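/- **Theorem.** Consider the following triply periodic polyhedral surfaces in $\mathbb{R}^3$, each modulo its lattice $\Lambda$ of translations; all faces are regarded as regular polygons with sides of length $1$, and $\{p,q\}$ means that the surface is tiled by $p$-gons, $q$ at every vertex. * *Mucube* $\{4,6\}$ ($12$ faces modulo $\Lambda=2\mathbb{Z}^3$): the boundary of the union of unit cubes placed at the points of $2\mathbb{Z}^3$ and of the cubes (square prisms) that join neighbouring ones along faces. * *Muoctahedron* $\{6,4\}$ ($8$ faces modulo $\Lambda=4\mathbb{Z}^3$): the hexagons of the truncated octahedra, with vertices the permutations of $(0,\pm1,\pm2)$, centred at the points of $4\mathbb{Z}^3$; neighbouring ones meet along squares. * *Mutetrahedron* $\{6,6\}$ ($4$ faces modulo $\Lambda$, the face-centred cubic lattice generated by $(0,4,4),(4,0,4),(4,4,0)$): the hexagons of the truncated tetrahedra, with vertices the permutations of $(\pm1,\pm1,\pm3)$ with an even number of minus signs, centred at the points of $\Lambda$; these are joined by tetrahedra along triangles. * *Octa-4* $\{3,8\}$ ($32$ faces modulo $\Lambda$): the boundary of the union of regular octahedra placed at the vertices of the diamond net and of the triangular antiprisms along its edges that join them along faces.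 * *Truncated Octa-8* $\{4,5\}$ ($30$ faces modulo $\Lambda$): the boundary of the union of truncated octahedra placed at the points of a body-centred cubic lattice $\Lambda$ and of the hexagonal prisms that join them along their hexagons. The *translation cover* of such a surface is a connected component of the translation surface obtained from copies of $X=\Pi/\Lambda$, rotated by the multiples of $2\pi/N$ ($N=4$ for square faces, $N=6$ for triangles and hexagons), by gluing their polygons along corresponding parallel sides by translations. For square faces it is tiled by unit squares. Otherwise (after dividing every hexagon into six triangles) it is tiled by rhombi consisting of two triangles, with sides $1$ and $\zeta$, and it is made square-tiled by the real linear map with $1\mapsto 1$, $\zeta\mapsto i$; here $\zeta=e^{\pi i/3}$ for Mutetrahedron and $\zeta=e^{2\pi i/3}$ for Muoctahedron and Octa-4. For each of these square-tiled translation surfaces (whichever component is chosen) the Veech group, that is, the stabilizer of the translation surface in $SL(2,\mathbb{R})$, is a subgroup $\Gamma$ of finite index in $SL(2,\mathbb{Z})$. The index, representatives of the cusps (the orbits of $\Gamma$ on $\mathbb{Q}\cup\{\infty\}$ under Möbius transformations, each listed exactly once), and the corresponding cusp widths are | | Index | Cusps | Cusp widths | |---|---|---|---| | Mucube | $9$ |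 $\infty,\ 1/2,\ 1$ | $4,\ 2,\ 3$ | | Muoctahedron | $16$ | $\infty,\ 1/5,\ 1/2,\ 1/7$ | $9,\ 1,\ 3,\ 3$ | | Mutetrahedron | $4$ | $\infty,\ 1$ | $3,\ 1$ | | Octa-4 | $4$ | $\infty,\ 1/2$ | $3,\ 1$ | | Truncated Octa-8 | $15$ | $\infty,\ 3,\ 1,\ 4$ | $6,\ 2,\ 3,\ 4$ | Here the width of the cusp $g\cdot\infty$, $g\in SL(2,\mathbb{Z})$, is the least $n>0$ with $\pm g\begin{pmatrix}1&n\\0&1\end{pmatrix}g^{-1}\in\Gamma$. -/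

import Mathlib

open scoped MatrixGroups

/-! ### Square-tiled surfaces and their Veech groups -/

/-- A square-tiled surface given by its horizontal and vertical permutations: the right side of the
square `i` is glued to the left side of the square `h i`, the top of the square `i` is glued to the
bottom of the square `v i`. -/
structure SquareTiled (ι : Type) where
  h : Equiv.Perm ι
  v : Equiv.Perm ι

namespace SquareTiled

/-- The closed unit square in the plane. -/
abbrev Square : Type := Set.Icc (0 : Fin 2 → ℝ) 1

variable {ι : Type} (O : SquareTiled ι)

/-- The gluing of the sides of the squares by translations. -/
inductive Glue : (Σ _ : ι, Square) → (Σ _ : ι, Square) → Prop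
  | right (i : ι) (p q : Square) (hp : p.1 0 = 1) (hq : q.1 0 = 0) (hpq : p.1 1 = q.1 1) :
      Glue ⟨i, p⟩ ⟨O.h i, q⟩
  | top (i : ι) (p q : Square) (hp : p.1 1 = 1) (hq : q.1 1 = 0) (hpq : p.1 0 = q.1 0) :
      Glue ⟨i, p⟩ ⟨O.v i, q⟩

/-- The surface obtained from the disjoint union of the squares, with the quotient topology. -/
abbrev Surface : Type := Quot O.Glue

/-- The point `p` of the square `i`, as a point of the surface. -/
def point (i : ι) (p : Square) : O.Surface := Quot.mk _ ⟨i, p⟩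

/-- `φ` is, on the open set `U`, a primitive of the holomorphic one-form `ω` of the surface, which
is `dz` on every square (`ℂ` is identified with `ℝ²`). Near a point that is not a zero of
`ω` such functions are exactly the translation charts of the surface (up to restriction). -/
def IsPrimitive (U : Set O.Surface) (φ : O.Surface → (Fin 2 → ℝ)) : Prop :=
  ∀ (i : ι) (p : Square), O.point i p ∈ U →
    ∀ᶠ q in nhds p, φ (O.point i q) - φ (O.point i p) = q.1 - p.1

/-- The homeomorphism `f` is affine with derivative `A`, that is, it is an isomorphism of
translation surfaces from `A • (X, ω)` to `(X, ω)`: it pulls the local primitives of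
`ω` back to `A` composed with the local primitives of `ω`. -/
def IsAffine (A : SL(2, ℝ)) (f : O.Surface ≃ₜ O.Surface) : Prop :=
  ∀ (U : Set O.Surface) (φ : O.Surface → (Fin 2 → ℝ)), IsOpen U →
    (O.IsPrimitive (f '' U) φ ↔
      O.IsPrimitive U (fun x => ((A⁻¹ : SL(2, ℝ)) : Matrix (Fin 2) (Fin 2) ℝ).mulVec (φ (f x))))

/-- The Veech group: the stabilizer of the translation surface under the action of `SL(2, ℝ)`,
that is, the group of derivatives of its affine homeomorphisms. -/
def veechGroup : Subgroup SL(2, ℝ) where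
  carrier := {A | ∃ f : O.Surface ≃ₜ O.Surface, O.IsAffine A f}
  one_mem' := ⟨Homeomorph.refl _, fun U φ _ => by simp⟩
  mul_mem' := by
    rintro A B ⟨f, hf⟩ ⟨g, hg⟩
    refine ⟨g.trans f, fun U φ hU => ?_⟩
    have h1 := hf (g '' U) φ (g.isOpenMap U hU)
    have h2 := hg U (fun x => ((A⁻¹ : SL(2, ℝ)) : Matrix (Fin 2) (Fin 2) ℝ).mulVec (φ (f x))) hU
    rw [Set.image_image] at h1
    simp only [mul_inv_rev, Matrix.SpecialLinearGroup.coe_mul, ← Matrix.mulVec_mulVec]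
    exact h1.trans h2
  inv_mem' := by
    rintro A ⟨f, hf⟩
    refine ⟨f.symm, fun U φ hU => ?_⟩
    have h := hf (f.symm '' U)
      (fun x => (A : Matrix (Fin 2) (Fin 2) ℝ).mulVec (φ (f.symm x))) (f.symm.isOpenMap U hU)
    have e : ∀ w : Fin 2 → ℝ, ((A⁻¹ : SL(2, ℝ)) : Matrix (Fin 2) (Fin 2) ℝ).mulVec
        ((A : Matrix (Fin 2) (Fin 2) ℝ).mulVec w) = w := fun w => by
      rw [Matrix.mulVec_mulVec, ← Matrix.SpecialLinearGroup.coe_mul]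
      simp
    simp only [Set.image_image, Homeomorph.apply_symm_apply, Set.image_id',
      Homeomorph.symm_apply_apply, e] at h
    simpa only [inv_inv] using h.symm

/-- The squares that can be reached from the square `i` by crossing sides. -/
def tiles (i : ι) : Set ι := MulAction.orbit (Subgroup.closure {O.h, O.v}) i

lemma mem_tiles_iff (i : ι) {σ : Equiv.Perm ι} (hσ : σ ∈ Subgroup.closure {O.h, O.v}) (j : ι) :
    σ j ∈ O.tiles i ↔ j ∈ O.tiles i := by
  have h : MulAction.orbit (Subgroup.closure {O.h, O.v}) (σ j) =
      MulAction.orbit (Subgroup.closure {O.h, O.v}) j :=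
    MulAction.orbit_smul (⟨σ, hσ⟩ : Subgroup.closure {O.h, O.v}) j
  unfold tiles
  rw [← MulAction.orbit_eq_iff, h, MulAction.orbit_eq_iff]

/-- The connected component of the square `i`. -/
def component (i : ι) : SquareTiled (O.tiles i) where
  h := O.h.subtypePerm (O.mem_tiles_iff i (Subgroup.subset_closure (by simp)))
  v := O.v.subtypePerm (O.mem_tiles_iff i (Subgroup.subset_closure (by simp)))

end SquareTiled

/-! ### Cusps -/

/-- `L` lists the cusps and the cusp widths of the subgroup `Γ` of `SL(2, ℤ)`: the first components
are representatives of the `Γ`-orbits of cusps, one for every orbit; the second components are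
the widths. Here `Γ` acts by Moebius transformations, and the width of the cusp `g • ∞`, where `g`
lies in `SL(2, ℤ)`, is the least `n > 0` such that `g T ^ n g⁻¹` or its negative lies in `Γ`. -/
structure IsCuspTable (Γ : Subgroup SL(2, ℤ)) (L : List (OnePoint ℝ × ℕ)) : Prop where
  card_eq : Nat.card (CuspOrbits (Γ : Subgroup (GL (Fin 2) ℝ))) = L.length
  isCusp : ∀ e ∈ L, IsCusp e.1 (Γ : Subgroup (GL (Fin 2) ℝ))
  existsUnique : ∀ c : OnePoint ℝ, IsCusp c (Γ : Subgroup (GL (Fin 2) ℝ)) →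
    ∃! e, e ∈ L ∧ ∃ γ ∈ (Γ : Subgroup (GL (Fin 2) ℝ)), γ • e.1 = c
  width : ∀ e ∈ L, ∀ g : SL(2, ℤ), Matrix.SpecialLinearGroup.mapGL ℝ g • OnePoint.infty = e.1 →
    IsLeast {n : ℕ | 0 < n ∧
      (g * ModularGroup.T ^ n * g⁻¹ ∈ Γ ∨ -(g * ModularGroup.T ^ n * g⁻¹) ∈ Γ)} e.2

/-- The Veech group of the square-tiled surface `O` is a subgroup of `SL(2, ℤ)` of index `n` with
the cusps and cusp widths listed in `L`. -/
def HasVeechData {ι : Type} (O : SquareTiled ι) (n : ℕ) (L : List (OnePoint ℝ × ℕ)) : Prop :=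
  ∃ Γ : Subgroup SL(2, ℤ),
    O.veechGroup = Γ.map (Matrix.SpecialLinearGroup.map (Int.castRingHom ℝ)) ∧
    Γ.FiniteIndex ∧ Γ.index = n ∧ IsCuspTable Γ L

/-! ### Polygonal surfaces and their translation covers -/

/-- A closed oriented surface glued from polygons, given by its darts (the sides of the polygons,
oriented counterclockwise): `next d` follows `d` on the boundary of its polygon, and `opp d` is the
side that is glued to `d` (with the opposite orientation). -/
structure DartMap (D : Type) where
  next : Equiv.Perm D
  opp : Equiv.Perm D

namespace DartMap

variable {D : Type} (M : DartMap D)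

/-- Every polygon is divided into triangles by joining its centre to its vertices. The triangle on
the side `d` has the sides `(d, 0)`, which is `d` itself, `(d, 1)` from the end point of `d` to the
centre, and `(d, 2)` from the centre to the initial point of `d`. -/
def subdivide : DartMap (D × Fin 3) where
  next := (Equiv.refl D).prodCongr (Equiv.addRight 1)
  opp :=
    { toFun := fun x => match x with
        | (d, 0) => (M.opp d, 0)
        | (d, 1) => (M.next d, 2)
        | (d, 2) => (M.next.symm d, 1)
      invFun := fun x => match x with
        | (d, 0) => (M.opp.symm d, 0)
        | (d, 1) => (M.next d, 2)
        | (d, 2) => (M.next.symm d, 1)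
      left_inv := by rintro ⟨d, i⟩; fin_cases i <;> simp
      right_inv := by rintro ⟨d, i⟩; fin_cases i <;> simp }

/-- The unfolding of a surface glued from unit-length regular `p`-gons, where `p` divides the even
number `N`: we take `N` copies of the surface, turned by the multiples of `2 * π / N`, and glue their
polygons along parallel sides by translations. The dart `(d, θ)` is the copy of `d` that has the
direction `2 * π * θ / N`. The connected components of the unfolding are the translation covers of
the surface; they differ by rotations only. -/
def unfold (N p : ℕ) : DartMap (D × ZMod N) where
  next := M.next.prodCongr (Equiv.addRight ((N / p : ℕ) : ZMod N))
  opp := M.opp.prodCongr (Equiv.addRight ((N / 2 : ℕ) : ZMod N))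

/-- The square-tiled surface of an unfolding by unit squares (`N = p = 4`). A square is named by its
lower side, the dart of direction `0`. We leave it through its right side, respectively its top, and
go to the lower side of the square reached. -/
def squares (M : DartMap D) : SquareTiled D where
  h := M.next * M.opp * M.next
  v := M.opp * M.next * M.next

/-- The square-tiled surface of an unfolding by equilateral triangles (`N = 6`, `p = 3`), which are
paired to rhombi with the sides `1` and `exp (π * I / 3)`; the linear map that sends these to `1` and
`I` makes the rhombi unit squares. A rhombus is named by its lower side, the dart of direction `0`.
The upper right half of the rhombus is the triangle across the side of direction `π * 2 / 3`. -/
def rhombi60 (M : DartMap D) : SquareTiled D where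
  h := M.next * M.opp * M.next * M.opp * M.next
  v := M.opp * M.next * M.next * M.opp * M.next

/-- The same with rhombi with the sides `1` and `exp (2 * π * I / 3)`, which are sent to `1` and
`I`. The upper left half of the rhombus is the triangle across the side of direction `π * 4 / 3`
of the triangle on the lower side. -/
def rhombi120 (M : DartMap D) : SquareTiled D where
  h := M.next * M.opp * M.next * M.opp * M.next
  v := M.opp * M.next * M.opp * M.next * M.next

end DartMap

/-! ### Triply periodic polyhedral surfaces -/

/-- The lattice `n ℤ³`. -/
def cubicLattice (n : ℤ) : AddSubgroup (ℤ × ℤ × ℤ) where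
  carrier := {x | n ∣ x.1 ∧ n ∣ x.2.1 ∧ n ∣ x.2.2}
  zero_mem' := by simp
  add_mem' := fun ha hb => ⟨dvd_add ha.1 hb.1, dvd_add ha.2.1 hb.2.1, dvd_add ha.2.2 hb.2.2⟩
  neg_mem' := fun ha => by simpa using ha

/-- The face-centred cubic lattice generated by `n (0, 1, 1)`, `n (1, 0, 1)` and `n (1, 1, 0)`. -/
def fccLattice (n : ℤ) : AddSubgroup (ℤ × ℤ × ℤ) where
  carrier := {x | n ∣ x.1 ∧ n ∣ x.2.1 ∧ n ∣ x.2.2 ∧ 2 * n ∣ x.1 + x.2.1 + x.2.2}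
  zero_mem' := by simp
  add_mem' := fun {a b} ha hb => ⟨dvd_add ha.1 hb.1, dvd_add ha.2.1 hb.2.1,
    dvd_add ha.2.2.1 hb.2.2.1, by
      have h := dvd_add ha.2.2.2 hb.2.2.2
      rwa [show a.1 + a.2.1 + a.2.2 + (b.1 + b.2.1 + b.2.2) =
        (a + b).1 + (a + b).2.1 + (a + b).2.2 by simp; ring] at h⟩
  neg_mem' := fun {a} ha => ⟨(dvd_neg).2 ha.1, (dvd_neg).2 ha.2.1, (dvd_neg).2 ha.2.2.1, by
      have h := (dvd_neg).2 ha.2.2.2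
      rwa [show -(a.1 + a.2.1 + a.2.2) = (-a).1 + (-a).2.1 + (-a).2.2 by simp; ring] at h⟩

/-- The body-centred cubic lattice generated by the vectors `n (±1, ±1, ±1)`. -/
def bccLattice (n : ℤ) : AddSubgroup (ℤ × ℤ × ℤ) where
  carrier := {x | n ∣ x.1 ∧ 2 * n ∣ x.1 - x.2.1 ∧ 2 * n ∣ x.1 - x.2.2}
  zero_mem' := by simp
  add_mem' := fun {a b} ha hb => ⟨dvd_add ha.1 hb.1, by
      have h := dvd_add ha.2.1 hb.2.1
      rwa [show a.1 - a.2.1 + (b.1 - b.2.1) = (a + b).1 - (a + b).2.1 by simp; ring] at h, by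
      have h := dvd_add ha.2.2 hb.2.2
      rwa [show a.1 - a.2.2 + (b.1 - b.2.2) = (a + b).1 - (a + b).2.2 by simp; ring] at h⟩
  neg_mem' := fun {a} ha => ⟨(dvd_neg).2 ha.1, by
      have h := (dvd_neg).2 ha.2.1
      rwa [show -(a.1 - a.2.1) = (-a).1 - (-a).2.1 by simp; ring] at h, by
      have h := (dvd_neg).2 ha.2.2
      rwa [show -(a.1 - a.2.2) = (-a).1 - (-a).2.2 by simp; ring] at h⟩

instance (n : ℤ) : DecidablePred (· ∈ cubicLattice n) := fun x =>
  inferInstanceAs (Decidable (n ∣ x.1 ∧ n ∣ x.2.1 ∧ n ∣ x.2.2))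

instance (n : ℤ) : DecidablePred (· ∈ fccLattice n) := fun x =>
  inferInstanceAs (Decidable (n ∣ x.1 ∧ n ∣ x.2.1 ∧ n ∣ x.2.2 ∧ 2 * n ∣ x.1 + x.2.1 + x.2.2))

instance (n : ℤ) : DecidablePred (· ∈ bccLattice n) := fun x =>
  inferInstanceAs (Decidable (n ∣ x.1 ∧ 2 * n ∣ x.1 - x.2.1 ∧ 2 * n ∣ x.1 - x.2.2))

/-- Let the vectors `face i j` be the vertices of polygons in space with `p` sides, in
counterclockwise order as seen from one side of the surface formed by their translates under the
lattice `Λ`. The sides `e` and `e'` are glued in the quotient by `Λ` if a vector of `Λ` translates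
`e` to `e'` with the opposite orientation. Here `(i, j)` is the side from `face i j` to
`face i (j + 1)`. -/
def SidesMatch {m p : ℕ} [NeZero p] (face : Fin m → Fin p → ℤ × ℤ × ℤ)
    (Λ : AddSubgroup (ℤ × ℤ × ℤ)) (e e' : Fin m × Fin p) : Prop :=
  face e'.1 (e'.2 + 1) - face e'.1 e'.2 = face e.1 e.2 - face e.1 (e.2 + 1) ∧
    face e'.1 e'.2 - face e.1 (e.2 + 1) ∈ Λ

instance {m p : ℕ} [NeZero p] (face : Fin m → Fin p → ℤ × ℤ × ℤ)
    (Λ : AddSubgroup (ℤ × ℤ × ℤ)) [DecidablePred (· ∈ Λ)] (e e' : Fin m × Fin p) :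
    Decidable (SidesMatch face Λ e e') :=
  inferInstanceAs (Decidable (_ ∧ _))

/-- A triply periodic polyhedral surface with `m` faces modulo its lattice `Λ` of translations, all
of them `p`-gons: the translates of the faces under `Λ` form the surface, and `opp` is the gluing of the
sides modulo `Λ`. -/
structure PeriodicSurface (m p : ℕ) [NeZero p] where
  face : Fin m → Fin p → ℤ × ℤ × ℤ
  Λ : AddSubgroup (ℤ × ℤ × ℤ)
  opp : Equiv.Perm (Fin m × Fin p)
  opp_match : ∀ e, SidesMatch face Λ e (opp e)

/-- The quotient by the lattice, as a surface glued from polygons. The polygons are regarded as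
regular with unit sides. -/
def PeriodicSurface.toDartMap {m p : ℕ} [NeZero p] (S : PeriodicSurface m p) :
    DartMap (Fin m × Fin p) where
  next := (Equiv.refl (Fin m)).prodCongr (Equiv.addRight 1)
  opp := S.opp

/-- Mucube `{4, 6}`: at the points of `2 ℤ³` there are unit cubes, joined by unit cubes (square
prisms) along their faces. The faces are the free sides of the prisms. -/
def mucubeFace : Fin 12 → Fin 4 → ℤ × ℤ × ℤ :=
  ![![(1, 0, 0), (2, 0, 0), (2, 0, 1), (1, 0, 1)],
    ![(1, 1, 0), (1, 1, 1), (2, 1, 1), (2, 1, 0)],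
    ![(1, 0, 0), (1, 1, 0), (2, 1, 0), (2, 0, 0)],
    ![(1, 0, 1), (2, 0, 1), (2, 1, 1), (1, 1, 1)],
    ![(0, 1, 0), (0, 1, 1), (0, 2, 1), (0, 2, 0)],
    ![(1, 1, 0), (1, 2, 0), (1, 2, 1), (1, 1, 1)],
    ![(0, 1, 0), (0, 2, 0), (1, 2, 0), (1, 1, 0)],
    ![(0, 1, 1), (1, 1, 1), (1, 2, 1), (0, 2, 1)],
    ![(0, 0, 1), (0, 0, 2), (0, 1, 2), (0, 1, 1)],
    ![(1, 0, 1), (1, 1, 1), (1, 1, 2), (1, 0, 2)],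
    ![(0, 0, 1), (1, 0, 1), (1, 0, 2), (0, 0, 2)],
    ![(0, 1, 1), (0, 1, 2), (1, 1, 2), (1, 1, 1)]]

/-- The gluing of the sides of Mucube: side `j` of face `i` is glued to the listed side. -/
def mucubeOpp : Fin 12 → Fin 4 → Fin 12 × Fin 4 :=
  ![![(2, 3), (4, 2), (3, 0), (5, 1)],
    ![(5, 3), (3, 2), (4, 0), (2, 1)],
    ![(9, 2), (1, 3), (8, 1), (0, 0)],
    ![(0, 2), (8, 3), (1, 1), (9, 0)],
    ![(1, 2), (7, 3), (0, 1), (6, 0)],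
    ![(6, 2), (0, 3), (7, 1), (1, 0)],
    ![(4, 3), (10, 2), (5, 0), (11, 1)],
    ![(11, 3), (5, 2), (10, 0), (4, 1)],
    ![(10, 3), (2, 2), (11, 0), (3, 1)],
    ![(3, 3), (11, 2), (2, 0), (10, 1)],
    ![(7, 2), (9, 3), (6, 1), (8, 0)],
    ![(8, 2), (6, 3), (9, 1), (7, 0)]]

/-- Mucube. -/
def mucube : PeriodicSurface 12 4 where
  face := mucubeFace
  Λ := cubicLattice 2
  opp := ⟨fun e => mucubeOpp e.1 e.2, fun e => mucubeOpp e.1 e.2,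
    by decide +kernel, by decide +kernel⟩
  opp_match := by decide +kernel

/-- Muoctahedron `{6, 4}`: truncated octahedra, centred at the points of `4 ℤ³`, with the vertices
`(0, ±1, ±2)` and their permutations, meet along their square faces. The faces are the
hexagons of the truncated octahedra. -/
def muoctahedronFace : Fin 8 → Fin 6 → ℤ × ℤ × ℤ :=
  ![![(2, 1, 0), (1, 2, 0), (0, 2, 1), (0, 1, 2), (1, 0, 2), (2, 0, 1)],
    ![(2, 1, 0), (2, 0, -1), (1, 0, -2), (0, 1, -2), (0, 2, -1), (1, 2, 0)],
    ![(0, -2, 1), (1, -2, 0), (2, -1, 0), (2, 0, 1), (1, 0, 2), (0, -1, 2)],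
    ![(0, -2, -1), (0, -1, -2), (1, 0, -2), (2, 0, -1), (2, -1, 0), (1, -2, 0)],
    ![(-1, 0, 2), (0, 1, 2), (0, 2, 1), (-1, 2, 0), (-2, 1, 0), (-2, 0, 1)],
    ![(0, 2, -1), (0, 1, -2), (-1, 0, -2), (-2, 0, -1), (-2, 1, 0), (-1, 2, 0)],
    ![(0, -2, 1), (0, -1, 2), (-1, 0, 2), (-2, 0, 1), (-2, -1, 0), (-1, -2, 0)],
    ![(0, -2, -1), (-1, -2, 0), (-2, -1, 0), (-2, 0, -1), (-1, 0, -2), (0, -1, -2)]]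

/-- The gluing of the sides of Muoctahedron: side `j` of face `i` is glued to the listed side. -/
def muoctahedronOpp : Fin 8 → Fin 6 → Fin 8 × Fin 6 :=
  ![![(1, 5), (2, 0), (4, 1), (1, 2), (2, 3), (4, 4)],
    ![(5, 3), (3, 2), (0, 3), (5, 0), (3, 5), (0, 0)],
    ![(0, 1), (3, 4), (6, 3), (0, 4), (3, 1), (6, 0)],
    ![(7, 5), (2, 4), (1, 1), (7, 2), (2, 1), (1, 4)],
    ![(5, 1), (0, 2), (6, 5), (5, 4), (0, 5), (6, 2)],
    ![(1, 3), (4, 0), (7, 3), (1, 0), (4, 3), (7, 0)],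
    ![(2, 5), (7, 4), (4, 5), (2, 2), (7, 1), (4, 2)],
    ![(5, 5), (6, 4), (3, 3), (5, 2), (6, 1), (3, 0)]]

/-- Muoctahedron. -/
def muoctahedron : PeriodicSurface 8 6 where
  face := muoctahedronFace
  Λ := cubicLattice 4
  opp := ⟨fun e => muoctahedronOpp e.1 e.2, fun e => muoctahedronOpp e.1 e.2,
    by decide +kernel, by decide +kernel⟩
  opp_match := by decide +kernel

/-- Mutetrahedron `{6, 6}`: truncated tetrahedra, centred at the points of the lattice, whose
vertices are the permutations of `(±1, ±1, ±3)` with an even number of minus signs, and tetrahedra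
(the translates of the one with the vertices `(3, 1, 1)`, `(1, 3, 1)`, `(1, 1, 3)`, `(3, 3, 3)`) meet
along triangles. The faces are the hexagons of the truncated tetrahedra. -/
def mutetrahedronFace : Fin 4 → Fin 6 → ℤ × ℤ × ℤ :=
  ![![(3, -1, -1), (1, -1, -3), (-1, 1, -3), (-1, 3, -1), (1, 3, 1), (3, 1, 1)],
    ![(3, -1, -1), (3, 1, 1), (1, 1, 3), (-1, -1, 3), (-1, -3, 1), (1, -3, -1)],
    ![(-3, -1, 1), (-1, -1, 3), (1, 1, 3), (1, 3, 1), (-1, 3, -1), (-3, 1, -1)],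
    ![(-3, -1, 1), (-3, 1, -1), (-1, 1, -3), (1, -1, -3), (1, -3, -1), (-1, -3, 1)]]

/-- The gluing of the sides of Mutetrahedron: side `j` of face `i` is glued to the listed side. -/
def mutetrahedronOpp : Fin 4 → Fin 6 → Fin 4 × Fin 6 :=
  ![![(2, 0), (3, 2), (1, 3), (2, 3), (3, 5), (1, 0)],
    ![(0, 5), (3, 1), (2, 1), (0, 2), (3, 4), (2, 4)],
    ![(0, 0), (1, 2), (3, 3), (0, 3), (1, 5), (3, 0)],
    ![(2, 5), (1, 1), (0, 1), (2, 2), (1, 4), (0, 4)]]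

/-- Mutetrahedron. -/
def mutetrahedron : PeriodicSurface 4 6 where
  face := mutetrahedronFace
  Λ := fccLattice 4
  opp := ⟨fun e => mutetrahedronOpp e.1 e.2, fun e => mutetrahedronOpp e.1 e.2,
    by decide +kernel, by decide +kernel⟩
  opp_match := by decide +kernel

/-- Octa-4 `{3, 8}`: regular octahedra with the vertices `±3 eᵢ` around the centres `0` and
`(4, 4, 4)`, modulo the lattice, are joined along four of their faces by triangular
antiprisms (regular octahedra with the centres `2 (1, 1, 1)`, `2 (1, -1, -1)`, `2 (-1, 1, -1)`,
`2 (-1, -1, 1)`). The faces are the remaining faces of the octahedra and the lateral faces of the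
antiprisms. -/
def octa4Face : Fin 32 → Fin 3 → ℤ × ℤ × ℤ :=
  ![![(7, 4, 4), (4, 7, 4), (4, 4, 7)],
    ![(3, 0, 0), (0, 3, 0), (4, 4, 1)],
    ![(3, 0, 0), (4, 1, 4), (0, 0, 3)],
    ![(3, 0, 0), (4, 4, 1), (4, 1, 4)],
    ![(1, 4, 4), (0, 3, 0), (0, 0, 3)],
    ![(1, 4, 4), (4, 4, 1), (0, 3, 0)],
    ![(1, 4, 4), (0, 0, 3), (4, 1, 4)],
    ![(3, 0, 0), (0, 0, -3), (0, 3, 0)],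
    ![(3, 0, 0), (0, 0, 3), (0, -3, 0)],
    ![(7, 4, 4), (4, 1, 4), (4, 4, 1)],
    ![(3, 0, 0), (0, -3, 0), (4, -4, -1)],
    ![(3, 0, 0), (4, -1, -4), (0, 0, -3)],
    ![(3, 0, 0), (4, -4, -1), (4, -1, -4)],
    ![(1, -4, -4), (0, -3, 0), (0, 0, -3)],
    ![(1, -4, -4), (4, -4, -1), (0, -3, 0)],
    ![(1, -4, -4), (0, 0, -3), (4, -1, -4)],
    ![(-3, 0, 0), (0, 0, 3), (0, 3, 0)],
    ![(1, 4, 4), (4, 7, 4), (4, 4, 1)],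
    ![(-3, 0, 0), (0, 3, 0), (-4, 4, -1)],
    ![(-3, 0, 0), (-4, 1, -4), (0, 0, -3)],
    ![(-3, 0, 0), (-4, 4, -1), (-4, 1, -4)],
    ![(-1, 4, -4), (0, 3, 0), (0, 0, -3)],
    ![(-1, 4, -4), (-4, 4, -1), (0, 3, 0)],
    ![(-1, 4, -4), (0, 0, -3), (-4, 1, -4)],
    ![(1, 4, 4), (4, 1, 4), (4, 4, 7)],
    ![(-3, 0, 0), (0, -3, 0), (-4, -4, 1)],
    ![(-3, 0, 0), (-4, -1, 4), (0, 0, 3)],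
    ![(-3, 0, 0), (-4, -4, 1), (-4, -1, 4)],
    ![(-1, -4, 4), (0, -3, 0), (0, 0, 3)],
    ![(-1, -4, 4), (-4, -4, 1), (0, -3, 0)],
    ![(-1, -4, 4), (0, 0, 3), (-4, -1, 4)],
    ![(-3, 0, 0), (0, 0, -3), (0, -3, 0)]]

/-- The gluing of the sides of Octa-4: side `j` of face `i` is glued to the listed side. -/
def octa4Opp : Fin 32 → Fin 3 → Fin 32 × Fin 3 :=
  ![![(30, 2), (12, 1), (22, 0)],
    ![(7, 2), (5, 1), (3, 0)],
    ![(3, 2), (6, 1), (8, 0)],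
    ![(1, 2), (9, 1), (2, 0)],
    ![(5, 2), (16, 1), (6, 0)],
    ![(17, 2), (1, 1), (4, 0)],
    ![(4, 2), (2, 1), (24, 0)],
    ![(11, 2), (21, 1), (1, 0)],
    ![(2, 2), (28, 1), (10, 0)],
    ![(23, 2), (3, 1), (29, 0)],
    ![(8, 2), (14, 1), (12, 0)],
    ![(12, 2), (15, 1), (7, 0)],
    ![(10, 2), (0, 1), (11, 0)],
    ![(14, 2), (31, 1), (15, 0)],
    ![(24, 2), (10, 1), (13, 0)],
    ![(13, 2), (11, 1), (17, 0)],
    ![(26, 2), (4, 1), (18, 0)],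
    ![(15, 2), (27, 1), (5, 0)],
    ![(16, 2), (22, 1), (20, 0)],
    ![(20, 2), (23, 1), (31, 0)],
    ![(18, 2), (24, 1), (19, 0)],
    ![(22, 2), (7, 1), (23, 0)],
    ![(0, 2), (18, 1), (21, 0)],
    ![(21, 2), (19, 1), (9, 0)],
    ![(6, 2), (20, 1), (14, 0)],
    ![(31, 2), (29, 1), (27, 0)],
    ![(27, 2), (30, 1), (16, 0)],
    ![(25, 2), (17, 1), (26, 0)],
    ![(29, 2), (8, 1), (30, 0)],
    ![(9, 2), (25, 1), (28, 0)],
    ![(28, 2), (26, 1), (0, 0)],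
    ![(19, 2), (13, 1), (25, 0)]]

/-- Octa-4. -/
def octa4 : PeriodicSurface 32 3 where
  face := octa4Face
  Λ := fccLattice 8
  opp := ⟨fun e => octa4Opp e.1 e.2, fun e => octa4Opp e.1 e.2,
    by decide +kernel, by decide +kernel⟩
  opp_match := by decide +kernel

/-- Truncated Octa-8 `{4, 5}`: truncated octahedra, centred at the points of the lattice, with the
vertices `(0, ±1, ±2)` and their permutations, are joined along their hexagons by hexagonal
prisms. The faces are the squares of the truncated octahedra and the lateral faces of the prisms.
(The height of the prisms is scaled here so that all vertices are integral; this does not change how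
the faces are glued.) -/
def truncatedOcta8Face : Fin 30 → Fin 4 → ℤ × ℤ × ℤ :=
  ![![(2, 1, 0), (1, 2, 0), (2, 3, 1), (3, 2, 1)],
    ![(1, 2, 0), (0, 2, 1), (1, 3, 2), (2, 3, 1)],
    ![(0, 2, 1), (0, 1, 2), (1, 2, 3), (1, 3, 2)],
    ![(0, 1, 2), (1, 0, 2), (2, 1, 3), (1, 2, 3)],
    ![(1, 0, 2), (2, 0, 1), (3, 1, 2), (2, 1, 3)],
    ![(2, 0, 1), (2, 1, 0), (3, 2, 1), (3, 1, 2)],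
    ![(2, 1, 0), (2, 0, -1), (3, 1, -2), (3, 2, -1)],
    ![(2, 0, -1), (1, 0, -2), (2, 1, -3), (3, 1, -2)],
    ![(1, 0, -2), (0, 1, -2), (1, 2, -3), (2, 1, -3)],
    ![(0, 1, -2), (0, 2, -1), (1, 3, -2), (1, 2, -3)],
    ![(0, 2, -1), (1, 2, 0), (2, 3, -1), (1, 3, -2)],
    ![(1, 2, 0), (2, 1, 0), (3, 2, -1), (2, 3, -1)],
    ![(0, -2, 1), (1, -2, 0), (2, -3, 1), (1, -3, 2)],
    ![(1, -2, 0), (2, -1, 0), (3, -2, 1), (2, -3, 1)],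
    ![(2, -1, 0), (2, 0, 1), (3, -1, 2), (3, -2, 1)],
    ![(2, 0, 1), (1, 0, 2), (2, -1, 3), (3, -1, 2)],
    ![(1, 0, 2), (0, -1, 2), (1, -2, 3), (2, -1, 3)],
    ![(0, -1, 2), (0, -2, 1), (1, -3, 2), (1, -2, 3)],
    ![(0, -2, -1), (0, -1, -2), (1, -2, -3), (1, -3, -2)],
    ![(0, -1, -2), (1, 0, -2), (2, -1, -3), (1, -2, -3)],
    ![(1, 0, -2), (2, 0, -1), (3, -1, -2), (2, -1, -3)],
    ![(2, 0, -1), (2, -1, 0), (3, -2, -1), (3, -1, -2)],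
    ![(2, -1, 0), (1, -2, 0), (2, -3, -1), (3, -2, -1)],
    ![(1, -2, 0), (0, -2, -1), (1, -3, -2), (2, -3, -1)],
    ![(2, 1, 0), (2, 0, 1), (2, -1, 0), (2, 0, -1)],
    ![(-2, -1, 0), (-2, 0, 1), (-2, 1, 0), (-2, 0, -1)],
    ![(0, 2, 1), (1, 2, 0), (0, 2, -1), (-1, 2, 0)],
    ![(1, -2, 0), (0, -2, 1), (-1, -2, 0), (0, -2, -1)],
    ![(0, 1, 2), (-1, 0, 2), (0, -1, 2), (1, 0, 2)],
    ![(0, -1, -2), (-1, 0, -2), (0, 1, -2), (1, 0, -2)]]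

/-- The gluing of the sides of Truncated Octa-8: side `j` of face `i` is glued to the listed side. -/
def truncatedOcta8Opp : Fin 30 → Fin 4 → Fin 30 × Fin 4 :=
  ![![(11, 0), (1, 3), (29, 0), (5, 1)],
    ![(26, 0), (2, 3), (12, 2), (0, 1)],
    ![(21, 2), (3, 3), (25, 3), (1, 1)],
    ![(28, 3), (4, 3), (8, 2), (2, 1)],
    ![(15, 0), (5, 3), (27, 2), (3, 1)],
    ![(24, 0), (0, 3), (18, 0), (4, 1)],
    ![(24, 3), (7, 3), (17, 0), (11, 1)],
    ![(20, 0), (8, 3), (27, 1), (6, 1)],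
    ![(29, 2), (9, 3), (3, 2), (7, 1)],
    ![(14, 2), (10, 3), (25, 0), (8, 1)],
    ![(26, 1), (11, 3), (23, 2), (9, 1)],
    ![(0, 0), (6, 3), (28, 1), (10, 1)],
    ![(27, 0), (13, 3), (1, 2), (17, 1)],
    ![(22, 0), (14, 3), (29, 1), (12, 1)],
    ![(24, 1), (15, 3), (9, 0), (13, 1)],
    ![(4, 0), (16, 3), (26, 2), (14, 1)],
    ![(28, 2), (17, 3), (19, 2), (15, 1)],
    ![(6, 2), (12, 3), (25, 2), (16, 1)],
    ![(5, 2), (19, 3), (25, 1), (23, 1)],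
    ![(29, 3), (20, 3), (16, 2), (18, 1)],
    ![(7, 0), (21, 3), (26, 3), (19, 1)],
    ![(24, 2), (22, 3), (2, 0), (20, 1)],
    ![(13, 0), (23, 3), (28, 0), (21, 1)],
    ![(27, 3), (18, 3), (10, 2), (22, 1)],
    ![(5, 0), (14, 0), (21, 0), (6, 0)],
    ![(9, 2), (18, 2), (17, 2), (2, 2)],
    ![(1, 0), (10, 0), (15, 2), (20, 2)],
    ![(12, 0), (7, 2), (4, 2), (23, 0)],
    ![(22, 2), (11, 2), (16, 0), (3, 0)],
    ![(0, 2), (13, 2), (8, 0), (19, 0)]]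

/-- Truncated Octa-8. -/
def truncatedOcta8 : PeriodicSurface 30 4 where
  face := truncatedOcta8Face
  Λ := bccLattice 3
  opp := ⟨fun e => truncatedOcta8Opp e.1 e.2, fun e => truncatedOcta8Opp e.1 e.2,
    by decide +kernel, by decide +kernel⟩
  opp_match := by decide +kernel

/-! ### The square-tiled translation covers

The translation cover is the component, in the square-tiled unfolding, of the square (or rhombus)
whose lower side is a given dart `d`, placed in direction `0`. -/

/-- The translation cover of a surface tiled by squares. -/
def squareCover {D : Type} (M : DartMap D) (d : D) :=
  (M.unfold 4 4).squares.component (d, 0)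

/-- The translation cover of a surface tiled by equilateral triangles, made square-tiled by means of
rhombi with the angle `π / 3`. -/
def rhombusCover60 {D : Type} (M : DartMap D) (d : D) :=
  (M.unfold 6 3).rhombi60.component (d, 0)

/-- The translation cover of a surface tiled by equilateral triangles, made square-tiled by means of
rhombi with the angle `2 * π / 3`. -/
def rhombusCover120 {D : Type} (M : DartMap D) (d : D) :=
  (M.unfold 6 3).rhombi120.component (d, 0)

/-! The Veech group is computed as the stabilizer of a point in a finite orbit of `SL(2, ℤ)` on
square-tiled surfaces up to relabelling.

The generators `S` and `T` act on pairs `(h, v)` by `rotate` and `shear`. Cutting the squares and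
reassembling them gives genuine affine homeomorphisms with these derivatives
(`affinelyEquivalent_rotate`, `affinelyEquivalent_shear`). The converse is a rigidity statement. An
affine homeomorphism matches the points without a translation chart, and these are lattice points.
If some horizontal and some vertical side have two singular ends, the images of these sides are
lattice vectors, so the derivative is integral (`IsAffineBetween.exists_int`). If the derivative is
`1` and there is a singular point, positions modulo `ℤ²` are preserved, so centres of squares go to
centres of squares, neighbours to neighbours, and the homeomorphism comes from a relabelling
(`IsAffineBetween.exists_isTileMap`). Hence the Veech group is the image of a subgroup `Γ` of `SL(2,
ℤ)` whose left cosets are the points of the orbit (`IsInvariantFamily.exists_stabilizer`), and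
`Γ.index` is the size of the orbit.

Cusps correspond to double cosets of `Γ` and `±⟨T⟩`. After inversion these are the orbits of `T` on
the left cosets, and the width is the length of the orbit (`isCuspTable_of_isOrbitTable`). So the
permutations `σ` and `τ` by which `S` and `T` act on the orbit determine the whole table.

For the five surfaces the rest is a finite verification. The moves `h` and `v` preserve the
direction of a dart, so the squares of the unfolding can be numbered by the darts of the polyhedral
surface alone. One numbering identifies all components with the same table (`IsLabelling`), which is
why the choice of component does not matter. Explicit relabellings confirm `σ` and `τ`. The members
of the orbit are told apart by whether `h ^ p = 1` after certain words in `S` and `T`. -/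

/-! ### Coordinates on a square-tiled surface -/

namespace SquareTiled

open Filter Topology

variable {ι κ μ : Type}

/-- The permutation that is used to leave a square in the `k`-th coordinate direction. -/
def side (O : SquareTiled ι) (k : Fin 2) : Equiv.Perm ι := ![O.h, O.v] k

lemma point_eq_of_side (O : SquareTiled ι) (k : Fin 2) (i : ι) (p q : Square) (hp : p.1 k = 1)
    (hq : q.1 k = 0) (hpq : ∀ l, l ≠ k → p.1 l = q.1 l) :
    O.point i p = O.point (O.side k i) q := by
  fin_cases k
  · exact Quot.sound (Glue.right i p q hp hq (hpq 1 (by decide)))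
  · exact Quot.sound (Glue.top i p q hp hq (hpq 0 (by decide)))

lemma Glue.exists_side {O : SquareTiled ι} {x y : Σ _ : ι, Square} (h : O.Glue x y) :
    ∃ k : Fin 2, y.1 = O.side k x.1 ∧ x.2.1 k = 1 ∧ y.2.1 k = 0 ∧
      ∀ l, l ≠ k → x.2.1 l = y.2.1 l := by
  cases h with
  | right i p q hp hq hpq =>
    refine ⟨0, rfl, hp, hq, fun l hl => ?_⟩
    obtain rfl : l = 1 := by omega
    exact hpq
  | top i p q hp hq hpq =>
    refine ⟨1, rfl, hp, hq, fun l hl => ?_⟩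
    obtain rfl : l = 0 := by omega
    exact hpq

lemma exists_point (O : SquareTiled ι) (x : O.Surface) : ∃ i p, x = O.point i p := by
  obtain ⟨⟨i, p⟩, rfl⟩ := Quot.exists_rep x
  exact ⟨i, p, rfl⟩

lemma continuous_point (O : SquareTiled ι) (i : ι) : Continuous (O.point i) :=
  continuous_quot_mk.comp continuous_sigmaMk

lemma isOpen_iff_point (O : SquareTiled ι) (U : Set O.Surface) :
    IsOpen U ↔ ∀ i, IsOpen (O.point i ⁻¹' U) := by
  rw [← isQuotientMap_quot_mk.isOpen_preimage, isOpen_sigma_iff]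
  rfl

lemma continuous_iff_point (O : SquareTiled ι) {X : Type} [TopologicalSpace X] (f : O.Surface → X) :
    Continuous f ↔ ∀ i, Continuous fun p => f (O.point i p) := by
  rw [isQuotientMap_quot_mk.continuous_iff, continuous_sigma_iff]
  rfl

lemma continuous_square_apply (l : Fin 2) : Continuous fun p : Square => p.1 l :=
  (continuous_apply l).comp continuous_subtype_val

/-! ### Position modulo the lattice and the primitives obtained from it -/

/-- The position of a point modulo the lattice `ℤ²`. -/
def coord (O : SquareTiled ι) : O.Surface → Fin 2 → UnitAddCircle :=
  Quot.lift (fun x l => (x.2.1 l : UnitAddCircle)) fun x y h => by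
    obtain ⟨k, -, hx, hy, hxy⟩ := h.exists_side
    funext l
    rcases eq_or_ne l k with rfl | hl
    · simp only [hx, hy, AddCircle.coe_zero]
      exact AddCircle.coe_period 1
    · rw [hxy l hl]

@[simp] lemma coord_point (O : SquareTiled ι) (i : ι) (p : Square) (l : Fin 2) :
    O.coord (O.point i p) l = (p.1 l : UnitAddCircle) := rfl

/-- The representative of the position, relative to `b`, in `[0, 1) ^ 2`. -/
noncomputable def liftFrom (O : SquareTiled ι) (b : Fin 2 → ℝ) : O.Surface → Fin 2 → ℝ :=
  Quot.lift (fun x l => Int.fract (x.2.1 l - b l)) fun x y h => by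
    obtain ⟨k, -, hx, hy, hxy⟩ := h.exists_side
    funext l
    rcases eq_or_ne l k with rfl | hl
    · simp only [hx, hy]
      rw [Int.fract_eq_fract]
      exact ⟨1, by simp⟩
    · rw [hxy l hl]

lemma liftFrom_point (O : SquareTiled ι) (b : Fin 2 → ℝ) (i : ι) (p : Square) (l : Fin 2) :
    O.liftFrom b (O.point i p) l = Int.fract (p.1 l - b l) := rfl

lemma coe_liftFrom (O : SquareTiled ι) (b : Fin 2 → ℝ) (x : O.Surface) (l : Fin 2) :
    (O.liftFrom b x l : UnitAddCircle) = O.coord x l - (b l : UnitAddCircle) := by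
  obtain ⟨i, p, rfl⟩ := O.exists_point x
  rw [liftFrom_point, coord_point, ← AddCircle.coe_sub, ← sub_eq_zero, ← AddCircle.coe_sub,
    AddCircle.coe_eq_zero_iff]
  refine ⟨-⌊p.1 l - b l⌋, ?_⟩
  rw [Int.fract]
  simp

/-- The points whose coordinates are different from those of `b` modulo `ℤ²`. -/
def liftDomain (O : SquareTiled ι) (b : Fin 2 → ℝ) : Set O.Surface :=
  {x | ∀ l, O.liftFrom b x l ≠ 0}

lemma isOpen_liftDomain (O : SquareTiled ι) (b : Fin 2 → ℝ) : IsOpen (O.liftDomain b) := by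
  rw [isOpen_iff_point]
  intro i
  have h : IsOpen {r : ℝ | Int.fract r ≠ 0} := by
    have : {r : ℝ | Int.fract r ≠ 0} = (Set.range ((↑) : ℤ → ℝ))ᶜ := by
      ext r
      simp [Int.fract_eq_zero_iff]
    rw [this]
    exact Int.isClosedEmbedding_coe_real.isClosed_range.isOpen_compl
  have : O.point i ⁻¹' O.liftDomain b = ⋂ l, {p : Square | Int.fract (p.1 l - b l) ≠ 0} := by
    ext p
    simp [liftDomain, liftFrom_point]
  rw [this]
  exact isOpen_iInter_of_finite fun l =>
    h.preimage ((continuous_square_apply l).sub continuous_const)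

/-- Away from the integers the floor is locally constant, so taking the fractional part does not
change increments. The offset `b` is free, so that the jumps can be moved away from any given point.
-/
lemma isPrimitive_liftFrom (O : SquareTiled ι) (b : Fin 2 → ℝ) :
    O.IsPrimitive (O.liftDomain b) (O.liftFrom b) := by
  intro i p hp
  have h : ∀ l, ∀ᶠ q : Square in 𝓝 p, ⌊q.1 l - b l⌋ = ⌊p.1 l - b l⌋ := fun l => by
    have hl : Int.fract (p.1 l - b l) ≠ 0 := hp l
    have hc : Continuous fun q : Square => q.1 l - b l :=
      (continuous_square_apply l).sub continuous_const
    have hm : Set.Ioo (⌊p.1 l - b l⌋ : ℝ) (⌊p.1 l - b l⌋ + 1) ∈ 𝓝 (p.1 l - b l) :=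
      Ioo_mem_nhds (lt_of_le_of_ne (Int.floor_le _) fun h => hl (by rw [Int.fract, h, sub_self]))
        (Int.lt_floor_add_one _)
    filter_upwards [hc.continuousAt hm] with q hq
    exact Int.floor_eq_iff.2 ⟨hq.1.le, hq.2⟩
  filter_upwards [h 0, h 1] with q h0 h1
  have hl : ∀ l, ⌊q.1 l - b l⌋ = ⌊p.1 l - b l⌋ := by
    intro l
    fin_cases l
    · exact h0
    · exact h1
  funext l
  simp only [Pi.sub_apply, liftFrom_point, Int.fract, hl l]
  ring

lemma IsPrimitive.mono {O : SquareTiled ι} {U V : Set O.Surface} {φ : O.Surface → Fin 2 → ℝ}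
    (h : O.IsPrimitive V φ) (hUV : U ⊆ V) : O.IsPrimitive U φ :=
  fun i p hp => h i p (hUV hp)

/-! ### Strips across the sides and their labels -/

open Classical in
/-- The square `i` labels the points beyond the line where the `k`-th coordinate is `c` in this
square, and the points before this line in the next square. Points on horizontal (if `k = 0`) or
vertical (if `k = 1`) sides have no label. -/
noncomputable def label (O : SquareTiled ι) (k : Fin 2) {c : ℝ} (hc : c ∈ Set.Ioo (0 : ℝ) 1) :
    O.Surface → Option ι :=
  Quot.lift (fun x => if ∀ l, l ≠ k → x.2.1 l ∈ Set.Ioo (0 : ℝ) 1 then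
      if c < x.2.1 k then some x.1 else if x.2.1 k < c then some ((O.side k).symm x.1) else none
    else none) fun x y h => by
    obtain ⟨k', hi, hx, hy, hxy⟩ := h.exists_side
    rcases eq_or_ne k k' with rfl | hk
    · have : (∀ l, l ≠ k → x.2.1 l ∈ Set.Ioo (0 : ℝ) 1) ↔
          ∀ l, l ≠ k → y.2.1 l ∈ Set.Ioo (0 : ℝ) 1 :=
        forall₂_congr fun l hl => by rw [hxy l hl]
      simp only [this, hx, hy, hi, hc.1, hc.2, hc.1.not_gt, if_true, if_false,
        Equiv.symm_apply_apply]
    · rw [if_neg fun h => by simpa [hx] using h k' hk.symm,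
        if_neg fun h => by simpa [hy] using h k' hk.symm]

open Classical in
lemma label_point (O : SquareTiled ι) (k : Fin 2) {c : ℝ} (hc : c ∈ Set.Ioo (0 : ℝ) 1) (i : ι)
    (p : Square) : O.label k hc (O.point i p) =
      if ∀ l, l ≠ k → p.1 l ∈ Set.Ioo (0 : ℝ) 1 then
        if c < p.1 k then some i else if p.1 k < c then some ((O.side k).symm i) else none
      else none := rfl

lemma label_point_eq_some_iff (O : SquareTiled ι) (k : Fin 2) {c : ℝ} (hc : c ∈ Set.Ioo (0 : ℝ) 1)
    (i j : ι) (p : Square) : O.label k hc (O.point i p) = some j ↔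
      (∀ l, l ≠ k → p.1 l ∈ Set.Ioo (0 : ℝ) 1) ∧
        (c < p.1 k ∧ i = j ∨ p.1 k < c ∧ i = O.side k j) := by
  rw [label_point]
  split_ifs with h1 h2 h3
  · rw [and_iff_right h1]
    simp [h2, h2.not_gt]
  · rw [and_iff_right h1]
    simp [h2, h3, Equiv.symm_apply_eq]
  · simp [h2, h3]
  · simp only [h1, false_and]

lemma isOpen_label (O : SquareTiled ι) (k : Fin 2) {c : ℝ} (hc : c ∈ Set.Ioo (0 : ℝ) 1) (j : ι) :
    IsOpen {x | O.label k hc x = some j} := by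
  rw [isOpen_iff_point]
  intro i
  simp only [Set.preimage_ofPred_eq, label_point_eq_some_iff, Set.ofPred_and, Set.ofPred_or,
    Set.ofPred_forall]
  exact (isOpen_iInter_of_finite fun l => isOpen_iInter_of_finite fun _ =>
    isOpen_Ioo.preimage (continuous_square_apply l)).inter
    (((isOpen_lt continuous_const (continuous_square_apply k)).inter isOpen_const).union
      ((isOpen_lt (continuous_square_apply k) continuous_const).inter isOpen_const))

lemma _root_.UnitAddCircle.coe_eq_coe_iff_of_mem_Icc {a b : ℝ} (ha : a ∈ Set.Icc (0 : ℝ) 1)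
    (hb : b ∈ Set.Icc (0 : ℝ) 1) (h : (a : UnitAddCircle) = b) :
    a = b ∨ (a = 1 ∧ b = 0) ∨ (a = 0 ∧ b = 1) := by
  rw [← sub_eq_zero, ← AddCircle.coe_sub, AddCircle.coe_eq_zero_iff] at h
  obtain ⟨n, hn⟩ := h
  rw [zsmul_eq_mul, mul_one] at hn
  have h1 : n ≤ 1 := by
    have : (n : ℝ) ≤ 1 := by linarith [ha.2, hb.1]
    exact_mod_cast this
  have h2 : -1 ≤ n := by
    have : (-1 : ℝ) ≤ n := by linarith [ha.1, hb.2]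
    exact_mod_cast this
  have h3 : n = -1 ∨ n = 0 ∨ n = 1 := by omega
  rcases h3 with rfl | rfl | rfl
  · right; right
    push_cast at hn
    constructor <;> linarith [ha.1, hb.2, ha.2, hb.1]
  · left
    push_cast at hn
    linarith
  · right; left
    push_cast at hn
    constructor <;> linarith [ha.1, hb.2, ha.2, hb.1]

lemma mem_Icc_coord (p : Square) (l : Fin 2) : p.1 l ∈ Set.Icc (0 : ℝ) 1 :=
  ⟨p.2.1 l, p.2.2 l⟩

/-- The points with a given label form an open strip of length `1` across the side that separates
two consecutive squares. On such a strip the position modulo `ℤ²` is injective: where it leaves the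
choice between the values `0` and `1` of the `k`-th coordinate, the two points are glued. -/
lemma eq_of_label_eq_of_coord_eq (O : SquareTiled ι) (k : Fin 2) {c : ℝ}
    (hc : c ∈ Set.Ioo (0 : ℝ) 1) {x y : O.Surface} {j : ι} (hx : O.label k hc x = some j)
    (hy : O.label k hc y = some j) (hxy : O.coord x = O.coord y) : x = y := by
  obtain ⟨i, p, rfl⟩ := O.exists_point x
  obtain ⟨i', q, rfl⟩ := O.exists_point y
  rw [label_point_eq_some_iff] at hx hy
  have hl : ∀ l, l ≠ k → p.1 l = q.1 l := fun l hl => by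
    have h1 := hx.1 l hl
    have h2 := hy.1 l hl
    rcases UnitAddCircle.coe_eq_coe_iff_of_mem_Icc (mem_Icc_coord p l) (mem_Icc_coord q l)
      (congrFun hxy l) with h | h | h
    · exact h
    · linarith [h1.2, h.1]
    · linarith [h1.1, h.1]
  have hk := UnitAddCircle.coe_eq_coe_iff_of_mem_Icc (mem_Icc_coord p k) (mem_Icc_coord q k)
      (congrFun hxy k)
  have heq : p.1 k = q.1 k → p = q := fun h => Subtype.ext (funext fun l => by
    rcases eq_or_ne l k with rfl | h'
    · exact h
    · exact hl l h')
  rcases hx.2 with ⟨h1, rfl⟩ | ⟨h1, rfl⟩ <;> rcases hy.2 with ⟨h2, rfl⟩ | ⟨h2, rfl⟩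
  · rw [heq]
    rcases hk with h | h | h
    · exact h
    · linarith [hc.1]
    · linarith [hc.1]
  · rcases hk with h | h | h
    · linarith
    · exact O.point_eq_of_side k i p q h.1 h.2 hl
    · linarith [hc.1]
  · rcases hk with h | h | h
    · linarith
    · linarith [hc.1]
    · exact (O.point_eq_of_side k i' q p h.2 h.1 fun l hl' => (hl l hl').symm).symm
  · rw [heq]
    rcases hk with h | h | h
    · exact h
    · linarith [hc.2]
    · linarith [hc.2]

/-! ### Regular and singular points -/

/-- A point is regular if a translation chart exists near it. -/
def IsRegularPoint (O : SquareTiled ι) (x : O.Surface) : Prop :=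
  ∃ U φ, IsOpen U ∧ x ∈ U ∧ O.IsPrimitive U φ ∧ Set.InjOn φ U

/-- The strip of a label carries a chart: with offset `c` in direction `k` and `0` in the other one,
the jumps of `liftFrom` lie on the boundary of the strip. -/
lemma isRegularPoint_of_label_eq_some (O : SquareTiled ι) (k : Fin 2) {c : ℝ}
    (hc : c ∈ Set.Ioo (0 : ℝ) 1) {x : O.Surface} {j : ι} (hx : O.label k hc x = some j) :
    O.IsRegularPoint x := by
  set b : Fin 2 → ℝ := Pi.single k c
  refine ⟨{x | O.label k hc x = some j}, O.liftFrom b, O.isOpen_label k hc j, hx,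
    (O.isPrimitive_liftFrom b).mono fun y hy l => ?_, fun y hy z hz hyz =>
      O.eq_of_label_eq_of_coord_eq k hc hy hz <| funext fun l => ?_⟩
  · obtain ⟨i, p, rfl⟩ := O.exists_point y
    rw [Set.mem_ofPred_eq, label_point_eq_some_iff] at hy
    rw [liftFrom_point]
    have hfract : ∀ r : ℝ, -1 < r → r < 1 → r ≠ 0 → Int.fract r ≠ 0 := fun r h1 h2 h3 h => by
      rw [Int.fract_eq_zero_iff] at h
      obtain ⟨n, rfl⟩ := h
      have h1' : -1 < n := by exact_mod_cast h1
      have h2' : n < 1 := by exact_mod_cast h2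
      exact h3 (by exact_mod_cast (show n = 0 by omega))
    rcases eq_or_ne l k with rfl | hl
    · have := mem_Icc_coord p l
      have hb : b l = c := Pi.single_eq_same (M := fun _ => ℝ) l c
      rw [hb]
      refine hfract _ (by linarith [this.1, hc.2]) (by linarith [this.2, hc.1]) ?_
      rcases hy.2 with h | h
      · linarith [h.1]
      · linarith [h.1]
    · have := hy.1 l hl
      have hb : b l = 0 := Pi.single_eq_of_ne (M := fun _ => ℝ) hl c
      rw [hb, sub_zero]
      exact hfract _ (by linarith [this.1]) (by linarith [this.2]) (by linarith [this.1])
  · have := congrFun hyz l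
    have h2 := O.coe_liftFrom b y l
    rw [this, O.coe_liftFrom b z l] at h2
    exact (sub_left_inj.1 h2).symm

lemma coord_eq_zero_of_not_isRegularPoint (O : SquareTiled ι) {x : O.Surface}
    (hx : ¬ O.IsRegularPoint x) (l : Fin 2) : O.coord x l = 0 := by
  obtain ⟨i, p, rfl⟩ := O.exists_point x
  have hp := mem_Icc_coord p l
  by_cases h0 : p.1 l = 0
  · simp [h0]
  by_cases h1 : p.1 l = 1
  · rw [coord_point, h1]
    exact AddCircle.coe_period 1
  exfalso
  apply hx
  obtain ⟨k, hk⟩ : ∃ k : Fin 2, ∀ l', l' ≠ k → l' = l := ⟨1 - l, by omega⟩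
  have hlIoo : ∀ l', l' ≠ k → p.1 l' ∈ Set.Ioo (0 : ℝ) 1 := fun l' hl' => by
    rw [hk l' hl']
    exact ⟨lt_of_le_of_ne hp.1 (Ne.symm h0), lt_of_le_of_ne hp.2 h1⟩
  have hpk := mem_Icc_coord p k
  -- The line must avoid the point, so its position depends on the half of the square that contains
  -- the point.
  by_cases h : p.1 k < 1 / 2
  · exact O.isRegularPoint_of_label_eq_some k (c := 1 / 2) (by norm_num)
      ((O.label_point_eq_some_iff k _ i ((O.side k).symm i) p).2 ⟨hlIoo, Or.inr ⟨h, by simp⟩⟩)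
  · exact O.isRegularPoint_of_label_eq_some k (c := 1 / 3) (by norm_num)
      ((O.label_point_eq_some_iff k _ i i p).2 ⟨hlIoo, Or.inl ⟨by linarith, rfl⟩⟩)

/-- The upper right corner of a square. -/
def corner : Square := ⟨1, by simp, le_rfl⟩

/-- Two different squares have this point as their lower left corner. A primitive takes equal values
at corresponding points of their diagonals near the corner, so it is not injective. -/
lemma not_isRegularPoint_corner (O : SquareTiled ι) {i : ι} (hi : O.h (O.v i) ≠ O.v (O.h i)) :
    ¬ O.IsRegularPoint (O.point i corner) := by
  rintro ⟨U, φ, hU, hx, hφ, hinj⟩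
  let o : Square := ⟨0, le_rfl, by simp⟩
  let m (l : Fin 2) : Square := ⟨Pi.single l 1, by
    constructor <;> intro j <;> by_cases h : j = l <;> simp [h]⟩
  have hm : ∀ l l', (m l).1 l' = if l' = l then 1 else 0 := fun l l' => by
    simp [m, Pi.single_apply]
  have e1 : O.point i corner = O.point (O.v (O.h i)) o :=
    (O.point_eq_of_side 0 i corner (m 1) rfl (by simp [hm])
      (fun l hl => by obtain rfl : l = 1 := by omega
                      simp [hm, corner])).trans
      (O.point_eq_of_side 1 _ (m 1) o (by simp [hm]) rfl
        (fun l hl => by simp [hm, hl, o]))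
  have e2 : O.point i corner = O.point (O.h (O.v i)) o :=
    (O.point_eq_of_side 1 i corner (m 0) rfl (by simp [hm])
      (fun l hl => by obtain rfl : l = 0 := by omega
                      simp [hm, corner])).trans
      (O.point_eq_of_side 0 _ (m 0) o (by simp [hm]) rfl
        (fun l hl => by simp [hm, hl, o]))
  have ev : ∀ j, O.point i corner = O.point j o →
      ∀ᶠ q in 𝓝 o, O.point j q ∈ U ∧ φ (O.point j q) = φ (O.point i corner) + q.1 := fun j hj => by
    have h1 := hφ j o (hj ▸ hx)
    have h2 : O.point j ⁻¹' U ∈ 𝓝 o := (O.continuous_point j).continuousAt (hU.mem_nhds (hj ▸ hx))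
    filter_upwards [h1, h2] with q hq1 hq2
    refine ⟨hq2, ?_⟩
    rw [hj, ← sub_eq_iff_eq_add', hq1]
    simp [o]
  let d : unitInterval → Square := fun ε => ⟨fun _ => ε, fun _ => ε.2.1, fun _ => ε.2.2⟩
  have hd : Tendsto d (𝓝 0) (𝓝 o) := by
    have : Continuous d := by fun_prop
    exact this.tendsto' _ _ rfl
  have key := hd.eventually ((ev _ e1).and (ev _ e2))
  have hlt : ∀ᶠ ε : unitInterval in 𝓝 0, (ε : ℝ) < 1 :=
    (isOpen_lt continuous_subtype_val continuous_const).mem_nhds (by simp)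
  have hne : (𝓝[≠] (0 : unitInterval)).NeBot := by infer_instance
  obtain ⟨ε, ⟨⟨h1, h2⟩, hε1⟩, hε0⟩ :=
    (((key.and hlt).filter_mono (nhdsWithin_le_nhds (s := {0}ᶜ))).and
      (self_mem_nhdsWithin)).exists
  have hpos : (0 : ℝ) < ε := lt_of_le_of_ne ε.2.1 fun h => hε0 (Subtype.ext h.symm)
  have heq := hinj h1.1 h2.1 (h1.2.trans h2.2.symm)
  -- The line at `ε / 2` lies before the point with coordinates `(ε, ε)`, so the label there is the
  -- square itself.
  have hlab := congrArg (O.label 0 (c := ε / 2) ⟨by linarith, by linarith⟩) heq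
  have hl : ∀ j, O.label 0 (c := ε / 2) ⟨by linarith, by linarith⟩ (O.point j (d ε)) = some j :=
    fun j => (O.label_point_eq_some_iff _ _ _ _ _).2
      ⟨fun _ _ => ⟨hpos, hε1⟩, Or.inl ⟨by simp only [d]; linarith, rfl⟩⟩
  rw [hl, hl] at hlab
  exact hi (Option.some_injective _ hlab).symm

end SquareTiled

/-! ### Affine homeomorphisms between square-tiled surfaces -/

namespace SquareTiled

open Filter Topology

variable {ι κ μ : Type}

/-- The action of `SL(2, ℝ)` on vectors. -/
abbrev act (A : SL(2, ℝ)) (w : Fin 2 → ℝ) : Fin 2 → ℝ :=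
  (A : Matrix (Fin 2) (Fin 2) ℝ).mulVec w

lemma act_mul (A B : SL(2, ℝ)) (w : Fin 2 → ℝ) : act (A * B) w = act A (act B w) := by
  rw [act, act, act, Matrix.mulVec_mulVec, Matrix.SpecialLinearGroup.coe_mul]

lemma act_sub (A : SL(2, ℝ)) (u w : Fin 2 → ℝ) : act A (u - w) = act A u - act A w :=
  Matrix.mulVec_sub _ _ _

lemma act_inv_act (A : SL(2, ℝ)) (w : Fin 2 → ℝ) : act A⁻¹ (act A w) = w := by
  rw [← act_mul, inv_mul_cancel]
  simp [act]

lemma act_act_inv (A : SL(2, ℝ)) (w : Fin 2 → ℝ) : act A (act A⁻¹ w) = w := by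
  rw [← act_mul, mul_inv_cancel]
  simp [act]

/-- The homeomorphism `f` between square-tiled surfaces is affine with derivative `A`. -/
def IsAffineBetween (O : SquareTiled ι) (O' : SquareTiled κ) (A : SL(2, ℝ))
    (f : O.Surface ≃ₜ O'.Surface) : Prop :=
  ∀ (U : Set O.Surface) (φ : O'.Surface → (Fin 2 → ℝ)), IsOpen U →
    (O'.IsPrimitive (f '' U) φ ↔ O.IsPrimitive U fun x => act A⁻¹ (φ (f x)))

/-- There is an affine homeomorphism with derivative `A` between two square-tiled surfaces. -/
def AffinelyEquivalent (O : SquareTiled ι) (O' : SquareTiled κ) (A : SL(2, ℝ)) : Prop :=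
  ∃ f : O.Surface ≃ₜ O'.Surface, IsAffineBetween O O' A f

lemma mem_veechGroup_iff (O : SquareTiled ι) (A : SL(2, ℝ)) :
    A ∈ O.veechGroup ↔ AffinelyEquivalent O O A := Iff.rfl

lemma AffinelyEquivalent.trans {O : SquareTiled ι} {O' : SquareTiled κ} {O'' : SquareTiled μ}
    {A B : SL(2, ℝ)} (h : AffinelyEquivalent O O' A) (h' : AffinelyEquivalent O' O'' B) :
    AffinelyEquivalent O O'' (B * A) := by
  obtain ⟨g, hg⟩ := h
  obtain ⟨f, hf⟩ := h'
  refine ⟨g.trans f, fun U φ hU => ?_⟩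
  have h1 := hf (g '' U) φ (g.isOpenMap U hU)
  have h2 := hg U (fun x => act B⁻¹ (φ (f x))) hU
  rw [Set.image_image] at h1
  simp only [mul_inv_rev, act_mul]
  exact h1.trans h2

lemma AffinelyEquivalent.symm {O : SquareTiled ι} {O' : SquareTiled κ} {A : SL(2, ℝ)}
    (h : AffinelyEquivalent O O' A) : AffinelyEquivalent O' O A⁻¹ := by
  obtain ⟨f, hf⟩ := h
  refine ⟨f.symm, fun U φ hU => ?_⟩
  have h := hf (f.symm '' U) (fun x => act A (φ (f.symm x))) (f.symm.isOpenMap U hU)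
  simp only [Set.image_image, Homeomorph.apply_symm_apply, Set.image_id',
    Homeomorph.symm_apply_apply, act_inv_act] at h
  simpa only [inv_inv] using h.symm

/-! ### Rigidity of affine homeomorphisms -/

section Rigidity

variable {O : SquareTiled ι} {O' : SquareTiled κ} {A : SL(2, ℝ)} {f : O.Surface ≃ₜ O'.Surface}

lemma IsAffineBetween.isRegularPoint (hf : IsAffineBetween O O' A f) {x : O.Surface}
    (hx : O'.IsRegularPoint (f x)) : O.IsRegularPoint x := by
  obtain ⟨U, φ, hU, hxU, hφ, hinj⟩ := hx
  have him : f '' (f ⁻¹' U) = U := f.image_preimage U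
  refine ⟨f ⁻¹' U, fun x => act A⁻¹ (φ (f x)), hU.preimage f.continuous, hxU,
    (hf _ φ (hU.preimage f.continuous)).1 (him.symm ▸ hφ), fun y hy z hz hyz => ?_⟩
  have := congrArg (act A) hyz
  simp only [act_act_inv] at this
  exact f.injective (hinj hy hz this)

/-- The affine condition speaks about primitives only. It is applied to `liftFrom b`, whose class
modulo `ℤ` is the position up to a constant. -/
lemma IsAffineBetween.eventually_coord_sub (hf : IsAffineBetween O O' A f) (i : ι) (p : Square) :
    ∀ᶠ q : Square in 𝓝 p, ∀ l, O'.coord (f (O.point i q)) l - O'.coord (f (O.point i p)) l =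
      (act A (q.1 - p.1) l : UnitAddCircle) := by
  set y := f (O.point i p) with hy
  -- The shift by `1 / 2` puts `y` at the centre of the fundamental domain, away from the jumps.
  set b : Fin 2 → ℝ := fun l => O'.liftFrom 0 y l + 1 / 2 with hb
  have hyb : y ∈ O'.liftDomain b := fun l => by
    obtain ⟨j, r, hr⟩ := O'.exists_point y
    simp only [hb, hr, liftFrom_point, Pi.zero_apply, sub_zero]
    rw [show r.1 l - (Int.fract (r.1 l) + 1 / 2) = 1 / 2 + ((⌊r.1 l⌋ - 1 : ℤ) : ℝ) by
      rw [Int.fract]; push_cast; ring, Int.fract_add_intCast]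
    rw [Int.fract_eq_self.2 (by norm_num)]
    norm_num
  have hopen := (O'.isOpen_liftDomain b).preimage f.continuous
  have him : f '' (f ⁻¹' O'.liftDomain b) = O'.liftDomain b := f.image_preimage _
  have h := (hf _ (O'.liftFrom b) hopen).1 (him.symm ▸ O'.isPrimitive_liftFrom b) i p hyb
  filter_upwards [h] with q hq l
  have h1 := congrArg (act A) hq
  rw [← Matrix.mulVec_sub, act_act_inv] at h1
  have h2 := congrArg (fun r : ℝ => (r : UnitAddCircle)) (congrFun h1 l)
  simp only [Pi.sub_apply, AddCircle.coe_sub, coe_liftFrom] at h2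
  rw [← h2, ← hy]
  abel

instance : PreconnectedSpace Square :=
  Subtype.preconnectedSpace (convex_Icc (0 : Fin 2 → ℝ) 1).isPreconnected

/-- The difference between the position of the image and the linear map is locally constant, and the
square is connected. -/
lemma IsAffineBetween.coord_sub (hf : IsAffineBetween O O' A f) (i : ι) (p q : Square)
    (l : Fin 2) : O'.coord (f (O.point i q)) l - O'.coord (f (O.point i p)) l =
      (act A (q.1 - p.1) l : UnitAddCircle) := by
  have hloc : IsLocallyConstant fun q : Square =>
      O'.coord (f (O.point i q)) l - (act A q.1 l : UnitAddCircle) := by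
    rw [IsLocallyConstant.iff_eventually_eq]
    intro p
    filter_upwards [hf.eventually_coord_sub i p] with q hq
    have := hq l
    rw [act, Matrix.mulVec_sub, Pi.sub_apply, AddCircle.coe_sub, sub_eq_sub_iff_sub_eq_sub] at this
    exact this
  have := hloc.apply_eq_of_preconnectedSpace q p
  rw [act, Matrix.mulVec_sub, Pi.sub_apply, AddCircle.coe_sub]
  exact sub_eq_sub_iff_sub_eq_sub.1 this

lemma IsAffineBetween.coord_corner (hf : IsAffineBetween O O' A f) {i : ι}
    (hi : O.h (O.v i) ≠ O.v (O.h i)) (l : Fin 2) :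
    O'.coord (f (O.point i corner)) l = 0 :=
  O'.coord_eq_zero_of_not_isRegularPoint
    (fun h => O.not_isRegularPoint_corner hi (hf.isRegularPoint h)) l

/-- The corner of a square that precedes the upper right corner in the `k`-th coordinate
direction. -/
def prevCorner (k : Fin 2) : Square := ⟨1 - Pi.single k 1, by
  constructor <;> intro j <;> by_cases h : j = k <;> simp [h]⟩

lemma point_corner (O : SquareTiled ι) (k : Fin 2) (i : ι) :
    O.point i corner = O.point (O.side k i) (prevCorner k) :=
  O.point_eq_of_side k i corner _ rfl (by simp [prevCorner])
    (fun l hl => by simp [prevCorner, corner, hl])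

/-- The upper right corners of the square `i` and of the next square in the `k`-th coordinate
direction are singular. -/
def HasSingularSide (O : SquareTiled ι) (k : Fin 2) : Prop :=
  ∃ i, O.h (O.v i) ≠ O.v (O.h i) ∧
    O.h (O.v (O.side k i)) ≠ O.v (O.h (O.side k i))

/-- The image of a side with singular end points has integral holonomy. -/
lemma IsAffineBetween.exists_int (hf : IsAffineBetween O O' A f) {k : Fin 2}
    (hk : O.HasSingularSide k) (l : Fin 2) : ∃ n : ℤ, (A.1 l k : ℝ) = n := by
  obtain ⟨i, hi, hi'⟩ := hk
  have hp := O.point_corner k i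
  set p := prevCorner k with hpk
  have h := hf.coord_sub (O.side k i) p corner l
  rw [← hp, hf.coord_corner hi, hf.coord_corner hi', sub_zero] at h
  have hA : act A (corner.1 - p.1) l = A.1 l k := by
    simp [hpk, prevCorner, corner, act]
  rw [hA] at h
  obtain ⟨n, hn⟩ := (AddCircle.coe_eq_zero_iff 1).1 h.symm
  exact ⟨n, by simpa using hn.symm⟩

/-- Every square can be reached from every other one. -/
def IsTransitive (O : SquareTiled ι) : Prop :=
  ∀ (s : Set ι), s.Nonempty → (∀ i, O.h i ∈ s ↔ i ∈ s) → (∀ i, O.v i ∈ s ↔ i ∈ s) → s = Set.univ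

lemma IsTransitive.side (hO : O.IsTransitive) (s : Set ι) (hs : s.Nonempty)
    (h : ∀ k i, O.side k i ∈ s ↔ i ∈ s) : s = Set.univ :=
  hO s hs (h 0) (h 1)

/-- A translation is pinned down modulo `ℤ²` by one singular corner, where both positions vanish.
Agreement at one point of a square spreads over the square, then through common corners to its
neighbours, and by transitivity to all squares. -/
lemma IsAffineBetween.coord_eq (hf : IsAffineBetween O O' 1 f) (hO : O.IsTransitive) {i : ι}
    (hi : O.h (O.v i) ≠ O.v (O.h i)) (x : O.Surface) : O'.coord (f x) = O.coord x := by
  have key : {j | ∀ p, O'.coord (f (O.point j p)) = O.coord (O.point j p)} = Set.univ := by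
    have hsub : ∀ j p q, O'.coord (f (O.point j p)) = O.coord (O.point j p) →
        O'.coord (f (O.point j q)) = O.coord (O.point j q) := fun j p q hp => by
      funext l
      have h1 := hf.coord_sub j p q l
      rw [hp, coord_point, sub_eq_iff_eq_add] at h1
      rw [h1, coord_point, ← AddCircle.coe_add]
      simp [act]
    apply hO.side
    · refine ⟨i, fun p => hsub i corner p ?_⟩
      funext l
      rw [hf.coord_corner hi]
      exact (AddCircle.coe_period 1).symm
    · intro k j
      have hp := O.point_corner k j
      constructor
      · intro h q
        refine hsub j corner q ?_
        rw [hp]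
        exact h _
      · intro h q
        refine hsub _ (prevCorner k) q ?_
        rw [← hp]
        exact h corner
  obtain ⟨j, p, rfl⟩ := O.exists_point x
  have hj : j ∈ {j | ∀ p, O'.coord (f (O.point j p)) = O.coord (O.point j p)} :=
    key ▸ Set.mem_univ j
  exact hj p

/-! ### Affine homeomorphisms with derivative `1` as maps of squares -/

/-- A combinatorial map between square-tiled surfaces. -/
def IsTileMap (O : SquareTiled ι) (O' : SquareTiled κ) (e : ι → κ) : Prop :=
  (∀ i, e (O.h i) = O'.h (e i)) ∧ ∀ i, e (O.v i) = O'.v (e i)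

lemma mem_Ioo_of_coe_eq {a b : ℝ} (ha : a ∈ Set.Icc (0 : ℝ) 1) (hb : b ∈ Set.Ioo (0 : ℝ) 1)
    (h : (a : UnitAddCircle) = b) : a = b := by
  rcases UnitAddCircle.coe_eq_coe_iff_of_mem_Icc ha ⟨hb.1.le, hb.2.le⟩ h with h | h | h
  · exact h
  · linarith [hb.1, h.2]
  · linarith [hb.2, h.2]

/-- The square that contains the image of the centre of a square. -/
lemma exists_label_of_coord (O : SquareTiled ι) (k : Fin 2) {c : ℝ} (hc : c ∈ Set.Ioo (0 : ℝ) 1)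
    {x : O.Surface} (hx : ∀ l, l ≠ k → O.coord x l ≠ 0) (hk : O.coord x k ≠ (c : UnitAddCircle)) :
    ∃ j, O.label k hc x = some j := by
  obtain ⟨i, p, rfl⟩ := O.exists_point x
  have h1 : ∀ l, l ≠ k → p.1 l ∈ Set.Ioo (0 : ℝ) 1 := fun l hl => by
    have h := hx l hl
    have hp := mem_Icc_coord p l
    refine ⟨lt_of_le_of_ne hp.1 fun h' => h ?_, lt_of_le_of_ne hp.2 fun h' => h ?_⟩
    · rw [coord_point, ← h', AddCircle.coe_zero]
    · rw [coord_point, h']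
      exact AddCircle.coe_period 1
  rcases lt_trichotomy c (p.1 k) with h | h | h
  · exact ⟨i, (O.label_point_eq_some_iff k hc _ _ _).2 ⟨h1, Or.inl ⟨h, rfl⟩⟩⟩
  · exact absurd (by rw [coord_point, h]) hk
  · exact ⟨(O.side k).symm i, (O.label_point_eq_some_iff k hc _ _ _).2
      ⟨h1, Or.inr ⟨h, by simp⟩⟩⟩

/-- The label is constant on the preconnected subsets of its domain. -/
lemma label_eq_of_isPreconnected (O : SquareTiled ι) (k : Fin 2) {c : ℝ}
    (hc : c ∈ Set.Ioo (0 : ℝ) 1) {s : Set O.Surface} (hs : IsPreconnected s)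
    (hlab : ∀ x ∈ s, ∃ j, O.label k hc x = some j) {x y : O.Surface} (hx : x ∈ s) (hy : y ∈ s) :
    O.label k hc x = O.label k hc y := by
  obtain ⟨j, hj⟩ := hlab x hx
  by_contra hne
  have hV : IsOpen (⋃ j' ∈ {j' | j' ≠ j}, {x | O.label k hc x = some j'}) :=
    isOpen_biUnion fun j' _ => O.isOpen_label k hc j'
  obtain ⟨z, -, hz1, hz2⟩ := hs _ _ (O.isOpen_label k hc j) hV
    (fun z hz => by
      obtain ⟨j', hj'⟩ := hlab z hz
      by_cases h : j' = j
      · exact Or.inl (h ▸ hj')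
      · exact Or.inr (Set.mem_biUnion (x := j') h hj'))
    ⟨x, hx, hj⟩
    (by
      obtain ⟨j', hj'⟩ := hlab y hy
      refine ⟨y, hy, Set.mem_biUnion (x := j') (fun h => hne ?_) hj'⟩
      rw [hj, hj', h])
  simp only [Set.mem_iUnion, Set.mem_ofPred_eq] at hz1 hz2
  obtain ⟨j', hj', h⟩ := hz2
  rw [hz1] at h
  exact hj' (Option.some_injective _ h).symm

/-- The point of a square with all coordinates equal to `1 / 2` except for the `k`-th, which
is `r`. -/
noncomputable def midpoint (k : Fin 2) (r : unitInterval) : Square :=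
  ⟨Function.update (fun _ => 1 / 2) k r, by
    have := r.2.1
    have := r.2.2
    constructor <;> intro l <;> rcases eq_or_ne l k with rfl | h
    · simpa
    · simp [h]
    · simpa
    · simp only [Function.update_of_ne h, Pi.one_apply]
      norm_num⟩

lemma midpoint_self (k : Fin 2) (r : unitInterval) : (midpoint k r).1 k = r := by
  simp [midpoint]

lemma midpoint_of_ne {k l : Fin 2} (h : l ≠ k) (r : unitInterval) :
    (midpoint k r).1 l = 1 / 2 := by
  simp [midpoint, h]

lemma continuous_midpoint (k : Fin 2) : Continuous (midpoint k) := by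
  refine Continuous.subtype_mk ?_ _
  exact continuous_const.update k continuous_subtype_val

lemma half_ne_zero : ((1 / 2 : ℝ) : UnitAddCircle) ≠ 0 := fun h => by
  have := mem_Ioo_of_coe_eq (a := 0) (b := 1 / 2) (by norm_num) (by norm_num)
    (by rw [h, AddCircle.coe_zero])
  norm_num at this

/-- An affine homeomorphism with derivative `1` is given by a map between the squares. -/
lemma IsAffineBetween.exists_isTileMap (hf : IsAffineBetween O O' 1 f) (hO : O.IsTransitive)
    {i : ι} (hi : O.h (O.v i) ≠ O.v (O.h i)) : ∃ e : ι → κ, IsTileMap O O' e := by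
  have hcoord := hf.coord_eq hO hi
  let half : unitInterval := ⟨1 / 2, by norm_num⟩
  have hm : ∀ k, midpoint k half = midpoint 0 half := fun k => Subtype.ext <| funext fun l => by
    have : ∀ k, (midpoint k half).1 l = 1 / 2 := fun k => by
      rcases eq_or_ne l k with rfl | h
      · exact midpoint_self _ _
      · exact midpoint_of_ne h _
    rw [this, this]
  have hmc : ∀ l, (midpoint 0 half).1 l = 1 / 2 := fun l => by
    rcases eq_or_ne l 0 with rfl | h
    · exact midpoint_self _ _
    · exact midpoint_of_ne h _
  have hc4 : (1 / 4 : ℝ) ∈ Set.Ioo (0 : ℝ) 1 := by norm_num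
  have hc34 : (3 / 4 : ℝ) ∈ Set.Ioo (0 : ℝ) 1 := by norm_num
  -- the square of the image of the centre of a square
  have hex : ∀ j, ∃ j', f (O.point j (midpoint 0 half)) = O'.point j' (midpoint 0 half) := fun j => by
    obtain ⟨j', q, hq⟩ := O'.exists_point (f (O.point j (midpoint 0 half)))
    refine ⟨j', ?_⟩
    rw [hq]
    congr 1
    refine Subtype.ext (funext fun l => ?_)
    have h := congrFun (hcoord (O.point j (midpoint 0 half))) l
    rw [hq, coord_point, coord_point] at h
    exact mem_Ioo_of_coe_eq (mem_Icc_coord q l) (by rw [hmc]; norm_num) h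
  choose e he using hex
  -- The path between neighbouring centres is divided at the common side. The first half avoids the
  -- line at `1 / 4` and the second half the line at `3 / 4`, so the corresponding label of the
  -- image is constant on each half. Both labels are compared at the image of the midpoint of the
  -- side.
  have key : ∀ k j, e (O.side k j) = O'.side k (e j) := fun k j => by
    -- a segment from the centre of the square `j` to the side
    let s1 : Set O'.Surface := (fun r => f (O.point j (midpoint k r))) '' Set.Icc half 1
    let s2 : Set O'.Surface := (fun r => f (O.point (O.side k j) (midpoint k r))) '' Set.Icc 0 half
    have hcont : ∀ j, Continuous fun r => f (O.point j (midpoint k r)) := fun j =>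
      f.continuous.comp ((O.continuous_point j).comp (continuous_midpoint k))
    have hs1 : IsPreconnected s1 := isPreconnected_Icc.image _ (hcont _).continuousOn
    have hs2 : IsPreconnected s2 := isPreconnected_Icc.image _ (hcont _).continuousOn
    have hjoin : f (O.point j (midpoint k 1)) = f (O.point (O.side k j) (midpoint k 0)) := by
      rw [O.point_eq_of_side k j (midpoint k 1) (midpoint k 0) (midpoint_self k 1)
        (midpoint_self k 0) fun l hl => by rw [midpoint_of_ne hl, midpoint_of_ne hl]]
    have hlabel : ∀ (c : ℝ) (hc : c ∈ Set.Ioo (0 : ℝ) 1) (j : ι) (r : unitInterval), (r : ℝ) ≠ c →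
        ∃ j', O'.label k hc (f (O.point j (midpoint k r))) = some j' := fun c hc j r hr => by
      apply exists_label_of_coord
      · intro l hl
        rw [hcoord, coord_point, midpoint_of_ne hl]
        exact half_ne_zero
      · rw [hcoord, coord_point, midpoint_self]
        exact fun h => hr (mem_Ioo_of_coe_eq r.2 hc h)
    have hcentre : ∀ (j : κ), O'.label k hc4 (O'.point j (midpoint 0 half)) = some j := fun j =>
      (O'.label_point_eq_some_iff k _ _ _ _).2
        ⟨fun l _ => by rw [hmc]; norm_num, Or.inl ⟨by rw [hmc]; norm_num, rfl⟩⟩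
    have hcentre' : ∀ (j : κ), O'.label k hc34 (O'.point (O'.side k j) (midpoint 0 half)) = some j :=
      fun j => (O'.label_point_eq_some_iff k _ _ _ _).2
        ⟨fun l _ => by rw [hmc]; norm_num, Or.inr ⟨by rw [hmc]; norm_num, rfl⟩⟩
    -- the label at the side
    obtain ⟨j1, q1, hq1⟩ := O'.exists_point (f (O.point j (midpoint k 1)))
    have e1 := O'.label_eq_of_isPreconnected k hc4 hs1 (by
      rintro _ ⟨r, hr, rfl⟩
      refine hlabel _ _ _ _ fun h => ?_
      have : (1 / 2 : ℝ) ≤ r := hr.1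
      linarith) (Set.mem_image_of_mem _ ⟨le_rfl, half.2.2⟩)
      (Set.mem_image_of_mem _ ⟨half.2.2, le_rfl⟩)
    have e2 := O'.label_eq_of_isPreconnected k hc34 hs2 (by
      rintro _ ⟨r, hr, rfl⟩
      refine hlabel _ _ _ _ fun h => ?_
      have : r ≤ (1 / 2 : ℝ) := hr.2
      linarith) (Set.mem_image_of_mem _ ⟨half.2.1, le_rfl⟩)
      (Set.mem_image_of_mem _ ⟨le_rfl, half.2.1⟩)
    simp only [hm, he] at e1 e2
    rw [hcentre] at e1
    obtain ⟨j0, hj0⟩ : ∃ j0, e (O.side k j) = O'.side k j0 := ⟨(O'.side k).symm (e (O.side k j)), by simp⟩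
    rw [hj0, hcentre', ← hjoin] at e2
    rw [hq1, eq_comm, label_point_eq_some_iff] at e1 e2
    rw [hj0]
    have hq1k : q1.1 k = 0 ∨ q1.1 k = 1 := by
      have h := congrFun (hcoord (O.point j (midpoint k 1))) k
      rw [hq1, coord_point, coord_point, midpoint_self] at h
      rcases UnitAddCircle.coe_eq_coe_iff_of_mem_Icc (mem_Icc_coord q1 k) (by norm_num) h with h | h | h
      · exact Or.inr h
      · exact Or.inr h.1
      · exact Or.inl h.1
    -- The image of the midpoint may be presented as a point of either adjacent square. In each
    -- presentation both lines lie on the same side of it, so the two labels coincide.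
    rcases hq1k with h | h
    · have h1 := e1.2.resolve_left fun h' => by linarith [h'.1]
      have h2 := e2.2.resolve_left fun h' => by linarith [h'.1]
      rw [← h1.2, ← h2.2]
    · have h1 := e1.2.resolve_right fun h' => by linarith [h'.1]
      have h2 := e2.2.resolve_right fun h' => by linarith [h'.1]
      rw [← h1.2, ← h2.2]
  exact ⟨e, key 0, key 1⟩

end Rigidity

end SquareTiled

/-! ### Constructions of affine homeomorphisms -/

namespace SquareTiled

open Filter Topology

variable {ι κ μ : Type}

/-- Every square is the union of two closed pieces on which `f` is affine with derivative `A` and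
takes values in one square. -/
def IsPiecewiseAffine (O : SquareTiled ι) (O' : SquareTiled κ) (A : SL(2, ℝ))
    (f : O.Surface → O'.Surface) : Prop :=
  ∀ i, ∃ (K : Bool → Set Square) (j : Bool → κ) (g : Bool → Square → Square),
    (∀ a, IsClosed (K a)) ∧ (∀ q, ∃ a, q ∈ K a) ∧ (∀ a, Continuous (g a)) ∧
    (∀ a, ∀ q ∈ K a, f (O.point i q) = O'.point (j a) (g a q)) ∧
    ∀ a, ∀ p ∈ K a, ∀ q ∈ K a, (g a q).1 - (g a p).1 = act A (q.1 - p.1)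

section

variable {O : SquareTiled ι} {O' : SquareTiled κ} {A : SL(2, ℝ)}

lemma IsPiecewiseAffine.continuous {f : O.Surface → O'.Surface}
    (hf : IsPiecewiseAffine O O' A f) : Continuous f := by
  rw [continuous_iff_point]
  intro i
  obtain ⟨K, j, g, hK, hcov, hg, hfg, -⟩ := hf i
  refine (locallyFinite_of_finite K).continuous (Set.iUnion_eq_univ_iff.2 hcov) hK fun a => ?_
  exact (((O'.continuous_point (j a)).comp (hg a)).continuousOn).congr (hfg a)

/-- Increments from `p` need checking only on the closed pieces that contain `p`; the others are
absent from a neighbourhood of `p`. A point near `p` lies in one of the pieces. -/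
lemma IsPiecewiseAffine.isPrimitive {f : O.Surface → O'.Surface}
    (hf : IsPiecewiseAffine O O' A f) {V : Set O'.Surface} {φ : O'.Surface → Fin 2 → ℝ}
    (hφ : O'.IsPrimitive V φ) : O.IsPrimitive (f ⁻¹' V) fun x => act A⁻¹ (φ (f x)) := by
  intro i p hp
  obtain ⟨K, j, g, hK, hcov, hg, hfg, hA⟩ := hf i
  have h : ∀ a, ∀ᶠ q in 𝓝 p, q ∈ K a →
      act A⁻¹ (φ (f (O.point i q))) - act A⁻¹ (φ (f (O.point i p))) = q.1 - p.1 := fun a => by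
    by_cases hpa : p ∈ K a
    · have hV : O'.point (j a) (g a p) ∈ V := by
        rw [← hfg a p hpa]
        exact hp
      filter_upwards [(hg a).continuousAt.eventually (hφ (j a) (g a p) hV)] with q hq hqa
      rw [hfg a q hqa, hfg a p hpa, ← act_sub, hq, hA a p hpa q hqa, act_inv_act]
    · filter_upwards [(hK a).isOpen_compl.mem_nhds hpa] with q hq hqa
      exact absurd hqa hq
  filter_upwards [h true, h false] with q h1 h2
  obtain ⟨a, ha⟩ := hcov q
  cases a
  · exact h2 ha
  · exact h1 ha

lemma AffinelyEquivalent.of_isPiecewiseAffine (f : O.Surface ≃ O'.Surface)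
    (hf : IsPiecewiseAffine O O' A f) (hf' : IsPiecewiseAffine O' O A⁻¹ f.symm) :
    AffinelyEquivalent O O' A := by
  refine ⟨⟨f, hf.continuous, hf'.continuous⟩, fun U φ _ => ⟨fun h => ?_, fun h => ?_⟩⟩
  · have := hf.isPrimitive h
    rwa [show (f ⁻¹' ((⟨f, hf.continuous, hf'.continuous⟩ : O.Surface ≃ₜ O'.Surface) '' U)) = U from
      f.injective.preimage_image U] at this
  · have := hf'.isPrimitive h
    simp only [inv_inv] at this
    rw [← Equiv.image_eq_preimage_symm] at this
    have e : (fun x => act A (act A⁻¹ (φ (f (f.symm x))))) = φ := by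
      funext x
      rw [act_act_inv, f.apply_symm_apply]
    exact e ▸ this

end

/-- The point of the unit square with the given coordinates, which are replaced by the nearest
elements of `[0, 1]`. -/
noncomputable def sq (s t : ℝ) : Square :=
  ⟨![max 0 (min 1 s), max 0 (min 1 t)], by
    constructor <;> intro l <;> fin_cases l <;> simp⟩

lemma continuous_sq {X : Type} [TopologicalSpace X] {f g : X → ℝ} (hf : Continuous f)
    (hg : Continuous g) : Continuous fun x => sq (f x) (g x) := by
  refine Continuous.subtype_mk (continuous_pi fun l => ?_) _
  fin_cases l
  · exact continuous_const.max (continuous_const.min hf)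
  · exact continuous_const.max (continuous_const.min hg)

lemma sq_zero {s t : ℝ} (h0 : 0 ≤ s) (h1 : s ≤ 1) : (sq s t).1 0 = s := by
  simp [sq, h0, h1]

lemma sq_one {s t : ℝ} (h0 : 0 ≤ t) (h1 : t ≤ 1) : (sq s t).1 1 = t := by
  simp [sq, h0, h1]

lemma sq_self (p : Square) : sq (p.1 0) (p.1 1) = p := by
  refine Subtype.ext (funext fun l => ?_)
  have h0 := mem_Icc_coord p 0
  have h1 := mem_Icc_coord p 1
  fin_cases l
  · exact sq_zero h0.1 h0.2
  · exact sq_one h1.1 h1.2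

lemma eq_sq_zero {p : Square} {s : ℝ} (h : p.1 0 = s) : p = sq s (p.1 1) := by
  rw [← h, sq_self]

lemma eq_sq_one {p : Square} {t : ℝ} (h : p.1 1 = t) : p = sq (p.1 0) t := by
  rw [← h, sq_self]

lemma point_right (O : SquareTiled ι) (i : ι) (t : ℝ) :
    O.point i (sq 1 t) = O.point (O.h i) (sq 0 t) :=
  Quot.sound (Glue.right i _ _ (sq_zero zero_le_one le_rfl) (sq_zero le_rfl zero_le_one) rfl)

lemma point_top (O : SquareTiled ι) (i : ι) (s : ℝ) :
    O.point i (sq s 1) = O.point (O.v i) (sq s 0) :=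
  Quot.sound (Glue.top i _ _ (sq_one zero_le_one le_rfl) (sq_one le_rfl zero_le_one) rfl)

/-- A map between surfaces that is given on the squares and respects the gluing. -/
def mapOfSquares (O : SquareTiled ι) {X : Type} (F : ι → Square → X)
    (hright : ∀ i t, 0 ≤ t → t ≤ 1 → F i (sq 1 t) = F (O.h i) (sq 0 t))
    (htop : ∀ i s, 0 ≤ s → s ≤ 1 → F i (sq s 1) = F (O.v i) (sq s 0)) : O.Surface → X :=
  Quot.lift (fun x => F x.1 x.2) fun x y h => by
    cases h with
    | right i p q hp hq hpq =>
      have := mem_Icc_coord p 1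
      rw [eq_sq_zero hp, eq_sq_zero hq, ← hpq]
      exact hright i _ this.1 this.2
    | top i p q hp hq hpq =>
      have := mem_Icc_coord p 0
      rw [eq_sq_one hp, eq_sq_one hq, ← hpq]
      exact htop i _ this.1 this.2

lemma act_one (w : Fin 2 → ℝ) : act 1 w = w := by simp [act]

/-! #### Relabelling -/

/-- The relabelling of the squares. -/
lemma AffinelyEquivalent.of_isTileMap {O : SquareTiled ι} {O' : SquareTiled κ} (e : ι ≃ κ)
    (he : IsTileMap O O' e) : AffinelyEquivalent O O' 1 := by
  have he' : IsTileMap O' O e.symm :=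
    ⟨fun i => by rw [Equiv.symm_apply_eq, he.1, e.apply_symm_apply],
      fun i => by rw [Equiv.symm_apply_eq, he.2, e.apply_symm_apply]⟩
  let f : O.Surface ≃ O'.Surface :=
    { toFun := O.mapOfSquares (fun i p => O'.point (e i) p)
        (fun i t _ _ => by rw [O'.point_right, he.1]) (fun i t _ _ => by rw [O'.point_top, he.2])
      invFun := O'.mapOfSquares (fun i p => O.point (e.symm i) p)
        (fun i t _ _ => by rw [O.point_right, he'.1]) (fun i t _ _ => by rw [O.point_top, he'.2])
      left_inv := fun x => by
        obtain ⟨i, p, rfl⟩ := O.exists_point x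
        exact congrArg (O.point · p) (e.symm_apply_apply i)
      right_inv := fun x => by
        obtain ⟨i, p, rfl⟩ := O'.exists_point x
        exact congrArg (O'.point · p) (e.apply_symm_apply i) }
  refine of_isPiecewiseAffine f (fun i => ⟨fun _ => Set.univ, fun _ => e i, fun _ => id,
      fun _ => isClosed_univ, fun q => ⟨true, trivial⟩, fun _ => continuous_id,
      fun _ _ _ => rfl, fun _ p _ q _ => (act_one _).symm⟩)
    (fun i => ⟨fun _ => Set.univ, fun _ => e.symm i, fun _ => id,
      fun _ => isClosed_univ, fun q => ⟨true, trivial⟩, fun _ => continuous_id,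
      fun _ _ _ => rfl, fun _ p _ q _ => by rw [inv_one, act_one]; rfl⟩)

/-! #### Quarter turns -/

/-- The embedding of `SL(2, ℤ)` into `SL(2, ℝ)`. -/
abbrev intCast : SL(2, ℤ) →* SL(2, ℝ) :=
  Matrix.SpecialLinearGroup.map (Int.castRingHom ℝ)

lemma act_intCast (A : SL(2, ℤ)) (w : Fin 2 → ℝ) : act (intCast A) w =
    ![A.1 0 0 * w 0 + A.1 0 1 * w 1, A.1 1 0 * w 0 + A.1 1 1 * w 1] := by
  have h : ∀ l, act (intCast A) w l = ∑ j, (A.1 l j : ℝ) * w j := fun _ => rfl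
  ext l
  rw [h, Fin.sum_univ_two]
  fin_cases l <;> rfl

lemma act_S (w : Fin 2 → ℝ) : act (intCast ModularGroup.S) w = ![-w 1, w 0] := by
  rw [act_intCast]
  simp [ModularGroup.S]

lemma act_S_inv (w : Fin 2 → ℝ) : act (intCast ModularGroup.S)⁻¹ w = ![w 1, -w 0] := by
  have h := act_inv_act (intCast ModularGroup.S) ![w 1, -w 0]
  rwa [act_S, show ![-(![w 1, -w 0] : Fin 2 → ℝ) 1, (![w 1, -w 0] : Fin 2 → ℝ) 0] = w by
    ext l; fin_cases l <;> simp] at h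

lemma act_T (w : Fin 2 → ℝ) : act (intCast ModularGroup.T) w = ![w 0 + w 1, w 1] := by
  rw [act_intCast]
  simp [ModularGroup.T]

lemma act_T_inv (w : Fin 2 → ℝ) : act (intCast ModularGroup.T)⁻¹ w = ![w 0 - w 1, w 1] := by
  have h := act_inv_act (intCast ModularGroup.T) ![w 0 - w 1, w 1]
  rwa [act_T, show ![(![w 0 - w 1, w 1] : Fin 2 → ℝ) 0 + (![w 0 - w 1, w 1] : Fin 2 → ℝ) 1,
      (![w 0 - w 1, w 1] : Fin 2 → ℝ) 1] = w by
    ext l; fin_cases l <;> simp] at h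

/-- The surface turned by `π / 2`. -/
def rotate (O : SquareTiled ι) : SquareTiled ι where
  h := O.v⁻¹
  v := O.h

lemma sq_sub_zero {s t s' t' : ℝ} (h0 : 0 ≤ s) (h1 : s ≤ 1) (h0' : 0 ≤ s') (h1' : s' ≤ 1) :
    ((sq s t).1 - (sq s' t').1) 0 = s - s' := by
  rw [Pi.sub_apply, sq_zero h0 h1, sq_zero h0' h1']

lemma sq_sub_one {s t s' t' : ℝ} (h0 : 0 ≤ t) (h1 : t ≤ 1) (h0' : 0 ≤ t') (h1' : t' ≤ 1) :
    ((sq s t).1 - (sq s' t').1) 1 = t - t' := by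
  rw [Pi.sub_apply, sq_one h0 h1, sq_one h0' h1']

lemma eq_vec {w : Fin 2 → ℝ} {a b : ℝ} (h0 : w 0 = a) (h1 : w 1 = b) : w = ![a, b] := by
  rw [← h0, ← h1]
  ext l
  fin_cases l <;> rfl

/-- The quarter turn takes every square to itself by `(x, y) ↦ (1 - y, x)`. The right side becomes
the top and the bottom becomes the right side, whence `h` and `v⁻¹`. -/
lemma affinelyEquivalent_rotate (O : SquareTiled ι) :
    AffinelyEquivalent O O.rotate (intCast ModularGroup.S) := by
  have hm : ∀ p : Square, 0 ≤ p.1 0 ∧ p.1 0 ≤ 1 ∧ 0 ≤ p.1 1 ∧ p.1 1 ≤ 1 := fun p =>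
    ⟨(mem_Icc_coord p 0).1, (mem_Icc_coord p 0).2, (mem_Icc_coord p 1).1, (mem_Icc_coord p 1).2⟩
  let f : O.Surface ≃ O.rotate.Surface :=
    { toFun := O.mapOfSquares (fun i p => O.rotate.point i (sq (1 - p.1 1) (p.1 0)))
        (fun i t h0 h1 => by
          rw [sq_zero zero_le_one le_rfl, sq_zero le_rfl zero_le_one, sq_one h0 h1, sq_one h0 h1,
            point_top]
          rfl)
        (fun i s h0 h1 => by
          rw [sq_one zero_le_one le_rfl, sq_one le_rfl zero_le_one, sq_zero h0 h1, sq_zero h0 h1,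
            sub_self, sub_zero, point_right]
          simp [rotate])
      invFun := O.rotate.mapOfSquares (fun i p => O.point i (sq (p.1 1) (1 - p.1 0)))
        (fun i t h0 h1 => by
          rw [sq_zero zero_le_one le_rfl, sq_zero le_rfl zero_le_one, sq_one h0 h1, sq_one h0 h1,
            sub_self, sub_zero, point_top]
          simp [rotate])
        (fun i s h0 h1 => by
          rw [sq_one zero_le_one le_rfl, sq_one le_rfl zero_le_one, sq_zero h0 h1, sq_zero h0 h1,
            point_right]
          rfl)
      left_inv := fun x => by
        obtain ⟨i, p, rfl⟩ := O.exists_point x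
        obtain ⟨h1, h2, h3, h4⟩ := hm p
        refine congrArg (O.point i) ?_
        rw [sq_one h1 h2, sq_zero (by linarith) (by linarith), sub_sub_cancel, sq_self]
      right_inv := fun x => by
        obtain ⟨i, p, rfl⟩ := O.rotate.exists_point x
        obtain ⟨h1, h2, h3, h4⟩ := hm p
        refine congrArg (O.rotate.point i) ?_
        rw [sq_one (by linarith) (by linarith), sq_zero h3 h4, sub_sub_cancel, sq_self] }
  have hc := continuous_square_apply
  refine AffinelyEquivalent.of_isPiecewiseAffine f
    (fun i => ⟨fun _ => Set.univ, fun _ => i, fun _ p => sq (1 - p.1 1) (p.1 0),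
      fun _ => isClosed_univ, fun q => ⟨true, trivial⟩,
      fun _ => continuous_sq (continuous_const.sub (hc 1)) (hc 0),
      fun _ _ _ => rfl, fun _ p _ q _ => ?_⟩)
    (fun i => ⟨fun _ => Set.univ, fun _ => i, fun _ p => sq (p.1 1) (1 - p.1 0),
      fun _ => isClosed_univ, fun q => ⟨true, trivial⟩,
      fun _ => continuous_sq (hc 1) (continuous_const.sub (hc 0)),
      fun _ _ _ => rfl, fun _ p _ q _ => ?_⟩)
  all_goals
    obtain ⟨h1, h2, h3, h4⟩ := hm p
    obtain ⟨h1', h2', h3', h4'⟩ := hm q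
  · rw [act_S]
    exact eq_vec ((sq_sub_zero (by linarith) (by linarith) (by linarith) (by linarith)).trans
      (by rw [Pi.sub_apply]; ring)) (sq_sub_one h1' h2' h1 h2)
  · rw [act_S_inv]
    exact eq_vec (sq_sub_zero h3' h4' h3 h4)
      ((sq_sub_one (by linarith) (by linarith) (by linarith) (by linarith)).trans
        (by rw [Pi.sub_apply]; ring))

/-! #### Shears -/

/-- The surface after the shear `(x, y) ↦ (x + y, y)`. -/
def shear (O : SquareTiled ι) : SquareTiled ι where
  h := O.h
  v := O.v * O.h⁻¹

lemma shear_v_h (O : SquareTiled ι) (i : ι) : O.shear.v (O.h i) = O.v i := by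
  simp [shear]

open Classical in
/-- The shear on the square `i`. -/
noncomputable def shearSquare (O : SquareTiled ι) (i : ι) (p : Square) : O.shear.Surface :=
  if p.1 0 + p.1 1 ≤ 1 then O.shear.point i (sq (p.1 0 + p.1 1) (p.1 1))
  else O.shear.point (O.h i) (sq (p.1 0 + p.1 1 - 1) (p.1 1))

lemma shearSquare_of_le (O : SquareTiled ι) (i : ι) {p : Square} (h : p.1 0 + p.1 1 ≤ 1) :
    O.shearSquare i p = O.shear.point i (sq (p.1 0 + p.1 1) (p.1 1)) := if_pos h

/-- On the diagonal both formulas agree by the gluing of a right side with a left side, so the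
pieces can be taken closed. -/
lemma shearSquare_of_ge (O : SquareTiled ι) (i : ι) {p : Square} (h : 1 ≤ p.1 0 + p.1 1) :
    O.shearSquare i p = O.shear.point (O.h i) (sq (p.1 0 + p.1 1 - 1) (p.1 1)) := by
  rcases h.eq_or_lt with h | h
  · rw [shearSquare_of_le _ _ h.ge, ← h, sub_self, point_right]
    rfl
  · exact if_neg h.not_ge

open Classical in
/-- The inverse of the shear on the square `i`. -/
noncomputable def unshearSquare (O : SquareTiled ι) (i : ι) (p : Square) : O.Surface :=
  if p.1 1 ≤ p.1 0 then O.point i (sq (p.1 0 - p.1 1) (p.1 1))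
  else O.point (O.h⁻¹ i) (sq (p.1 0 - p.1 1 + 1) (p.1 1))

lemma unshearSquare_of_ge (O : SquareTiled ι) (i : ι) {p : Square} (h : p.1 1 ≤ p.1 0) :
    O.unshearSquare i p = O.point i (sq (p.1 0 - p.1 1) (p.1 1)) := if_pos h

lemma unshearSquare_of_le (O : SquareTiled ι) (i : ι) {p : Square} (h : p.1 0 ≤ p.1 1) :
    O.unshearSquare i p = O.point (O.h⁻¹ i) (sq (p.1 0 - p.1 1 + 1) (p.1 1)) := by
  rcases h.eq_or_lt with h | h
  · rw [unshearSquare_of_ge _ _ h.ge, h, sub_self, zero_add, point_right]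
    simp
  · exact if_neg h.not_ge

/-- The new square `i` has the same lower side as the old one. The sheared square `i` leaves it
across the right side, and the part beyond belongs to the new square `h i`. Consequently the top of
the new square `i` lies along the top of the old square `h⁻¹ i`. -/
lemma affinelyEquivalent_shear (O : SquareTiled ι) :
    AffinelyEquivalent O O.shear (intCast ModularGroup.T) := by
  have hm : ∀ p : Square, 0 ≤ p.1 0 ∧ p.1 0 ≤ 1 ∧ 0 ≤ p.1 1 ∧ p.1 1 ≤ 1 := fun p =>
    ⟨(mem_Icc_coord p 0).1, (mem_Icc_coord p 0).2, (mem_Icc_coord p 1).1, (mem_Icc_coord p 1).2⟩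
  let f : O.Surface ≃ O.shear.Surface :=
    { toFun := O.mapOfSquares O.shearSquare
        (fun i t h0 h1 => by
          rw [shearSquare_of_ge _ _ (by rw [sq_zero zero_le_one le_rfl, sq_one h0 h1]; linarith),
            shearSquare_of_le _ _ (by rw [sq_zero le_rfl zero_le_one, sq_one h0 h1]; linarith),
            sq_zero zero_le_one le_rfl, sq_one h0 h1, sq_zero le_rfl zero_le_one, sq_one h0 h1]
          congr 2
          ring)
        (fun i s h0 h1 => by
          rw [shearSquare_of_ge _ _ (by rw [sq_one zero_le_one le_rfl, sq_zero h0 h1]; linarith),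
            shearSquare_of_le _ _ (by rw [sq_one le_rfl zero_le_one, sq_zero h0 h1]; linarith),
            sq_one zero_le_one le_rfl, sq_zero h0 h1, sq_one le_rfl zero_le_one, sq_zero h0 h1,
            point_top, shear_v_h]
          congr 2
          ring)
      invFun := O.shear.mapOfSquares O.unshearSquare
        (fun i t h0 h1 => by
          rw [unshearSquare_of_ge _ _ (by rw [sq_zero zero_le_one le_rfl, sq_one h0 h1]; linarith),
            unshearSquare_of_le _ _ (by rw [sq_zero le_rfl zero_le_one, sq_one h0 h1]; linarith),
            sq_zero zero_le_one le_rfl, sq_one h0 h1, sq_zero le_rfl zero_le_one, sq_one h0 h1]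
          change _ = O.point (O.h⁻¹ (O.h i)) _
          rw [Equiv.Perm.inv_def, Equiv.symm_apply_apply]
          congr 2
          ring)
        (fun i s h0 h1 => by
          rw [unshearSquare_of_le _ _ (by rw [sq_one zero_le_one le_rfl, sq_zero h0 h1]; linarith),
            unshearSquare_of_ge _ _ (by rw [sq_one le_rfl zero_le_one, sq_zero h0 h1]; linarith),
            sq_one zero_le_one le_rfl, sq_zero h0 h1, sq_one le_rfl zero_le_one, sq_zero h0 h1,
            point_top]
          simp only [shear, Equiv.Perm.mul_apply]
          congr 2
          ring)
      left_inv := fun x => by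
        obtain ⟨i, p, rfl⟩ := O.exists_point x
        obtain ⟨h1, h2, h3, h4⟩ := hm p
        change O.shear.mapOfSquares O.unshearSquare _ _ (O.shearSquare i p) = _
        rcases le_total (p.1 0 + p.1 1) 1 with h | h
        · rw [shearSquare_of_le _ _ h]
          change O.unshearSquare _ _ = _
          rw [unshearSquare_of_ge] <;> rw [sq_zero (by linarith) h, sq_one h3 h4]
          · rw [add_sub_cancel_right, sq_self]
          · linarith
        · rw [shearSquare_of_ge _ _ h]
          change O.unshearSquare _ _ = _
          rw [unshearSquare_of_le] <;> rw [sq_zero (by linarith) (by linarith), sq_one h3 h4]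
          · rw [Equiv.Perm.inv_def, Equiv.symm_apply_apply]
            congr 1
            rw [show p.1 0 + p.1 1 - 1 - p.1 1 + 1 = p.1 0 by ring, sq_self]
          · linarith
      right_inv := fun x => by
        obtain ⟨i, p, rfl⟩ := O.shear.exists_point x
        obtain ⟨h1, h2, h3, h4⟩ := hm p
        change O.mapOfSquares O.shearSquare _ _ (O.unshearSquare i p) = _
        rcases le_total (p.1 1) (p.1 0) with h | h
        · rw [unshearSquare_of_ge _ _ h]
          change O.shearSquare _ _ = _
          rw [shearSquare_of_le] <;> rw [sq_zero (by linarith) (by linarith), sq_one h3 h4]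
          · rw [sub_add_cancel, sq_self]
          · linarith
        · rw [unshearSquare_of_le _ _ h]
          change O.shearSquare _ _ = _
          rw [shearSquare_of_ge] <;> rw [sq_zero (by linarith) (by linarith), sq_one h3 h4]
          · rw [Equiv.Perm.inv_def, Equiv.apply_symm_apply]
            congr 1
            rw [show p.1 0 - p.1 1 + 1 + p.1 1 - 1 = p.1 0 by ring, sq_self]
          · linarith }
  have hc := continuous_square_apply
  refine AffinelyEquivalent.of_isPiecewiseAffine f
    (fun i => ⟨fun a => if a then {p | p.1 0 + p.1 1 ≤ 1} else {p | 1 ≤ p.1 0 + p.1 1},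
      fun a => if a then i else O.h i,
      fun a p => sq (p.1 0 + p.1 1 - if a then 0 else 1) (p.1 1), ?_, fun q => ?_,
      fun a => continuous_sq (((hc 0).add (hc 1)).sub continuous_const) (hc 1), ?_, ?_⟩)
    (fun i => ⟨fun a => if a then {p | p.1 1 ≤ p.1 0} else {p | p.1 0 ≤ p.1 1},
      fun a => if a then i else O.h⁻¹ i,
      fun a p => sq (p.1 0 - p.1 1 + if a then 0 else 1) (p.1 1), ?_, fun q => ?_,
      fun a => continuous_sq (((hc 0).sub (hc 1)).add continuous_const) (hc 1), ?_, ?_⟩)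
  · rintro (_ | _)
    · exact isClosed_le continuous_const ((hc 0).add (hc 1))
    · exact isClosed_le ((hc 0).add (hc 1)) continuous_const
  · rcases le_total (q.1 0 + q.1 1) 1 with h | h
    · exact ⟨true, h⟩
    · exact ⟨false, h⟩
  · rintro (_ | _) q hq
    · exact O.shearSquare_of_ge i hq
    · refine (O.shearSquare_of_le i hq).trans ?_
      simp
  · rw [Bool.forall_bool]
    constructor
    all_goals
      intro p hp q hq
      simp only [Bool.false_eq_true, if_true, if_false, Set.mem_ofPred_eq] at hp hq
      obtain ⟨h1, h2, h3, h4⟩ := hm p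
      obtain ⟨h1', h2', h3', h4'⟩ := hm q
      rw [act_T]
      refine eq_vec ((sq_sub_zero ?_ ?_ ?_ ?_).trans ?_) (sq_sub_one h3' h4' h3 h4)
    all_goals
      simp only [Bool.false_eq_true, if_true, if_false, Pi.sub_apply]
      linarith
  · rintro (_ | _)
    · exact isClosed_le (hc 0) (hc 1)
    · exact isClosed_le (hc 1) (hc 0)
  · rcases le_total (q.1 1) (q.1 0) with h | h
    · exact ⟨true, h⟩
    · exact ⟨false, h⟩
  · rintro (_ | _) q hq
    · exact O.unshearSquare_of_le i hq
    · refine (O.unshearSquare_of_ge i hq).trans ?_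
      simp
  · rw [Bool.forall_bool]
    constructor
    all_goals
      intro p hp q hq
      simp only [Bool.false_eq_true, if_true, if_false, Set.mem_ofPred_eq] at hp hq
      obtain ⟨h1, h2, h3, h4⟩ := hm p
      obtain ⟨h1', h2', h3', h4'⟩ := hm q
      rw [act_T_inv]
      refine eq_vec ((sq_sub_zero ?_ ?_ ?_ ?_).trans ?_) (sq_sub_one h3' h4' h3 h4)
    all_goals
      simp only [Bool.false_eq_true, if_true, if_false, Pi.sub_apply]
      linarith

end SquareTiled

/-! ### The action of `SL(2, ℤ)` on square-tiled surfaces -/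

namespace SquareTiled

variable {ι κ μ : Type}

/-- Two square-tiled surfaces differ by a relabelling of the squares. -/
def Isomorphic (O : SquareTiled ι) (O' : SquareTiled κ) : Prop :=
  ∃ e : ι ≃ κ, IsTileMap O O' e

lemma Isomorphic.affinelyEquivalent {O : SquareTiled ι} {O' : SquareTiled κ}
    (h : Isomorphic O O') : AffinelyEquivalent O O' 1 := by
  obtain ⟨e, he⟩ := h
  exact .of_isTileMap e he

/-- The range is invariant under `h` and `v` in both directions. -/
lemma IsTileMap.surjective [Nonempty ι] {O : SquareTiled ι} {O' : SquareTiled κ} {e : ι → κ}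
    (he : IsTileMap O O' e) (hO' : O'.IsTransitive) : Function.Surjective e := by
  rw [← Set.range_eq_univ]
  refine hO' _ (Set.range_nonempty e) (fun x => ⟨?_, ?_⟩) fun x => ⟨?_, ?_⟩
  · rintro ⟨i, hi⟩
    refine ⟨O.h⁻¹ i, O'.h.injective ?_⟩
    rw [← he.1, ← hi]
    simp
  · rintro ⟨i, rfl⟩
    exact ⟨O.h i, he.1 i⟩
  · rintro ⟨i, hi⟩
    refine ⟨O.v⁻¹ i, O'.v.injective ?_⟩
    rw [← he.2, ← hi]
    simp
  · rintro ⟨i, rfl⟩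
    exact ⟨O.v i, he.2 i⟩

lemma IsTileMap.isomorphic [Finite ι] [Nonempty ι] {O O' : SquareTiled ι} {e : ι → ι}
    (he : IsTileMap O O' e) (hO' : O'.IsTransitive) : Isomorphic O O' :=
  ⟨Equiv.ofBijective e
    (Finite.injective_iff_surjective.2 (he.surjective hO') |>.bijective_of_finite), he⟩

lemma AffinelyEquivalent.isomorphic [Finite ι] [Nonempty ι] {O O' : SquareTiled ι}
    (h : AffinelyEquivalent O O' 1) (hO : O.IsTransitive) (hO' : O'.IsTransitive)
    (hne : O.h * O.v ≠ O.v * O.h) : Isomorphic O O' := by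
  obtain ⟨f, hf⟩ := h
  obtain ⟨i, hi⟩ : ∃ i, O.h (O.v i) ≠ O.v (O.h i) := by
    by_contra! h
    exact hne (Equiv.ext h)
  obtain ⟨e, he⟩ := hf.exists_isTileMap hO hi
  exact he.isomorphic hO'

/-! ### Invariant families and stabilizers -/

/-- The surfaces `X j` represent, up to isomorphism, an invariant set of square-tiled surfaces
under the action of `SL(2, ℤ)`, on which the generators `S` and `T` act by `σ` and `τ`. -/
structure IsInvariantFamily {J : Type} (X : J → SquareTiled ι) (σ τ : J → J) : Prop where
  isTransitive : ∀ j, (X j).IsTransitive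
  mul_ne : ∀ j, (X j).h * (X j).v ≠ (X j).v * (X j).h
  rotate : ∀ j, Isomorphic (X j).rotate (X (σ j))
  shear : ∀ j, Isomorphic (X j).shear (X (τ j))
  surjective_rotate : Function.Surjective σ
  surjective_shear : Function.Surjective τ
  eq_of_isomorphic : ∀ j k, Isomorphic (X j) (X k) → j = k

variable {J : Type} {X : J → SquareTiled ι} {σ τ : J → J}

lemma IsInvariantFamily.affinelyEquivalent_S (hX : IsInvariantFamily X σ τ) (j : J) :
    AffinelyEquivalent (X j) (X (σ j)) (intCast ModularGroup.S) := by
  simpa using (affinelyEquivalent_rotate (X j)).trans (hX.rotate j).affinelyEquivalent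

lemma IsInvariantFamily.affinelyEquivalent_T (hX : IsInvariantFamily X σ τ) (j : J) :
    AffinelyEquivalent (X j) (X (τ j)) (intCast ModularGroup.T) := by
  simpa using (affinelyEquivalent_shear (X j)).trans (hX.shear j).affinelyEquivalent

/-- Induction over words in `S` and `T`. The statement is carried along with its version for `A⁻¹`;
for inverses of generators the surjectivity of `σ` and `τ` is needed. -/
lemma IsInvariantFamily.exists_affinelyEquivalent (hX : IsInvariantFamily X σ τ) (A : SL(2, ℤ)) :
    ∀ j, ∃ k, AffinelyEquivalent (X j) (X k) (intCast A) := by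
  have hA : A ∈ Subgroup.closure {ModularGroup.S, ModularGroup.T} := by
    rw [SpecialLinearGroup.SL2Z_generators]
    trivial
  suffices h : (∀ j, ∃ k, AffinelyEquivalent (X j) (X k) (intCast A)) ∧
      ∀ j, ∃ k, AffinelyEquivalent (X j) (X k) (intCast A⁻¹) from h.1
  induction hA using Subgroup.closure_induction with
  | mem A hA =>
    rcases hA with rfl | rfl
    · refine ⟨fun j => ⟨_, hX.affinelyEquivalent_S j⟩, fun j => ?_⟩
      obtain ⟨k, rfl⟩ := hX.surjective_rotate j
      exact ⟨k, by simpa using (hX.affinelyEquivalent_S k).symm⟩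
    · refine ⟨fun j => ⟨_, hX.affinelyEquivalent_T j⟩, fun j => ?_⟩
      obtain ⟨k, rfl⟩ := hX.surjective_shear j
      exact ⟨k, by simpa using (hX.affinelyEquivalent_T k).symm⟩
  | one =>
    have h : ∀ j, AffinelyEquivalent (X j) (X j) 1 := fun j =>
      Isomorphic.affinelyEquivalent ⟨Equiv.refl ι, fun _ => rfl, fun _ => rfl⟩
    exact ⟨fun j => ⟨j, by simpa using h j⟩, fun j => ⟨j, by simpa using h j⟩⟩
  | mul A B _ _ hA hB =>
    refine ⟨fun j => ?_, fun j => ?_⟩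
    · obtain ⟨k, hk⟩ := hB.1 j
      obtain ⟨l, hl⟩ := hA.1 k
      exact ⟨l, by simpa using hk.trans hl⟩
    · obtain ⟨k, hk⟩ := hA.2 j
      obtain ⟨l, hl⟩ := hB.2 k
      exact ⟨l, by simpa using hk.trans hl⟩
  | inv A _ hA => exact ⟨hA.2, by simpa using hA.1⟩

/-- The Veech group is the stabilizer of a surface of an invariant family. -/
theorem IsInvariantFamily.exists_stabilizer [Finite ι] [Nonempty ι]
    (hX : IsInvariantFamily X σ τ) {C : SquareTiled κ} {j₀ : J} (hC : Isomorphic C (X j₀))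
    (hsing : ∀ k, (X j₀).HasSingularSide k) :
    ∃ Γ : Subgroup SL(2, ℤ), C.veechGroup = Γ.map intCast ∧
      ∃ c : SL(2, ℤ) → J, c 1 = j₀ ∧ (∀ A, c (ModularGroup.S * A) = σ (c A)) ∧
        (∀ A, c (ModularGroup.T * A) = τ (c A)) ∧ ∀ A B, c A = c B ↔ A⁻¹ * B ∈ Γ := by
  have hC' := hC.affinelyEquivalent
  have hex : ∀ A : SL(2, ℤ), ∃ k, AffinelyEquivalent C (X k) (intCast A) := fun A => by
    obtain ⟨k, hk⟩ := hX.exists_affinelyEquivalent A j₀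
    exact ⟨k, by simpa using hC'.trans hk⟩
  choose c hc using hex
  -- Two members reached from `C` with the same derivative are related by an affine homeomorphism
  -- with derivative `1`, so rigidity makes them isomorphic.
  have huniq : ∀ A k, AffinelyEquivalent C (X k) (intCast A) → c A = k := fun A k hk =>
    hX.eq_of_isomorphic _ _ <| AffinelyEquivalent.isomorphic (by simpa using (hc A).symm.trans hk)
      (hX.isTransitive _) (hX.isTransitive _) (hX.mul_ne _)
  refine ⟨C.veechGroup.comap intCast, ?_, c, huniq _ _ (by simpa using hC'), fun A => huniq _ _ ?_,
    fun A => huniq _ _ ?_, fun A B => ⟨fun h => ?_, fun h => ?_⟩⟩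
  · refine le_antisymm (fun A hA => ?_) (Subgroup.map_comap_le _ _)
    have hA' : AffinelyEquivalent (X j₀) (X j₀) A := by
      simpa using (hC'.symm.trans hA).trans hC'
    obtain ⟨f, hf⟩ := hA'
    -- The singular sides in both directions make both columns of `A` integral.
    choose B hB using fun k l => hf.exists_int (hsing k) l
    have hdet : (Matrix.of fun l k => B k l).det = 1 := by
      have h := A.2
      rw [Matrix.det_fin_two, hB, hB, hB, hB] at h
      rw [Matrix.det_fin_two]
      simp only [Matrix.of_apply]
      exact_mod_cast h
    obtain ⟨A', rfl⟩ : ∃ A' : SL(2, ℤ), intCast A' = A := by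
      refine ⟨⟨Matrix.of fun l k => B k l, hdet⟩, ?_⟩
      ext l k
      exact (hB k l).symm
    exact ⟨A', hA, rfl⟩
  · simpa using (hc A).trans (hX.affinelyEquivalent_S _)
  · simpa using (hc A).trans (hX.affinelyEquivalent_T _)
  · rw [Subgroup.mem_comap, mem_veechGroup_iff]
    have := (hc B).trans (h ▸ (hc A).symm)
    simpa using this
  · rw [Subgroup.mem_comap, mem_veechGroup_iff] at h
    exact (huniq B _ (by simpa using h.trans (hc A))).symm

/-! #### Words in the generators -/

/-- The action of the generators `S` (for `false`) and `T` (for `true`). -/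
def move (O : SquareTiled ι) : Bool → SquareTiled ι
  | false => O.rotate
  | true => O.shear

lemma IsTransitive.move {O : SquareTiled ι} (hO : O.IsTransitive) (b : Bool) :
    (O.move b).IsTransitive := by
  cases b
  · intro s hs h1 h2
    refine hO s hs h2 fun i => ?_
    have := h1 (O.v i)
    simpa [SquareTiled.move, SquareTiled.rotate] using this.symm
  · intro s hs h1 h2
    refine hO s hs h1 fun i => ?_
    have h3 := h2 (O.h i)
    have h4 := h1 i
    rw [← h4]
    simpa [SquareTiled.move, SquareTiled.shear] using h3

lemma move_mul_ne {O : SquareTiled ι} (hO : O.h * O.v ≠ O.v * O.h) (b : Bool) :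
    (O.move b).h * (O.move b).v ≠ (O.move b).v * (O.move b).h := by
  cases b
  · intro h
    simp only [move, rotate] at h
    rw [inv_mul_eq_iff_eq_mul, ← mul_assoc, eq_mul_inv_iff_mul_eq] at h
    exact hO h
  · intro h
    simp only [move, shear] at h
    rw [inv_mul_cancel_right, ← mul_assoc, mul_inv_eq_iff_eq_mul] at h
    exact hO h

/-- The action of a word in the generators. -/
def moves (O : SquareTiled ι) (w : List Bool) : SquareTiled ι := w.foldr (fun b O => O.move b) O

lemma moves_isTransitive {O : SquareTiled ι} (hO : O.IsTransitive) (w : List Bool) :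
    (O.moves w).IsTransitive := by
  induction w with
  | nil => exact hO
  | cons b w ih => exact ih.move b

lemma moves_mul_ne {O : SquareTiled ι} (hO : O.h * O.v ≠ O.v * O.h) (w : List Bool) :
    (O.moves w).h * (O.moves w).v ≠ (O.moves w).v * (O.moves w).h := by
  induction w with
  | nil => exact hO
  | cons b w ih => exact move_mul_ne ih b

/-- Isomorphisms are compatible with the action of the generators. -/
lemma Isomorphic.move {O : SquareTiled ι} {O' : SquareTiled κ} (h : Isomorphic O O') (b : Bool) :
    Isomorphic (O.move b) (O'.move b) := by
  obtain ⟨e, he⟩ := h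
  have hh : ∀ i, e (O.h⁻¹ i) = O'.h⁻¹ (e i) := fun i => by
    rw [Equiv.Perm.eq_inv_iff_eq, ← he.1]
    simp
  have hv : ∀ i, e (O.v⁻¹ i) = O'.v⁻¹ (e i) := fun i => by
    rw [Equiv.Perm.eq_inv_iff_eq, ← he.2]
    simp
  refine ⟨e, ?_⟩
  cases b
  · exact ⟨hv, he.1⟩
  · refine ⟨he.1, fun i => ?_⟩
    change e (O.v (O.h⁻¹ i)) = O'.v (O'.h⁻¹ (e i))
    rw [he.2, hh]

lemma Isomorphic.symm {O : SquareTiled ι} {O' : SquareTiled κ} (h : Isomorphic O O') :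
    Isomorphic O' O := by
  obtain ⟨e, he⟩ := h
  exact ⟨e.symm, fun i => by rw [Equiv.symm_apply_eq, he.1, e.apply_symm_apply],
    fun i => by rw [Equiv.symm_apply_eq, he.2, e.apply_symm_apply]⟩

lemma Isomorphic.trans {O : SquareTiled ι} {O' : SquareTiled κ} {O'' : SquareTiled μ}
    (h : Isomorphic O O') (h' : Isomorphic O' O'') : Isomorphic O O'' := by
  obtain ⟨e, he⟩ := h
  obtain ⟨e', he'⟩ := h'
  exact ⟨e.trans e', fun i => by simp [he.1, he'.1], fun i => by simp [he.2, he'.2]⟩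

lemma Isomorphic.pow_eq_one {O : SquareTiled ι} {O' : SquareTiled κ} (h : Isomorphic O O') {n : ℕ}
    (hn : O.h ^ n = 1) : O'.h ^ n = 1 := by
  obtain ⟨e, he⟩ := h
  have hpow : ∀ n i, e ((O.h ^ n) i) = (O'.h ^ n) (e i) := fun n => by
    induction n with
    | zero => exact fun _ => rfl
    | succ n ih =>
      intro i
      rw [pow_succ', pow_succ', Equiv.Perm.mul_apply, Equiv.Perm.mul_apply, he.1, ih]
  ext i
  obtain ⟨i, rfl⟩ := e.surjective i
  rw [← hpow, hn]
  rfl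

/-- The action of a word in the generators on an index set. -/
def moveIndex (σ τ : J → J) (w : List Bool) (j : J) : J :=
  w.foldr (fun b j => if b then τ j else σ j) j

/-- A criterion for the surfaces `O.moves (w j)` to be an invariant family. The surfaces are
distinguished by the order of the horizontal permutation of their images. -/
theorem isInvariantFamily_of_moves [Finite J] {O : SquareTiled ι} (hO : O.IsTransitive)
    (hne : O.h * O.v ≠ O.v * O.h) (w : J → List Bool)
    (hσ : ∀ j, Isomorphic ((O.moves (w j)).move false) (O.moves (w (σ j))))
    (hτ : ∀ j, Isomorphic ((O.moves (w j)).move true) (O.moves (w (τ j))))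
    (hσs : Function.Surjective σ) (hτs : Function.Surjective τ) (n : ℕ) (test : List (List Bool))
    (htest : ∀ j k, (∀ u ∈ test, (O.moves (w (moveIndex σ τ u j))).h ^ n = 1 ↔
      (O.moves (w (moveIndex σ τ u k))).h ^ n = 1) → j = k) :
    IsInvariantFamily (fun j => O.moves (w j)) σ τ where
  isTransitive _ := moves_isTransitive hO _
  mul_ne _ := moves_mul_ne hne _
  rotate := hσ
  shear := hτ
  surjective_rotate := hσs
  surjective_shear := hτs
  eq_of_isomorphic j k hjk := by
    refine htest j k fun u hu => ?_
    clear hu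
    suffices h : Isomorphic (O.moves (w (moveIndex σ τ u j))) (O.moves (w (moveIndex σ τ u k))) from
      ⟨h.pow_eq_one, h.symm.pow_eq_one⟩
    induction u with
    | nil => exact hjk
    | cons b u ih =>
      cases b
      · exact ((hσ _).symm.trans (ih.move false)).trans (hσ _)
      · exact ((hτ _).symm.trans (ih.move true)).trans (hτ _)

end SquareTiled

/-! ### Cusp tables of subgroups that are given by the action on their cosets -/

section CuspTable

open ModularGroup Matrix.SpecialLinearGroup

/-- The image of the cusp `∞` under an element of `SL(2, ℤ)`. -/
noncomputable abbrev cuspOf (g : SL(2, ℤ)) : OnePoint ℝ := mapGL ℝ g • OnePoint.infty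

lemma mapGL_smul_cuspOf (g g' : SL(2, ℤ)) : mapGL ℝ g • cuspOf g' = cuspOf (g * g') := by
  rw [cuspOf, cuspOf, map_mul, mul_smul]

lemma cuspOf_mul_T_zpow (g : SL(2, ℤ)) (k : ℤ) : cuspOf (g * T ^ k) = cuspOf g := by
  rw [← mapGL_smul_cuspOf]
  congr 1
  rw [cuspOf, OnePoint.smul_infty_eq_self_iff]
  have h : (T ^ k : SL(2, ℤ)).1 1 0 = 0 := by
    rw [coe_T_zpow]
    rfl
  simpa [-map_zpow] using h

lemma exists_eq_T_zpow_of_cuspOf_eq_infty {g : SL(2, ℤ)} (h : cuspOf g = OnePoint.infty) :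
    ∃ k : ℤ, g = T ^ k ∨ g = -T ^ k := by
  rw [cuspOf, OnePoint.smul_infty_eq_self_iff] at h
  have h10 : g.1 1 0 = 0 := by
    simpa using h
  have hdet := g.2
  rw [Matrix.det_fin_two, h10, mul_zero, sub_zero] at hdet
  rcases Int.mul_eq_one_iff_eq_one_or_neg_one.1 hdet with ⟨h0, h1⟩ | ⟨h0, h1⟩
  · refine ⟨g.1 0 1, Or.inl ?_⟩
    ext i j
    fin_cases i <;> fin_cases j <;> simp [coe_T_zpow, h0, h1, h10]
  · refine ⟨-g.1 0 1, Or.inr ?_⟩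
    ext i j
    fin_cases i <;> fin_cases j <;> simp [coe_T_zpow, h0, h1, h10]

/-- The stabilizer of `∞` in `SL(2, ℤ)` consists of the matrices `±T ^ k`. -/
lemma exists_eq_mul_T_zpow {g g' : SL(2, ℤ)} (h : cuspOf g = cuspOf g') :
    ∃ k : ℤ, g = g' * T ^ k ∨ g = -(g' * T ^ k) := by
  have h' : cuspOf (g'⁻¹ * g) = OnePoint.infty := by
    rw [← mapGL_smul_cuspOf, h, mapGL_smul_cuspOf, inv_mul_cancel]
    simp [cuspOf]
  obtain ⟨k, hk | hk⟩ := exists_eq_T_zpow_of_cuspOf_eq_infty h'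
  · exact ⟨k, Or.inl (by rw [← hk, mul_inv_cancel_left])⟩
  · refine ⟨k, Or.inr ?_⟩
    rw [← mul_neg, ← hk, mul_inv_cancel_left]

/-- The element of `SL(2, ℤ)` given by a word in `S` (for `false`) and `T` (for `true`). -/
def wordMatrix (w : List Bool) : SL(2, ℤ) := (w.map fun b => if b then T else S).prod

variable {J : Type} {Γ : Subgroup SL(2, ℤ)} {c : SL(2, ℤ) → J} {σ τ : J → J}

lemma apply_wordMatrix (hS : ∀ A, c (S * A) = σ (c A)) (hT : ∀ A, c (T * A) = τ (c A))
    (w : List Bool) : c (wordMatrix w) = SquareTiled.moveIndex σ τ w (c 1) := by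
  induction w with
  | nil => rfl
  | cons b w ih =>
    rw [wordMatrix, List.map_cons, List.prod_cons, ← wordMatrix]
    cases b
    · exact (hS _).trans (congrArg σ ih)
    · exact (hT _).trans (congrArg τ ih)

lemma apply_T_pow (hT : ∀ A, c (T * A) = τ (c A)) (n : ℕ) (A : SL(2, ℤ)) :
    c (T ^ n * A) = τ^[n] (c A) := by
  induction n with
  | zero => simp
  | succ n ih => rw [pow_succ', mul_assoc, hT, ih, Function.iterate_succ_apply']

/-- Since `S ^ 2 = -1`, an involutive `σ` means that signs do not affect the coset. -/
lemma apply_neg (hσ : ∀ j, σ (σ j) = j) (hS : ∀ A, c (S * A) = σ (c A)) (A : SL(2, ℤ)) :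
    c (-A) = c A := by
  have h : S * (S * A) = -A := by
    rw [← mul_assoc, show S * S = -1 by decide]
    simp
  rw [← h, hS, hS, hσ]

/-! ### Orbits of `T` on the cosets, index and cusps -/

/-- The list `R` contains representatives of the orbits of `τ` on `J`, given by words that act on
the base point `j₀`, and the lengths of the orbits. -/
structure IsOrbitTable (σ τ : J → J) (j₀ : J) (R : List (List Bool × ℕ)) : Prop where
  involutive : ∀ j, σ (σ j) = j
  nodup : R.Nodup
  cover : ∀ j, ∃ e ∈ R, ∃ n < e.2, τ^[n] (SquareTiled.moveIndex σ τ e.1 j₀) = j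
  disjoint : ∀ e ∈ R, ∀ e' ∈ R, ∀ n < e.2,
    τ^[n] (SquareTiled.moveIndex σ τ e.1 j₀) = SquareTiled.moveIndex σ τ e'.1 j₀ → e = e' ∧ n = 0
  periodic : ∀ e ∈ R, 0 < e.2 ∧
    τ^[e.2] (SquareTiled.moveIndex σ τ e.1 j₀) = SquareTiled.moveIndex σ τ e.1 j₀

lemma apply_T_zpow_of_periodic (hT : ∀ A, c (T * A) = τ (c A))
    (hΓ : ∀ A B, c A = c B ↔ A⁻¹ * B ∈ Γ) {A : SL(2, ℤ)} {w : ℕ} (hw : 0 < w)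
    (hA : τ^[w] (c A) = c A) (k : ℤ) : ∃ n < w, c (T ^ k * A) = τ^[n] (c A) := by
  have h1 : A⁻¹ * T ^ w * A ∈ Γ := by
    rw [mul_assoc, ← hΓ, apply_T_pow hT, hA]
  have h2 : ∀ q : ℤ, c (T ^ ((w : ℤ) * q) * A) = c A := fun q => by
    rw [eq_comm, hΓ, ← mul_assoc, zpow_mul, zpow_natCast]
    have h3 := Γ.zpow_mem h1 q
    rwa [show A⁻¹ * T ^ w * A = A⁻¹ * T ^ w * A⁻¹⁻¹ by rw [inv_inv], conj_zpow, inv_inv] at h3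
  have hw' : (w : ℤ) ≠ 0 := by exact_mod_cast hw.ne'
  obtain ⟨n, hn⟩ := Int.eq_ofNat_of_zero_le (Int.emod_nonneg k hw')
  have hlt := Int.emod_lt_of_pos k (by exact_mod_cast hw : (0 : ℤ) < w)
  refine ⟨n, by omega, ?_⟩
  rw [← Int.emod_add_mul_ediv k w, hn, zpow_add, mul_assoc, zpow_natCast, apply_T_pow hT, h2]

theorem index_eq_card [Finite J] (hT : ∀ A, c (T * A) = τ (c A))
    (hS : ∀ A, c (S * A) = σ (c A)) (hΓ : ∀ A B, c A = c B ↔ A⁻¹ * B ∈ Γ)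
    {R : List (List Bool × ℕ)} (hR : IsOrbitTable σ τ (c 1) R) : Γ.index = Nat.card J := by
  rw [Subgroup.index]
  refine Nat.card_congr (Equiv.ofBijective
    (Quotient.lift c fun A B h => (hΓ A B).2 (QuotientGroup.leftRel_apply.1 h)) ⟨?_, ?_⟩)
  · rintro ⟨A⟩ ⟨B⟩ h
    exact Quotient.sound (QuotientGroup.leftRel_apply.2 ((hΓ A B).1 h))
  · intro j
    obtain ⟨e, -, n, -, h⟩ := hR.cover j
    refine ⟨Quotient.mk _ (T ^ n * wordMatrix e.1), ?_⟩
    change c _ = j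
    rw [apply_T_pow hT, apply_wordMatrix hS hT, h]

/-- The map `c` separates left cosets `A Γ` and `T` multiplies from the left, so an orbit of `τ` is
a double coset of `⟨T⟩` and `Γ`. A cusp `g • ∞` modulo `Γ` corresponds to the coset of `g⁻¹` modulo
`⟨T⟩`; this is why the inverses of the words appear. -/
theorem isCuspTable_of_isOrbitTable [Γ.FiniteIndex] (hT : ∀ A, c (T * A) = τ (c A))
    (hS : ∀ A, c (S * A) = σ (c A)) (hΓ : ∀ A B, c A = c B ↔ A⁻¹ * B ∈ Γ)
    {R : List (List Bool × ℕ)} (hR : IsOrbitTable σ τ (c 1) R) :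
    IsCuspTable Γ (R.map fun e => (cuspOf (wordMatrix e.1)⁻¹, e.2)) := by
  have hcusp : ∀ x : OnePoint ℝ, IsCusp x (Γ : Subgroup (GL (Fin 2) ℝ)) ↔ ∃ g, x = cuspOf g :=
    fun x => by rw [Subgroup.IsArithmetic.isCusp_iff_isCusp_SL2Z, isCusp_SL2Z_iff']
  have hmove : ∀ e : List Bool × ℕ, c (wordMatrix e.1) = SquareTiled.moveIndex σ τ e.1 (c 1) :=
    fun e => apply_wordMatrix hS hT e.1
  have hper : ∀ e ∈ R, 0 < e.2 ∧ τ^[e.2] (c (wordMatrix e.1)) = c (wordMatrix e.1) := by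
    simpa only [hmove] using hR.periodic
  -- every cusp is equivalent to a cusp of the list
  have hex : ∀ g, ∃ e ∈ R, ∃ γ ∈ Γ, cuspOf (γ * (wordMatrix e.1)⁻¹) = cuspOf g :=
    fun g => by
    obtain ⟨e, he, n, -, hn⟩ := hR.cover (c g⁻¹)
    rw [← hmove, ← apply_T_pow hT, hΓ] at hn
    refine ⟨e, he, _, Γ.inv_mem hn, ?_⟩
    rw [← cuspOf_mul_T_zpow g n]
    simp only [mul_inv_rev, inv_inv, zpow_natCast, mul_assoc, mul_inv_cancel, mul_one]
  -- different cusps of the list are not equivalent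
  have huniq : ∀ e ∈ R, ∀ e' ∈ R, ∀ γ ∈ Γ,
      cuspOf (γ * (wordMatrix e.1)⁻¹) = cuspOf (wordMatrix e'.1)⁻¹ → e = e' := by
    intro e he e' he' γ hγ h
    obtain ⟨k, hk⟩ := exists_eq_mul_T_zpow h
    have h1 : c (wordMatrix e.1 * γ⁻¹) = c (T ^ (-k) * wordMatrix e'.1) := by
      rw [show wordMatrix e.1 * γ⁻¹ = (γ * (wordMatrix e.1)⁻¹)⁻¹ by group]
      rcases hk with hk | hk
      · rw [hk]
        congr 1
        group
      · rw [hk, ← apply_neg hR.involutive hS]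
        congr 1
        rw [inv_neg, neg_neg]
        group
    have h2 : c (wordMatrix e.1) = c (wordMatrix e.1 * γ⁻¹) := by
      rw [hΓ, inv_mul_cancel_left]
      exact Γ.inv_mem hγ
    obtain ⟨n, hn, h3⟩ := apply_T_zpow_of_periodic hT hΓ (hper e' he').1 (hper e' he').2 (-k)
    rw [← h1, ← h2, hmove, hmove] at h3
    exact (hR.disjoint e' he' e he n hn h3.symm).1.symm
  set L := R.map fun e => (cuspOf (wordMatrix e.1)⁻¹, e.2) with hL
  have hLmem : ∀ x, x ∈ L ↔ ∃ e ∈ R, (cuspOf (wordMatrix e.1)⁻¹, e.2) = x := fun x => List.mem_map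
  have hLcusp : ∀ x ∈ L, IsCusp x.1 (Γ : Subgroup (GL (Fin 2) ℝ)) := by
    intro x hx
    obtain ⟨e, -, rfl⟩ := (hLmem x).1 hx
    exact (hcusp _).2 ⟨_, rfl⟩
  have hLuniq : ∀ x ∈ L, ∀ y ∈ L, ∀ γ ∈ (Γ : Subgroup (GL (Fin 2) ℝ)), γ • x.1 = y.1 → x = y := by
    rintro x hx y hy _ ⟨γ, hγ, rfl⟩ h
    obtain ⟨e, he, rfl⟩ := (hLmem x).1 hx
    obtain ⟨e', he', rfl⟩ := (hLmem y).1 hy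
    change mapGL ℝ γ • _ = _ at h
    rw [mapGL_smul_cuspOf] at h
    rw [huniq e he e' he' γ hγ h]
  have hLex : ∀ x, IsCusp x (Γ : Subgroup (GL (Fin 2) ℝ)) →
      ∃ e ∈ L, ∃ γ ∈ (Γ : Subgroup (GL (Fin 2) ℝ)), γ • e.1 = x := by
    intro x hx
    obtain ⟨g, rfl⟩ := (hcusp x).1 hx
    obtain ⟨e, he, γ, hγ, h⟩ := hex g
    refine ⟨_, (hLmem _).2 ⟨e, he, rfl⟩, _, ⟨γ, hγ, rfl⟩, ?_⟩
    change mapGL ℝ γ • _ = _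
    rw [mapGL_smul_cuspOf]
    exact h
  have hLnodup : L.Nodup := by
    refine hR.nodup.map_on fun e he e' he' h => huniq e he e' he' 1 Γ.one_mem ?_
    rw [one_mul]
    exact congrArg Prod.fst h
  refine ⟨?_, hLcusp, fun x hx => ?_, fun x hx g hg => ?_⟩
  · classical
    rw [← List.toFinset_card_of_nodup hLnodup, ← Nat.card_eq_finsetCard]
    refine (Nat.card_congr (Equiv.ofBijective
      (fun x : {x // x ∈ L.toFinset} => (Quotient.mk _ ⟨x.1.1, hLcusp _ (List.mem_toFinset.1 x.2)⟩ :
        CuspOrbits (Γ : Subgroup (GL (Fin 2) ℝ)))) ⟨?_, ?_⟩)).symm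
    · rintro ⟨x, hx⟩ ⟨y, hy⟩ h
      obtain ⟨γ, hγ⟩ := Quotient.exact h
      exact (Subtype.ext (hLuniq y (List.mem_toFinset.1 hy) x (List.mem_toFinset.1 hx) γ.1 γ.2
        (congrArg Subtype.val hγ))).symm
    · rintro ⟨x, hx⟩
      obtain ⟨e, he, γ, hγ, h⟩ := hLex x hx
      exact ⟨⟨e, List.mem_toFinset.2 he⟩, (Quotient.sound
        (s := MulAction.orbitRel _ (cuspsSubMulAction _)) ⟨⟨γ, hγ⟩, Subtype.ext h⟩).symm⟩
  · obtain ⟨e, he, γ, hγ, h⟩ := hLex x hx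
    refine ⟨e, ⟨he, γ, hγ, h⟩, ?_⟩
    rintro e' ⟨he', γ', hγ', h'⟩
    refine hLuniq e' he' e he (γ⁻¹ * γ') (mul_mem (inv_mem hγ) hγ') ?_
    rw [mul_smul, h', ← h, inv_smul_smul]
  · obtain ⟨e, he, rfl⟩ := (hLmem x).1 hx
    obtain ⟨k, hk⟩ := exists_eq_mul_T_zpow hg
    -- Any other `g` with the same cusp differs by a factor `±T ^ k` on the right, which commutes
    -- with `T ^ n`; the width is independent of `g`.
    have hconj : ∀ n : ℕ, g * T ^ n * g⁻¹ = (wordMatrix e.1)⁻¹ * (T ^ n * wordMatrix e.1) := by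
      intro n
      have h : ∀ B : SL(2, ℤ), B * T ^ k * T ^ n * (B * T ^ k)⁻¹ = B * (T ^ n * B⁻¹) := fun B => by
        group
      rcases hk with rfl | rfl
      · rw [h, inv_inv]
      · rw [inv_neg, neg_mul, neg_mul_neg, h, inv_inv]
    have hmem : ∀ n : ℕ, (g * T ^ n * g⁻¹ ∈ Γ ∨ -(g * T ^ n * g⁻¹) ∈ Γ) ↔
        τ^[n] (c (wordMatrix e.1)) = c (wordMatrix e.1) := by
      intro n
      rw [hconj, ← mul_neg, ← hΓ, ← hΓ, apply_neg hR.involutive hS, or_self, apply_T_pow hT, eq_comm]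
    simp only [hmem]
    refine ⟨hper e he, ?_⟩
    rintro n ⟨hn0, hn⟩
    by_contra! hlt
    rw [hmove] at hn
    exact hn0.ne' (hR.disjoint e he e he n hlt hn).2

end CuspTable

/-! ### Square-tiled surfaces given by tables -/

namespace SquareTiled

/-- The tables of the permutations `h`, `h⁻¹`, `v` and `v⁻¹` of a square-tiled surface. -/
structure Tables where
  h : ℕ
  h' : ℕ
  v : ℕ
  v' : ℕ

namespace Tables

/-- The conjunction of `p 0`, …, `p (n - 1)`. -/
noncomputable def allBelow (p : ℕ → Bool) (n : ℕ) : Bool :=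
  Nat.rec (motive := fun _ => Bool) true (fun k ih => p k && ih) n

lemma allBelow_iff (p : ℕ → Bool) (n : ℕ) : allBelow p n = true ↔ ∀ i < n, p i = true := by
  induction n with
  | zero => simp [allBelow]
  | succ n ih =>
    change (p n && allBelow p n) = true ↔ _
    rw [Bool.and_eq_true, ih, Nat.forall_lt_succ_right, and_comm]

/-- A variant of `Nat.decidableBallLT` that is evaluated faster. -/
noncomputable instance decidableForallLT (n : ℕ) (p : ℕ → Prop) [DecidablePred p] :
    Decidable (∀ i < n, p i) :=
  decidable_of_iff (allBelow (fun i => decide (p i)) n = true) (by simp [allBelow_iff])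

/-! ### Tables encoded as natural numbers -/

/-- The entry of a table, which is encoded as a natural number with the digits `0, …, 255`. -/
def entry (c i : ℕ) : ℕ := c / 256 ^ i % 256

lemma entry_lt (c i : ℕ) : entry c i < 256 := Nat.mod_lt _ (by norm_num)

/-- The table of a map on `{0, …, n - 1}`. -/
noncomputable def tabulate (f : ℕ → ℕ) (n : ℕ) : ℕ :=
  Nat.rec (motive := fun _ => ℕ) 0 (fun k ih => ih + f k * 256 ^ k) n

lemma tabulate_lt {f : ℕ → ℕ} {n : ℕ} (hf : ∀ i < n, f i < 256) : tabulate f n < 256 ^ n := by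
  induction n with
  | zero => exact Nat.one_pos
  | succ n ih =>
    have h1 := ih fun i hi => hf i (by omega)
    have h2 := Nat.mul_le_mul_right (256 ^ n) (Nat.le_of_lt_succ (hf n (by omega)))
    change tabulate f n + f n * 256 ^ n < _
    rw [pow_succ]
    omega

lemma entry_tabulate {f : ℕ → ℕ} {n i : ℕ} (hf : ∀ i < n, f i < 256) (hi : i < n) :
    entry (tabulate f n) i = f i := by
  induction n with
  | zero => omega
  | succ n ih =>
    change (tabulate f n + f n * 256 ^ n) / 256 ^ i % 256 = f i
    have hf' : ∀ i < n, f i < 256 := fun i hi => hf i (by omega)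
    rcases Nat.lt_succ_iff_lt_or_eq.1 hi with hlt | rfl
    · obtain ⟨d, rfl⟩ := Nat.exists_eq_add_of_lt hlt
      rw [show f (i + d + 1) * 256 ^ (i + d + 1) = 256 ^ i * (256 * (256 ^ d * f (i + d + 1))) by ring,
        Nat.add_mul_div_left _ _ (by positivity), Nat.add_mul_mod_self_left]
      exact ih hf' hlt
    · rw [Nat.add_mul_div_right _ _ (by positivity), Nat.div_eq_of_lt (tabulate_lt hf'), zero_add,
        Nat.mod_eq_of_lt (hf i hi)]

/-- The table with the entries of a list. -/
noncomputable def ofList (l : List ℕ) : ℕ :=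
  List.rec (motive := fun _ => ℕ) 0 (fun x _ ih => x + 256 * ih) l

/-- The table of the inverse of an injective map on `{0, …, n - 1}`. -/
noncomputable def inverse (c n : ℕ) : ℕ :=
  Nat.rec (motive := fun _ => ℕ) 0 (fun k ih => ih + k * 256 ^ entry c k) n

/-- The tables describe the surface `O`. -/
def Represents {n : ℕ} (t : Tables) (O : SquareTiled (Fin n)) : Prop :=
  ∀ i : Fin n, entry t.h i = O.h i ∧ entry t.h' i = (O.h⁻¹ i : Fin n) ∧
    entry t.v i = O.v i ∧ entry t.v' i = (O.v⁻¹ i : Fin n)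

/-- The tables are those of a pair of permutations and their inverses. -/
def IsValid (n : ℕ) (t : Tables) : Prop :=
  ∀ i < n, (entry t.h i < n ∧ entry t.h' i < n ∧ entry t.v i < n ∧ entry t.v' i < n) ∧
    entry t.h' (entry t.h i) = i ∧ entry t.h (entry t.h' i) = i ∧
    entry t.v' (entry t.v i) = i ∧ entry t.v (entry t.v' i) = i

noncomputable instance (n : ℕ) (t : Tables) : Decidable (t.IsValid n) := by
  unfold IsValid
  exact decidableForallLT _ _

lemma IsValid.exists_represents {n : ℕ} {t : Tables} (ht : t.IsValid n) :
    ∃ O : SquareTiled (Fin n), t.Represents O :=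
  ⟨{  h := ⟨fun i => ⟨entry t.h i, (ht i i.2).1.1⟩, fun i => ⟨entry t.h' i, (ht i i.2).1.2.1⟩,
        fun i => Fin.ext (ht i i.2).2.1, fun i => Fin.ext (ht i i.2).2.2.1⟩
      v := ⟨fun i => ⟨entry t.v i, (ht i i.2).1.2.2.1⟩, fun i => ⟨entry t.v' i, (ht i i.2).1.2.2.2⟩,
        fun i => Fin.ext (ht i i.2).2.2.2.1, fun i => Fin.ext (ht i i.2).2.2.2.2⟩ },
    fun _ => ⟨rfl, rfl, rfl, rfl⟩⟩

/-- The action of the generators of `SL(2, ℤ)` on tables. -/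
noncomputable def move (n : ℕ) (t : Tables) : Bool → Tables
  | false => ⟨t.v', t.v, t.h, t.h'⟩
  | true => ⟨t.h, t.h', tabulate (fun i => entry t.v (entry t.h' i)) n,
      tabulate (fun i => entry t.h (entry t.v' i)) n⟩

/-- The action of a word in the generators of `SL(2, ℤ)` on tables. -/
noncomputable def moves (n : ℕ) (t : Tables) (w : List Bool) : Tables := w.foldr (fun b t => t.move n b) t

lemma Represents.move {n : ℕ} {t : Tables} {O : SquareTiled (Fin n)} (h : t.Represents O)
    (b : Bool) : (t.move n b).Represents (O.move b) := by
  intro i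
  cases b
  · exact ⟨(h i).2.2.2, by simpa [Tables.move, SquareTiled.move, rotate] using (h i).2.2.1,
      (h i).1, (h i).2.1⟩
  · refine ⟨(h i).1, (h i).2.1, ?_, ?_⟩
    · simp only [Tables.move]
      rw [entry_tabulate (fun _ _ => entry_lt _ _) i.2, (h i).2.1, (h _).2.2.1]
      rfl
    · simp only [Tables.move]
      rw [entry_tabulate (fun _ _ => entry_lt _ _) i.2, (h i).2.2.2, (h _).1]
      simp [SquareTiled.move, shear]

lemma Represents.moves {n : ℕ} {t : Tables} {O : SquareTiled (Fin n)} (h : t.Represents O)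
    (w : List Bool) : (t.moves n w).Represents (O.moves w) := by
  induction w with
  | nil => exact h
  | cons b w ih => exact ih.move b

/-- The squares are numbered so that going left or down from any square but `0` can lower the
number; descent ends at `0`. -/
lemma Represents.isTransitive {n : ℕ} {t : Tables} {O : SquareTiled (Fin n)} (h : t.Represents O)
    (ht : ∀ i < n, 0 < i → entry t.h' i < i ∨ entry t.v' i < i) : O.IsTransitive := by
  intro s ⟨i₀, hi₀⟩ h1 h2
  have hn : 0 < n := i₀.pos
  have key : ∀ i, ∀ hi : i < n, (⟨i, hi⟩ : Fin n) ∈ s ↔ (⟨0, hn⟩ : Fin n) ∈ s := by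
    intro i
    induction i using Nat.strong_induction_on with
    | _ i ih =>
      intro hi
      rcases Nat.eq_zero_or_pos i with rfl | hpos
      · rfl
      · rcases ht i hi hpos with hlt | hlt
        · have e := (h ⟨i, hi⟩).2.1
          simp only at e
          rw [e] at hlt
          rw [← ih _ hlt (Fin.is_lt _), ← h1 ⟨_, Fin.is_lt _⟩]
          simp
        · have e := (h ⟨i, hi⟩).2.2.2
          simp only at e
          rw [e] at hlt
          rw [← ih _ hlt (Fin.is_lt _), ← h2 ⟨_, Fin.is_lt _⟩]
          simp
  have h0 := (key i₀ i₀.2).1 hi₀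
  exact Set.eq_univ_of_forall fun i => (key i i.2).2 h0

/-- The table `e` maps the surface of `t` to the surface of `t'`. -/
def IsTableMap (n : ℕ) (t t' : Tables) (e : ℕ) : Prop :=
  ∀ i < n, entry e i < n ∧ entry e (entry t.h i) = entry t'.h (entry e i) ∧
    entry e (entry t.v i) = entry t'.v (entry e i)

noncomputable instance (n : ℕ) (t t' : Tables) (e : ℕ) : Decidable (IsTableMap n t t' e) := by
  unfold IsTableMap
  exact decidableForallLT _ _

lemma IsTableMap.exists_isTileMap {n : ℕ} {t t' : Tables} {e : ℕ} (he : IsTableMap n t t' e)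
    {O O' : SquareTiled (Fin n)} (h : t.Represents O) (h' : t'.Represents O') :
    ∃ f : Fin n → Fin n, IsTileMap O O' f := by
  refine ⟨fun i => ⟨entry e i, (he i i.2).1⟩, fun i => Fin.ext ?_, fun i => Fin.ext ?_⟩
  · have := (he i i.2).2.1
    rw [(h i).1] at this
    exact this.trans (h' ⟨_, (he i i.2).1⟩).1
  · have := (he i i.2).2.2
    rw [(h i).2.2.1] at this
    exact this.trans (h' ⟨_, (he i i.2).1⟩).2.2.1

/-- The inverse of `move`. -/
noncomputable def unmove (n : ℕ) (t : Tables) : Bool → Tables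
  | false => ⟨t.v, t.v', t.h', t.h⟩
  | true => ⟨t.h, t.h', tabulate (fun i => entry t.v (entry t.h i)) n,
      tabulate (fun i => entry t.h' (entry t.v' i)) n⟩

/-- The inverse of `moves`. -/
noncomputable def unmoves (n : ℕ) (t : Tables) (w : List Bool) : Tables := w.foldl (unmove n) t

/-- The map from the surface of `t` to the surface of `t'` that maps the square `0` to `y`, if it
exists and the square `0` of `t` can be reached from every square by decreasing numbers. -/
noncomputable def relabelling (n : ℕ) (t t' : Tables) (y : ℕ) : ℕ :=
  Nat.rec (motive := fun _ => ℕ) y (fun i e => e +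
    (if entry t.h' (i + 1) < i + 1 then entry t'.h (entry e (entry t.h' (i + 1)))
      else entry t'.v (entry e (entry t.v' (i + 1)))) * 256 ^ (i + 1)) (n - 1)

/-! ### Invariant families given by tables -/

/-- The data of an invariant family of square-tiled surfaces: they are obtained from the surface
of the tables by the words `word j`. -/
structure IsInvariantFamily (n m : ℕ) (t : Tables) (word : Fin m → List Bool) (σ τ : Fin m → Fin m)
    (bases : List ℕ) (p : ℕ) (special : List (Fin m)) (test : List (List Bool)) : Prop where
  valid : t.IsValid n
  reach : ∀ i < n, 0 < i → entry t.h' i < i ∨ entry t.v' i < i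
  singular_h : ∃ i < n, entry t.h (entry t.v i) ≠ entry t.v (entry t.h i) ∧
    entry t.h (entry t.v (entry t.h i)) ≠ entry t.v (entry t.h (entry t.h i))
  singular_v : ∃ i < n, entry t.h (entry t.v i) ≠ entry t.v (entry t.h i) ∧
    entry t.h (entry t.v (entry t.v i)) ≠ entry t.v (entry t.h (entry t.v i))
  -- A relabelling commutes with the moves, so one that starts at `t.moves n w` can be sought from
  -- `t` to the target with `w` undone. On `t` the descending numbering determines it by the image
  -- `y` of the square `0`. Only the resulting table is checked, so `unmoves` and `relabelling` need
  -- no correctness proof.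
  move : ∀ j b, ∃ y ∈ bases,
    IsTableMap n (t.moves n (word (if b then τ j else σ j))) ((t.moves n (word j)).move n b)
      (relabelling n t
        (((t.moves n (word j)).move n b).unmoves n (word (if b then τ j else σ j))) y)
  surjective_rotate : Function.Surjective σ
  surjective_shear : Function.Surjective τ
  mem_special_iff : ∀ j, j ∈ special ↔
    ∀ i < n, (entry (t.moves n (word j)).h)^[p] i = i
  eq_of_test : ∀ j k, (∀ u ∈ test, moveIndex σ τ u j ∈ special ↔ moveIndex σ τ u k ∈ special) → j = k

variable {n m : ℕ} {t : Tables} {word : Fin m → List Bool} {σ τ : Fin m → Fin m} {bases : List ℕ}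
  {p : ℕ} {special : List (Fin m)} {test : List (List Bool)}

lemma Represents.pow_eq_one_iff {O : SquareTiled (Fin n)} (h : t.Represents O) (p : ℕ) :
    O.h ^ p = 1 ↔ ∀ i < n, (entry t.h)^[p] i = i := by
  have key : ∀ i : Fin n, (entry t.h)^[p] i = ((O.h ^ p) i : Fin n) := fun i => by
    induction p with
    | zero => rfl
    | succ p ih => rw [Function.iterate_succ_apply', ih, (h _).1, pow_succ', Equiv.Perm.mul_apply]
  constructor
  · intro h1 i hi
    rw [key ⟨i, hi⟩, h1]
    rfl
  · intro h1
    ext i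
    rw [← key, h1 i i.2]
    rfl

lemma IsInvariantFamily.hasSingularSide
    (ht : IsInvariantFamily n m t word σ τ bases p special test) {O : SquareTiled (Fin n)}
    (hO : t.Represents O) (k : Fin 2) : O.HasSingularSide k := by
  have hne : ∀ i : Fin n, entry t.h (entry t.v i) ≠ entry t.v (entry t.h i) →
      O.h (O.v i) ≠ O.v (O.h i) := fun i hi h => hi <| by
    rw [(hO i).1, (hO i).2.2.1, (hO _).1, (hO _).2.2.1, h]
  fin_cases k
  · obtain ⟨i, hi, h1, h2⟩ := ht.singular_h
    refine ⟨⟨i, hi⟩, hne _ h1, hne _ ?_⟩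
    change entry t.h (entry t.v (O.h ⟨i, hi⟩ : Fin n)) ≠ entry t.v (entry t.h (O.h ⟨i, hi⟩ : Fin n))
    rw [← (hO _).1]
    exact h2
  · obtain ⟨i, hi, h1, h2⟩ := ht.singular_v
    refine ⟨⟨i, hi⟩, hne _ h1, hne _ ?_⟩
    change entry t.h (entry t.v (O.v ⟨i, hi⟩ : Fin n)) ≠ entry t.v (entry t.h (O.v ⟨i, hi⟩ : Fin n))
    rw [← (hO _).2.2.1]
    exact h2

lemma IsInvariantFamily.isInvariantFamily
    (ht : IsInvariantFamily n m t word σ τ bases p special test) {O : SquareTiled (Fin n)}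
    (hO : t.Represents O) :
    SquareTiled.IsInvariantFamily (fun j => O.moves (word j)) σ τ := by
  have htrans := hO.isTransitive ht.reach
  obtain ⟨i, hi, -⟩ := ht.hasSingularSide hO 0
  have : Nonempty (Fin n) := ⟨i⟩
  have hmove : ∀ j b, Isomorphic ((O.moves (word j)).move b)
      (O.moves (word (if b then τ j else σ j))) := fun j b => by
    obtain ⟨y, -, hy⟩ := ht.move j b
    obtain ⟨f, hf⟩ := hy.exists_isTileMap (hO.moves _) ((hO.moves _).move _)
    exact (hf.isomorphic ((moves_isTransitive htrans _).move b)).symm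
  have hspecial : ∀ j, (O.moves (word j)).h ^ p = 1 ↔ j ∈ special := fun j => by
    rw [(hO.moves _).pow_eq_one_iff, ht.mem_special_iff]
  refine isInvariantFamily_of_moves htrans (fun h => hi (Equiv.congr_fun h i)) word
    (fun j => hmove j false) (fun j => hmove j true) ht.surjective_rotate ht.surjective_shear p test
    fun j k h => ht.eq_of_test j k ?_
  simpa only [hspecial] using h

/-- The Veech group of a square-tiled surface that is given by tables. -/
theorem IsInvariantFamily.hasVeechData {κ : Type}
    (ht : IsInvariantFamily n m t word σ τ bases p special test) {C : SquareTiled κ} {j₀ : Fin m}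
    (hC : ∀ O : SquareTiled (Fin n), t.Represents O → Isomorphic C (O.moves (word j₀)))
    {R : List (List Bool × ℕ)} (hR : IsOrbitTable σ τ j₀ R) {L : List (OnePoint ℝ × ℕ)}
    (hL : L = R.map fun e => (cuspOf (wordMatrix e.1)⁻¹, e.2)) (hj₀ : word j₀ = []) :
    HasVeechData C m L := by
  obtain ⟨O, hO⟩ := ht.valid.exists_represents
  obtain ⟨i, hi, -⟩ := ht.hasSingularSide hO 0
  have : Nonempty (Fin n) := ⟨i⟩
  obtain ⟨Γ, hΓ, c, hc1, hS, hT, hc⟩ := (ht.isInvariantFamily hO).exists_stabilizer (hC O hO)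
    (by
      simp only [hj₀]
      exact ht.hasSingularSide hO)
  have hR' : IsOrbitTable σ τ (c 1) R := hc1 ▸ hR
  have hindex := index_eq_card hT hS hc hR'
  rw [Nat.card_eq_fintype_card, Fintype.card_fin] at hindex
  have : Γ.FiniteIndex := ⟨by
    rw [hindex]
    exact j₀.pos.ne'⟩
  exact ⟨Γ, hΓ, this, hindex, hL ▸ isCuspTable_of_isOrbitTable hT hS hc hR'⟩

end Tables

/-! ### Components -/

variable {ι : Type} (O : SquareTiled ι) {X : Type}

lemma apply_eq_of_mem_tiles {i j : ι} {g : ι → X} (hh : ∀ i, g (O.h i) = g i)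
    (hv : ∀ i, g (O.v i) = g i) (hj : j ∈ O.tiles i) : g j = g i := by
  obtain ⟨⟨s, hs⟩, rfl⟩ := hj
  change g (s i) = g i
  induction hs using Subgroup.closure_induction generalizing i with
  | mem s hs =>
    rcases hs with rfl | rfl
    · exact hh i
    · exact hv i
  | one => rfl
  | mul s s' _ _ h h' => exact (h (i := s' i)).trans h'
  | inv s _ h => simpa using (h (i := s⁻¹ i)).symm

/-- A numbering of the squares that identifies every component with the surface of the tables. -/
lemma isomorphic_component {n : ℕ} (hn : 0 < n) {t : Tables} (ht : ∀ i < n, 0 < i →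
      Tables.entry t.h' i < i ∨ Tables.entry t.v' i < i) {O' : SquareTiled (Fin n)}
    (hO' : t.Represents O') (i₀ : ι) (lab : ι → ℕ)
    (hlab : ∀ i ∈ O.tiles i₀, ∀ j ∈ O.tiles i₀, lab i = lab j → i = j)
    (hh : ∀ i, lab (O.h i) = lab i / n * n + Tables.entry t.h (lab i % n))
    (hv : ∀ i, lab (O.v i) = lab i / n * n + Tables.entry t.v (lab i % n)) :
    Isomorphic (O.component i₀) O' := by
  have hlt : ∀ k, lab k % n < n := fun k => Nat.mod_lt _ hn
  have hh' : ∀ i, lab (O.h i) = lab i / n * n + (O'.h ⟨lab i % n, hlt i⟩ : Fin n) := fun i => by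
    rw [hh]
    exact congrArg _ (hO' ⟨lab i % n, hlt i⟩).1
  have hv' : ∀ i, lab (O.v i) = lab i / n * n + (O'.v ⟨lab i % n, hlt i⟩ : Fin n) := fun i => by
    rw [hv]
    exact congrArg _ (hO' ⟨lab i % n, hlt i⟩).2.2.1
  have hdiv : ∀ a (b : Fin n), (a * n + b) / n = a ∧ (a * n + b) % n = b := fun a b =>
    ⟨by rw [mul_comm, Nat.mul_add_div hn, Nat.div_eq_of_lt b.2, add_zero],
      by rw [mul_comm, Nat.mul_add_mod, Nat.mod_eq_of_lt b.2]⟩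
  let e : O.tiles i₀ → Fin n := fun i => ⟨lab i % n, hlt i⟩
  have he : IsTileMap (O.component i₀) O' e := by
    refine ⟨fun i => Fin.ext ?_, fun i => Fin.ext ?_⟩
    · change lab (O.h i) % n = _
      rw [hh', (hdiv _ _).2]
    · change lab (O.v i) % n = _
      rw [hv', (hdiv _ _).2]
  -- The quotient of the number by `n` names the component, the remainder the square in the table.
  have hdivconst : ∀ i ∈ O.tiles i₀, lab i / n = lab i₀ / n := fun i hi =>
    O.apply_eq_of_mem_tiles (g := fun i => lab i / n) (fun i => by rw [hh', (hdiv _ _).1])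
      (fun i => by rw [hv', (hdiv _ _).1]) hi
  have hinj : Function.Injective e := fun i j hij => by
    refine Subtype.ext (hlab i i.2 j j.2 ?_)
    rw [← Nat.div_add_mod (lab i) n, ← Nat.div_add_mod (lab j) n, hdivconst i i.2, hdivconst j j.2]
    exact congrArg _ (Fin.ext_iff.1 hij)
  have : Nonempty (O.tiles i₀) := ⟨⟨i₀, MulAction.mem_orbit_self i₀⟩⟩
  exact ⟨Equiv.ofBijective e ⟨hinj, he.surjective (hO'.isTransitive ht)⟩, he⟩

end SquareTiled

/-! ### The translation covers -/

namespace SquareTiled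

variable {D : Type} {n N : ℕ} {t : Tables} {O' : SquareTiled (Fin n)}

/-- The tables of a surface with cylinders of length `k`, with the given vertical permutation. -/
noncomputable def Tables.ofCylinders (n k : ℕ) (v : List ℕ) : Tables where
  h := tabulate (fun i => i - i % k + (i % k + 1) % k) n
  h' := tabulate (fun i => i - i % k + (i % k + (k - 1)) % k) n
  v := ofList v
  v' := inverse (ofList v) n

/-- The table `labels` numbers the squares of `O`, in the order given by `E`, such that every component
is identified with the surface of the tables `t`. -/
structure IsLabelling (O : SquareTiled D) (n : ℕ) (t : Tables) {r : ℕ} (E : D ≃ Fin r)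
    (labels : ℕ) : Prop where
  inverse : ∀ i < r, Tables.entry (Tables.inverse labels r) (Tables.entry labels i) = i
  right : ∀ d, Tables.entry labels (E (O.h d)) = Tables.entry labels (E d) / n * n +
    Tables.entry t.h (Tables.entry labels (E d) % n)
  top : ∀ d, Tables.entry labels (E (O.v d)) = Tables.entry labels (E d) / n * n +
    Tables.entry t.v (Tables.entry labels (E d) % n)

/-- The moves of `U` keep the direction, so a component lies over a single direction and a numbering
of `D` suffices. -/
lemma IsLabelling.isomorphic {O : SquareTiled D} {r : ℕ} {E : D ≃ Fin r} {labels : ℕ}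
    (h : IsLabelling O n t E labels) (hn : 0 < n)
    (ht : ∀ i < n, 0 < i → Tables.entry t.h' i < i ∨ Tables.entry t.v' i < i)
    (hO' : t.Represents O') (U : SquareTiled (D × ZMod N))
    (hU : ∀ x, U.h x = (O.h x.1, x.2)) (hU' : ∀ x, U.v x = (O.v x.1, x.2)) (i₀ : D × ZMod N) :
    Isomorphic (U.component i₀) O' := by
  have hsnd : ∀ i ∈ U.tiles i₀, i.2 = i₀.2 := fun i hi =>
    U.apply_eq_of_mem_tiles (g := Prod.snd) (fun i => by rw [hU]) (fun i => by rw [hU']) hi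
  have hinj : ∀ d d', Tables.entry labels (E d) = Tables.entry labels (E d') → d = d' := by
    intro d d' hd
    refine E.injective (Fin.ext ?_)
    rw [← h.inverse _ (E d).2, ← h.inverse _ (E d').2, hd]
  refine U.isomorphic_component hn ht hO' i₀ (fun x => Tables.entry labels (E x.1))
    (fun i hi j hj hij => Prod.ext (hinj _ _ hij) ((hsnd i hi).trans (hsnd j hj).symm))
    (fun i => ?_) (fun i => ?_)
  · rw [hU]
    exact h.right i.1
  · rw [hU']
    exact h.top i.1

lemma IsLabelling.squareCover {M : DartMap D} {r : ℕ} {E : D ≃ Fin r} {labels : ℕ}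
    (h : IsLabelling M.squares n t E labels) (hn : 0 < n)
    (ht : ∀ i < n, 0 < i → Tables.entry t.h' i < i ∨ Tables.entry t.v' i < i)
    (hO' : t.Represents O') (d : D) : Isomorphic (squareCover M d) O' := by
  -- The turning angles along the path from one lower side to the next add up to a multiple of `2 *
  -- π`.
  have e1 : ∀ θ : ZMod 4, θ + ((4 / 4 : ℕ) : ZMod 4) + ((4 / 2 : ℕ) : ZMod 4) +
      ((4 / 4 : ℕ) : ZMod 4) = θ := by decide
  have e2 : ∀ θ : ZMod 4, θ + ((4 / 4 : ℕ) : ZMod 4) + ((4 / 4 : ℕ) : ZMod 4) +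
      ((4 / 2 : ℕ) : ZMod 4) = θ := by decide
  exact h.isomorphic hn ht hO' _ (fun x => Prod.ext rfl (e1 x.2)) (fun x => Prod.ext rfl (e2 x.2)) _

lemma IsLabelling.rhombusCover60 {M : DartMap D} {r : ℕ} {E : D ≃ Fin r} {labels : ℕ}
    (h : IsLabelling M.rhombi60 n t E labels) (hn : 0 < n)
    (ht : ∀ i < n, 0 < i → Tables.entry t.h' i < i ∨ Tables.entry t.v' i < i)
    (hO' : t.Represents O') (d : D) : Isomorphic (rhombusCover60 M d) O' := by
  have e1 : ∀ θ : ZMod 6, θ + ((6 / 3 : ℕ) : ZMod 6) + ((6 / 2 : ℕ) : ZMod 6) +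
      ((6 / 3 : ℕ) : ZMod 6) + ((6 / 2 : ℕ) : ZMod 6) + ((6 / 3 : ℕ) : ZMod 6) = θ := by decide
  have e2 : ∀ θ : ZMod 6, θ + ((6 / 3 : ℕ) : ZMod 6) + ((6 / 2 : ℕ) : ZMod 6) +
      ((6 / 3 : ℕ) : ZMod 6) + ((6 / 3 : ℕ) : ZMod 6) + ((6 / 2 : ℕ) : ZMod 6) = θ := by decide
  exact h.isomorphic hn ht hO' _ (fun x => Prod.ext rfl (e1 x.2)) (fun x => Prod.ext rfl (e2 x.2)) _

lemma IsLabelling.rhombusCover120 {M : DartMap D} {r : ℕ} {E : D ≃ Fin r} {labels : ℕ}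
    (h : IsLabelling M.rhombi120 n t E labels) (hn : 0 < n)
    (ht : ∀ i < n, 0 < i → Tables.entry t.h' i < i ∨ Tables.entry t.v' i < i)
    (hO' : t.Represents O') (d : D) : Isomorphic (rhombusCover120 M d) O' := by
  have e1 : ∀ θ : ZMod 6, θ + ((6 / 3 : ℕ) : ZMod 6) + ((6 / 2 : ℕ) : ZMod 6) +
      ((6 / 3 : ℕ) : ZMod 6) + ((6 / 2 : ℕ) : ZMod 6) + ((6 / 3 : ℕ) : ZMod 6) = θ := by decide
  have e2 : ∀ θ : ZMod 6, θ + ((6 / 3 : ℕ) : ZMod 6) + ((6 / 3 : ℕ) : ZMod 6) +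
      ((6 / 2 : ℕ) : ZMod 6) + ((6 / 3 : ℕ) : ZMod 6) + ((6 / 2 : ℕ) : ZMod 6) = θ := by decide
  exact h.isomorphic hn ht hO' _ (fun x => Prod.ext rfl (e1 x.2)) (fun x => Prod.ext rfl (e2 x.2)) _

lemma cuspOf_wordMatrix_inv {w : List Bool} {a b : ℤ} (ha : (wordMatrix w)⁻¹.1 0 0 = a)
    (hb : (wordMatrix w)⁻¹.1 1 0 = b) (hb0 : b ≠ 0) :
    cuspOf (wordMatrix w)⁻¹ = ((a / b : ℝ) : OnePoint ℝ) := by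
  have h0 : (Matrix.SpecialLinearGroup.mapGL ℝ (wordMatrix w)⁻¹) 0 0 = (a : ℝ) := by
    rw [← ha]
    rfl
  have h1 : (Matrix.SpecialLinearGroup.mapGL ℝ (wordMatrix w)⁻¹) 1 0 = (b : ℝ) := by
    rw [← hb]
    rfl
  rw [cuspOf, OnePoint.smul_infty_eq_ite, h0, h1, if_neg (by exact_mod_cast hb0)]

lemma cuspOf_wordMatrix_nil_inv : cuspOf (wordMatrix [])⁻¹ = OnePoint.infty := by
  simp [cuspOf, wordMatrix]

end SquareTiled

/-! ### The five surfaces -/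

namespace SquareTiled

/-! #### Mucube -/

namespace MucubeCover

/-- The translation cover of Mucube. -/
noncomputable def tables : Tables := .ofCylinders 24 4 [
    4, 8, 12, 16, 20, 9, 2, 19, 23, 13, 3, 7, 22, 17, 0, 11, 21, 5, 1, 15, 14, 10, 6, 18]

/-- The squares of the unfolding of Mucube, component by component. -/
noncomputable def labels : ℕ := Tables.ofList [
    0, 24, 22, 46, 44, 20, 26, 2, 47, 14, 27, 6, 4, 25, 12, 45, 38, 21, 30, 1, 3, 28, 23, 36, 10,
    31, 18, 37, 39, 16, 29, 8, 5, 42, 15, 34, 32, 13, 40, 7, 35, 17, 41, 11, 9, 43, 19, 33]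

/-- The `48` darts form two components of `24` squares. -/
lemma isLabelling : IsLabelling (DartMap.squares mucube.toDartMap) 24 tables
    finProdFinEquiv labels where
  inverse := by decide +kernel
  right := by decide +kernel
  top := by decide +kernel

/-- Words in `S` (`false`) and `T` (`true`) for the orbit under `SL(2, ℤ)`. -/
def word : Fin 9 → List Bool := ![
    [], [true], [true, true], [false, true], [true, true, true], [false, true, true],
    [true, false, true], [true, false, true, true], [true, true, false, true]]

/-- The action of `S` on the orbit. -/
def σ : Fin 9 → Fin 9 := ![0, 3, 5, 1, 6, 2, 4, 8, 7]

/-- The action of `T` on the orbit. -/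
def τ : Fin 9 → Fin 9 := ![1, 2, 4, 6, 0, 7, 8, 5, 3]

/-- The shear keeps `h`, so the special indices are a union of orbits of `τ`, here the orbit of
length `2`. For the same reason a test word gains nothing from a leading `T`. -/
lemma isInvariantFamily : Tables.IsInvariantFamily 24 9 tables word σ τ [0] 2
    [5, 7]
    [
      [], [false, true, true, true, false], [false], [false, true, true, true], [false, true],
      [false, true, false]] where
  valid := by decide +kernel
  reach := by decide +kernel
  singular_h := by decide +kernel
  singular_v := by decide +kernel
  move := by decide +kernel
  surjective_rotate := by decide +kernel
  surjective_shear := by decide +kernel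
  mem_special_iff := by decide +kernel
  eq_of_test := by decide +kernel

/-- The inverse of `S * T ^ n * S` sends `∞` to `1 / n`; the words have `n = 2` and `n = 1`. -/
lemma isOrbitTable : IsOrbitTable σ τ 0 [
    ([], 4), ([false, true, true, false], 2), ([false, true, false], 3)] where
  involutive := by decide +kernel
  nodup := by decide +kernel
  cover := by decide +kernel
  disjoint := by decide +kernel
  periodic := by decide +kernel

theorem hasVeechData (d) : HasVeechData (squareCover mucube.toDartMap d) 9
    [
      (OnePoint.infty, 4), (((1 / 2 : ℝ) : OnePoint ℝ), 2), (((1 : ℝ) : OnePoint ℝ), 3)] := by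
  refine isInvariantFamily.hasVeechData (j₀ := 0) (fun O hO => ?_) isOrbitTable ?_ rfl
  · exact isLabelling.squareCover (by norm_num) isInvariantFamily.reach hO d
  · simp only [List.map_cons, List.map_nil, cuspOf_wordMatrix_nil_inv]
    rw [cuspOf_wordMatrix_inv (a := -1) (b := -2) (by decide +kernel) (by decide +kernel)
        (by norm_num),
      cuspOf_wordMatrix_inv (a := -1) (b := -1) (by decide +kernel) (by decide +kernel)
        (by norm_num)]
    norm_num

end MucubeCover

/-! #### Muoctahedron -/

namespace MuoctahedronCover

/-- The translation cover of Muoctahedron. -/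
noncomputable def tables : Tables := .ofCylinders 72 9 [
    9, 10, 18, 15, 16, 27, 12, 13, 36, 2, 45, 7, 8, 54, 4, 5, 63, 1, 58, 59, 30, 55, 56, 6, 61,
    62, 42, 49, 50, 39, 46, 47, 0, 52, 53, 24, 67, 68, 21, 64, 65, 3, 70, 71, 33, 31, 32, 57, 28,
    29, 14, 34, 35, 69, 22, 23, 66, 19, 20, 17, 25, 26, 51, 40, 41, 48, 37, 38, 11, 43, 44, 60]

/-- The squares of the unfolding of Muoctahedron, component by component. -/
noncomputable def labels : ℕ := Tables.ofList [
    0, 64, 62, 72, 136, 134, 39, 61, 10, 111, 133, 82, 24, 9, 65, 96, 81, 137, 54, 31, 41, 132,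
    79, 101, 45, 40, 23, 83, 100, 98, 63, 22, 32, 120, 97, 80, 51, 1, 38, 126, 103, 113, 17, 37,
    35, 117, 112, 95, 66, 34, 2, 135, 94, 104, 33, 15, 56, 78, 118, 143, 3, 55, 53, 102, 142, 85,
    21, 52, 16, 114, 84, 119, 60, 7, 29, 123, 73, 110, 11, 28, 26, 89, 109, 107, 48, 25, 8, 138,
    106, 74, 6, 46, 71, 90, 139, 122, 30, 70, 13, 108, 121, 131, 42, 12, 47, 99, 130, 140, 18,
    67, 50, 105, 87, 128, 36, 49, 59, 75, 127, 125, 27, 58, 68, 93, 124, 88, 57, 43, 5, 141, 76,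
    92, 69, 4, 20, 86, 91, 116, 14, 19, 44, 129, 115, 77]

/-- The `144` darts of the subdivision form two components of `72` rhombi. -/
lemma isLabelling : IsLabelling (DartMap.rhombi120 muoctahedron.toDartMap.subdivide) 72 tables
    ((finProdFinEquiv.prodCongr (Equiv.refl (Fin 3))).trans finProdFinEquiv) labels where
  inverse := by decide +kernel
  right := by decide +kernel
  top := by decide +kernel

/-- Words in `S` (`false`) and `T` (`true`) for the orbit under `SL(2, ℤ)`. -/
def word : Fin 16 → List Bool := ![
    [], [true], [false], [true, true], [false, true], [true, true, true], [false, true, true],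
    [true, false, true], [true, true, true, true], [false, true, true, true],
    [true, false, true, true], [true, true, false, true], [false, true, false, true],
    [false, true, true, true, true], [true, false, true, true, true],
    [true, true, false, true, true]]

/-- The action of `S` on the orbit. -/
def σ : Fin 16 → Fin 16 := ![2, 4, 0, 6, 1, 9, 3, 12, 13, 5, 11, 10, 7, 8, 15, 14]

/-- The action of `T` on the orbit. -/
def τ : Fin 16 → Fin 16 := ![1, 3, 0, 5, 7, 8, 10, 11, 9, 14, 15, 4, 2, 13, 12, 6]

/-- The special indices are those outside the orbit of `τ` of length `9`. -/
lemma isInvariantFamily : Tables.IsInvariantFamily 72 16 tables word σ τ [0, 1, 2] 6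
    [4, 6, 7, 10, 11, 13, 15]
    [
      [], [false], [false, true, true, true, false, true], [false, true, true],
      [false, true, true, false], [false, true, true, true, true]] where
  valid := by decide +kernel
  reach := by decide +kernel
  singular_h := by decide +kernel
  singular_v := by decide +kernel
  move := by decide +kernel
  surjective_rotate := by decide +kernel
  surjective_shear := by decide +kernel
  mem_special_iff := by decide +kernel
  eq_of_test := by decide +kernel

lemma isOrbitTable : IsOrbitTable σ τ 0 [
    ([], 9), ([false, true, true, true, true, true, false], 1), ([false, true, true, false], 3),
    ([false, true, true, true, true, true, true, true, false], 3)] where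
  involutive := by decide +kernel
  nodup := by decide +kernel
  cover := by decide +kernel
  disjoint := by decide +kernel
  periodic := by decide +kernel

theorem hasVeechData (d) : HasVeechData (rhombusCover120 muoctahedron.toDartMap.subdivide d) 16
    [
      (OnePoint.infty, 9), (((1 / 5 : ℝ) : OnePoint ℝ), 1), (((1 / 2 : ℝ) : OnePoint ℝ), 3),
      (((1 / 7 : ℝ) : OnePoint ℝ), 3)] := by
  refine isInvariantFamily.hasVeechData (j₀ := 0) (fun O hO => ?_) isOrbitTable ?_ rfl
  · exact isLabelling.rhombusCover120 (by norm_num) isInvariantFamily.reach hO d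
  · simp only [List.map_cons, List.map_nil, cuspOf_wordMatrix_nil_inv]
    rw [cuspOf_wordMatrix_inv (a := -1) (b := -5) (by decide +kernel) (by decide +kernel)
        (by norm_num),
      cuspOf_wordMatrix_inv (a := -1) (b := -2) (by decide +kernel) (by decide +kernel)
        (by norm_num),
      cuspOf_wordMatrix_inv (a := -1) (b := -7) (by decide +kernel) (by decide +kernel)
        (by norm_num)]
    norm_num

end MuoctahedronCover

/-! #### Mutetrahedron -/

namespace MutetrahedronCover

/-- The translation cover of Mutetrahedron. -/
noncomputable def tables : Tables := .ofCylinders 24 6 [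
    6, 12, 8, 9, 15, 11, 4, 5, 18, 1, 2, 21, 23, 0, 19, 20, 3, 22, 17, 7, 13, 14, 10, 16]

/-- The squares of the unfolding of Mutetrahedron, component by component. -/
noncomputable def labels : ℕ := Tables.ofList [
    0, 37, 53, 60, 16, 33, 45, 52, 6, 18, 32, 71, 55, 11, 38, 27, 70, 17, 24, 56, 5, 12, 40, 62,
    51, 4, 30, 42, 61, 23, 7, 35, 57, 69, 22, 41, 3, 28, 65, 48, 13, 47, 31, 64, 9, 21, 46, 54,
    66, 8, 29, 36, 59, 14, 39, 67, 2, 15, 25, 50, 63, 1, 44, 34, 49, 20, 10, 43, 68, 58, 19, 26]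

/-- The `72` darts of the subdivision form three components of `24` rhombi. -/
lemma isLabelling : IsLabelling (DartMap.rhombi60 mutetrahedron.toDartMap.subdivide) 24 tables
    ((finProdFinEquiv.prodCongr (Equiv.refl (Fin 3))).trans finProdFinEquiv) labels where
  inverse := by decide +kernel
  right := by decide +kernel
  top := by decide +kernel

/-- Words in `S` (`false`) and `T` (`true`) for the orbit under `SL(2, ℤ)`. -/
def word : Fin 4 → List Bool := ![
    [], [true], [true, true], [false, true, true]]

/-- The action of `S` on the orbit. -/
def σ : Fin 4 → Fin 4 := ![1, 0, 3, 2]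

/-- The action of `T` on the orbit. -/
def τ : Fin 4 → Fin 4 := ![1, 2, 0, 3]

lemma isInvariantFamily : Tables.IsInvariantFamily 24 4 tables word σ τ [0, 1, 2] 2
    [3]
    [
      [], [false], [false, true]] where
  valid := by decide +kernel
  reach := by decide +kernel
  singular_h := by decide +kernel
  singular_v := by decide +kernel
  move := by decide +kernel
  surjective_rotate := by decide +kernel
  surjective_shear := by decide +kernel
  mem_special_iff := by decide +kernel
  eq_of_test := by decide +kernel

lemma isOrbitTable : IsOrbitTable σ τ 0 [
    ([], 3), ([false, true, false], 1)] where
  involutive := by decide +kernel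
  nodup := by decide +kernel
  cover := by decide +kernel
  disjoint := by decide +kernel
  periodic := by decide +kernel

theorem hasVeechData (d) : HasVeechData (rhombusCover60 mutetrahedron.toDartMap.subdivide d) 4
    [
      (OnePoint.infty, 3), (((1 : ℝ) : OnePoint ℝ), 1)] := by
  refine isInvariantFamily.hasVeechData (j₀ := 0) (fun O hO => ?_) isOrbitTable ?_ rfl
  · exact isLabelling.rhombusCover60 (by norm_num) isInvariantFamily.reach hO d
  · simp only [List.map_cons, List.map_nil, cuspOf_wordMatrix_nil_inv]
    rw [cuspOf_wordMatrix_inv (a := -1) (b := -1) (by decide +kernel) (by decide +kernel)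
        (by norm_num)]
    norm_num

end MutetrahedronCover

/-! #### Octa-4 -/

namespace Octa4Cover

/-- The translation cover of Octa-4. -/
noncomputable def tables : Tables := .ofCylinders 48 3 [
    3, 6, 9, 12, 15, 18, 21, 14, 24, 16, 23, 27, 0, 30, 33, 36, 2, 39, 31, 38, 22, 1, 42, 45, 43,
    35, 17, 40, 47, 13, 29, 5, 44, 7, 28, 37, 4, 25, 46, 26, 11, 32, 20, 8, 41, 10, 19, 34]

/-- The squares of the unfolding of Octa-4, component by component. -/
noncomputable def labels : ℕ := Tables.ofList [
    0, 46, 41, 9, 35, 31, 7, 18, 11, 48, 94, 89, 5, 10, 24, 93, 74, 60, 91, 51, 95, 87, 62, 67,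
    82, 92, 50, 20, 16, 33, 38, 40, 6, 32, 1, 37, 68, 64, 81, 21, 36, 29, 63, 76, 90, 61, 70, 65,
    53, 58, 72, 25, 30, 23, 43, 3, 47, 15, 28, 42, 75, 56, 52, 34, 44, 2, 55, 66, 59, 86, 88, 54,
    27, 8, 4, 13, 22, 17, 45, 26, 12, 73, 78, 71, 39, 14, 19, 80, 49, 85, 57, 83, 79, 69, 84, 77]

/-- The faces are triangles already; the `96` darts form two components of `48` rhombi. -/
lemma isLabelling : IsLabelling (DartMap.rhombi120 octa4.toDartMap) 48 tables
    finProdFinEquiv labels where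
  inverse := by decide +kernel
  right := by decide +kernel
  top := by decide +kernel

/-- Words in `S` (`false`) and `T` (`true`) for the orbit under `SL(2, ℤ)`. -/
def word : Fin 4 → List Bool := ![
    [], [true], [false], [false, true]]

/-- The action of `S` on the orbit. -/
def σ : Fin 4 → Fin 4 := ![2, 3, 0, 1]

/-- The action of `T` on the orbit. -/
def τ : Fin 4 → Fin 4 := ![1, 2, 0, 3]

lemma isInvariantFamily : Tables.IsInvariantFamily 48 4 tables word σ τ [0] 3
    [0, 1, 2]
    [
      [], [false], [false, true]] where
  valid := by decide +kernel
  reach := by decide +kernel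
  singular_h := by decide +kernel
  singular_v := by decide +kernel
  move := by decide +kernel
  surjective_rotate := by decide +kernel
  surjective_shear := by decide +kernel
  mem_special_iff := by decide +kernel
  eq_of_test := by decide +kernel

lemma isOrbitTable : IsOrbitTable σ τ 0 [
    ([], 3), ([false, true, true, false], 1)] where
  involutive := by decide +kernel
  nodup := by decide +kernel
  cover := by decide +kernel
  disjoint := by decide +kernel
  periodic := by decide +kernel

theorem hasVeechData (d) : HasVeechData (rhombusCover120 octa4.toDartMap d) 4
    [
      (OnePoint.infty, 3), (((1 / 2 : ℝ) : OnePoint ℝ), 1)] := by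
  refine isInvariantFamily.hasVeechData (j₀ := 0) (fun O hO => ?_) isOrbitTable ?_ rfl
  · exact isLabelling.rhombusCover120 (by norm_num) isInvariantFamily.reach hO d
  · simp only [List.map_cons, List.map_nil, cuspOf_wordMatrix_nil_inv]
    rw [cuspOf_wordMatrix_inv (a := -1) (b := -2) (by decide +kernel) (by decide +kernel)
        (by norm_num)]
    norm_num

end Octa4Cover

/-! #### Truncated Octa-8 -/

namespace TruncatedOcta8Cover

/-- The translation cover of Truncated Octa-8. -/
noncomputable def tables : Tables := .ofCylinders 120 6 [
    6, 12, 18, 24, 30, 36, 42, 20, 48, 3, 54, 34, 60, 26, 66, 4, 53, 40, 72, 32, 78, 5, 71, 10,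
    84, 38, 90, 0, 83, 16, 96, 8, 102, 1, 95, 22, 108, 14, 55, 2, 107, 28, 114, 50, 73, 9, 101,
    58, 62, 56, 13, 11, 70, 46, 112, 44, 103, 7, 41, 52, 119, 68, 85, 15, 113, 51, 74, 49, 19,
    17, 82, 64, 118, 80, 97, 21, 47, 69, 86, 67, 25, 23, 94, 76, 117, 92, 109, 27, 65, 81, 98,
    79, 31, 29, 106, 88, 116, 104, 43, 33, 77, 93, 110, 91, 37, 35, 59, 100, 115, 57, 61, 39, 89,
    105, 87, 75, 63, 45, 111, 99]

/-- The squares of the unfolding of Truncated Octa-8, component by component. -/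
noncomputable def labels : ℕ := Tables.ofList [
    0, 103, 117, 70, 1, 56, 116, 82, 2, 49, 115, 94, 3, 67, 114, 106, 4, 79, 119, 59, 5, 91, 118,
    52, 46, 22, 26, 110, 47, 35, 25, 61, 42, 105, 24, 68, 43, 113, 29, 19, 44, 64, 28, 32, 45,
    71, 27, 102, 96, 81, 12, 57, 97, 89, 17, 7, 98, 112, 16, 20, 99, 54, 15, 78, 100, 10, 14, 86,
    101, 23, 13, 109, 36, 92, 72, 51, 37, 85, 77, 11, 38, 62, 76, 34, 39, 48, 75, 95, 40, 8, 74,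
    88, 41, 31, 73, 65, 111, 53, 21, 90, 50, 108, 93, 18, 63, 83, 33, 55, 60, 58, 30, 80, 107, 9,
    66, 87, 6, 104, 84, 69]

lemma isLabelling : IsLabelling (DartMap.squares truncatedOcta8.toDartMap) 120 tables
    finProdFinEquiv labels where
  inverse := by decide +kernel
  right := by decide +kernel
  top := by decide +kernel

/-- Words in `S` (`false`) and `T` (`true`) for the orbit under `SL(2, ℤ)`. -/
def word : Fin 15 → List Bool := ![
    [], [true], [true, true], [false, true], [true, true, true], [false, true, true],
    [true, false, true], [true, true, true, true], [false, true, true, true],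
    [true, false, true, true], [true, true, false, true], [false, true, false, true],
    [false, true, true, true, true], [true, false, true, true, true],
    [true, false, true, true, true, true]]

/-- The action of `S` on the orbit. -/
def σ : Fin 15 → Fin 15 := ![0, 3, 5, 1, 8, 2, 11, 12, 4, 10, 9, 6, 7, 14, 13]

/-- The action of `T` on the orbit. -/
def τ : Fin 15 → Fin 15 := ![1, 2, 4, 6, 7, 9, 10, 11, 13, 12, 3, 0, 14, 8, 5]

/-- The special indices are the orbit of `τ` of length `3`. -/
lemma isInvariantFamily : Tables.IsInvariantFamily 120 15 tables word σ τ [0] 3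
    [3, 6, 10]
    [
      [], [false, true, true, false], [false, true, true, true, true, false, true], [false],
      [false, true, true], [false, true, true, true, true, true, true], [false, true],
      [false, true, true, true, false], [false, true, true, true]] where
  valid := by decide +kernel
  reach := by decide +kernel
  singular_h := by decide +kernel
  singular_v := by decide +kernel
  move := by decide +kernel
  surjective_rotate := by decide +kernel
  surjective_shear := by decide +kernel
  mem_special_iff := by decide +kernel
  eq_of_test := by decide +kernel

/-- To send the cusps `3` and `4` to `∞` one uses `S * T⁻¹ ^ n` with `n = 3, 4`. Up to sign `T⁻¹` is
`S * T * S * T * S`, which turns this into a positive word; a leading `T` is dropped because it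
fixes `∞`. -/
lemma isOrbitTable : IsOrbitTable σ τ 0 [
    ([], 6), ([false, true, true, false, true, true, false, true, false], 2),
    ([false, true, false], 3),
    ([false, true, true, false, true, true, false, true, true, false, true, false], 4)] where
  involutive := by decide +kernel
  nodup := by decide +kernel
  cover := by decide +kernel
  disjoint := by decide +kernel
  periodic := by decide +kernel

theorem hasVeechData (d) : HasVeechData (squareCover truncatedOcta8.toDartMap d) 15
    [
      (OnePoint.infty, 6), (((3 : ℝ) : OnePoint ℝ), 2), (((1 : ℝ) : OnePoint ℝ), 3),
      (((4 : ℝ) : OnePoint ℝ), 4)] := by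
  refine isInvariantFamily.hasVeechData (j₀ := 0) (fun O hO => ?_) isOrbitTable ?_ rfl
  · exact isLabelling.squareCover (by norm_num) isInvariantFamily.reach hO d
  · simp only [List.map_cons, List.map_nil, cuspOf_wordMatrix_nil_inv]
    rw [cuspOf_wordMatrix_inv (a := -3) (b := -1) (by decide +kernel) (by decide +kernel)
        (by norm_num),
      cuspOf_wordMatrix_inv (a := -1) (b := -1) (by decide +kernel) (by decide +kernel)
        (by norm_num),
      cuspOf_wordMatrix_inv (a := -4) (b := -1) (by decide +kernel) (by decide +kernel)
        (by norm_num)]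
    norm_num

end TruncatedOcta8Cover

end SquareTiled

theorem mainTheorem2 :
    (∀ d, HasVeechData (squareCover mucube.toDartMap d) 9
      [(OnePoint.infty, 4), (((1 / 2 : ℝ) : OnePoint ℝ), 2), (((1 : ℝ) : OnePoint ℝ), 3)]) ∧
    (∀ d, HasVeechData (rhombusCover120 muoctahedron.toDartMap.subdivide d) 16
      [(OnePoint.infty, 9), (((1 / 5 : ℝ) : OnePoint ℝ), 1), (((1 / 2 : ℝ) : OnePoint ℝ), 3),
        (((1 / 7 : ℝ) : OnePoint ℝ), 3)]) ∧
    (∀ d, HasVeechData (rhombusCover60 mutetrahedron.toDartMap.subdivide d) 4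
      [(OnePoint.infty, 3), (((1 : ℝ) : OnePoint ℝ), 1)]) ∧
    (∀ d, HasVeechData (rhombusCover120 octa4.toDartMap d) 4
      [(OnePoint.infty, 3), (((1 / 2 : ℝ) : OnePoint ℝ), 1)]) ∧
    (∀ d, HasVeechData (squareCover truncatedOcta8.toDartMap d) 15
      [(OnePoint.infty, 6), (((3 : ℝ) : OnePoint ℝ), 2), (((1 : ℝ) : OnePoint ℝ), 3),
        (((4 : ℝ) : OnePoint ℝ), 4)]) :=
  ⟨SquareTiled.MucubeCover.hasVeechData,
    SquareTiled.MuoctahedronCover.hasVeechData,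
    SquareTiled.MutetrahedronCover.hasVeechData,
    SquareTiled.Octa4Cover.hasVeechData,
    SquareTiled.TruncatedOcta8Cover.hasVeechData⟩
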